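/- Let $(N,g)$ be a compact smooth Riemannian manifold without boundary of dimension $n\ge 2$, and let $M\subset N$ be a closed subset which is an $n$-dimensional submanifold with smooth boundary $\partial M$. Let $\nu$ be the outer unit normal of $\partial M$, let $SM=\{(x,v): x\in M,\ v\in T_xM,\ |v|_g=1\}$, and let $\partial(SM)=\{(x,v)\in SM: x\in\partial M\}=\partial_+(SM)\cup\partial_-(SM)$ with $\partial_\pm(SM)=\{(x,v)\in\partial(SM): \mp\langle\nu(x),v\rangle\ge 0\}$. Let $d\Sigma^{2n-2}=dV^{n-1}\wedge dS_x$ be the measure on $\partial(SM)$ given by the Riemannian measure $dV^{n-1}$ of $\partial M$ and the Riemannian measures $dS_x$ of the unit spheres $S_x\subset T_xM$. Let $\gamma(t,x,v)$ be the geodesic of $N$ with $\gamma(0,x,v)=x$, $\dot\gamma(0,x,v)=v$, let $\varphi_t(x,v)=(\gamma(t,x,v),\dot\gamma(t,x,v))$, and let $\tau(x,v)=\inf\{t>0:\gamma(t,x,v)\in N\setminus M\}\in[0,\infty]$. Assume that $M$ is non-trapping, i.e. $\tau<\infty$ on $SM$, and that $\partial M$ is strictly convex, i.e. its second fundamental form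 $(v,v)\mapsto\langle\nabla_v\nu,v\rangle$ is positive definite. Put $\tau^0_-(x,v)=\frac12(\tau(x,v)-\tau(x,-v))$ and let $\alpha(x,v)=\varphi_{2\tau^0_-(x,v)}(x,v)$ for $(x,v)\in\partial(SM)$ be the scattering relation. Then $\alpha$ is a well-defined map $\partial(SM)\to\partial(SM)$ which maps $\partial_+(SM)$ into $\partial_-(SM)$ and $\partial_-(SM)$ into $\partial_+(SM)$, it is Borel measurable, and it carries the measure $|\langle\nu,v\rangle|\,d\Sigma^{2n-2}$ on $\partial_+(SM)$ to the measure $|\langle\nu,v\rangle|\,d\Sigma^{2n-2}$ on $\partial_-(SM)$. Moreover, let $L^2_{|\mu|}(\partial(SM))$ and $L^2_\mu(\partial_+(SM))$ be the spaces of real-valued functions that are square integrable on $\partial(SM)$, respectively on $\partial_+(SM)$, with respect to $|\langle\nu,v\rangle|\,d\Sigma^{2n-2}$, and for a function $w$ on $\partial_+(SM)$ put $$A_\pm w=w\ \text{ on }\partial_+(SM),\qquad A_\pm w=\pm\, w\circ\alpha\ \text{ on }\partial_-(SM)\setminus\partial_+(SM).$$ Then $A_+$ and $A_-$ induce well-defined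 bounded linear operators $L^2_\mu(\partial_+(SM))\to L^2_{|\mu|}(\partial(SM))$, and $\|A_\pm w\|_{L^2_{|\mu|}(\partial(SM))}=\sqrt2\,\|w\|_{L^2_\mu(\partial_+(SM))}$ for all $w$. -/

import Mathlib

open MeasureTheory Bundle Set Filter
open scoped Manifold ContDiff ENNReal Topology

noncomputable section

namespace GeodesicScattering

/-- Riemannian metrics of class `C^∞` on a manifold `N` of dimension `d + 1` without boundary. -/
abbrev SmoothMetric (d : ℕ) (N : Type*) [TopologicalSpace N]
    [ChartedSpace (EuclideanSpace ℝ (Fin (d + 1))) N] [IsManifold (𝓡 (d + 1)) ∞ N] :=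
  ContMDiffRiemannianMetric (𝓡 (d + 1)) ∞ (EuclideanSpace ℝ (Fin (d + 1)))
    (fun x : N => TangentSpace (𝓡 (d + 1)) x)

section Definitions

variable {d : ℕ} {N : Type*} [TopologicalSpace N]
  [ChartedSpace (EuclideanSpace ℝ (Fin (d + 1))) N] [IsManifold (𝓡 (d + 1)) ∞ N]

/-! ### The metric and its Christoffel symbols in a chart -/

/-- The metric `g` in the chart `e`: the bilinear form `(u, w) ↦ g_{ij}(y) u^i w^j`. -/
def chartMetric (g : SmoothMetric d N)
    (e : OpenPartialHomeomorph N (EuclideanSpace ℝ (Fin (d + 1))))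
    (y u w : EuclideanSpace ℝ (Fin (d + 1))) : ℝ :=
  g.inner (e.symm y) (mfderiv (𝓡 (d + 1)) (𝓡 (d + 1)) e.symm y u)
    (mfderiv (𝓡 (d + 1)) (𝓡 (d + 1)) e.symm y w)

/-- The coordinates of a tangent vector `v` at `x` in the chart `e`, i.e. `de_x(v)`. -/
def chartVector (e : OpenPartialHomeomorph N (EuclideanSpace ℝ (Fin (d + 1)))) (x : N)
    (v : TangentSpace (𝓡 (d + 1)) x) : EuclideanSpace ℝ (Fin (d + 1)) :=
  mfderiv (𝓡 (d + 1)) (𝓡 (d + 1)) e x v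

/-- The Christoffel symbols of the first kind of `g` in the chart `e`,
`Γ(u, v; w) = (∂_u g(v, w) + ∂_v g(u, w) - ∂_w g(u, v)) / 2`.
For the Levi-Civita connection, in this chart, and for vector fields `U`, `V` with constant
coefficients `u`, `v` one has `⟨∇_U V, w⟩ = Γ(u, v; w)`. -/
def christoffel (g : SmoothMetric d N)
    (e : OpenPartialHomeomorph N (EuclideanSpace ℝ (Fin (d + 1))))
    (y u v w : EuclideanSpace ℝ (Fin (d + 1))) : ℝ :=
  (1 / 2 : ℝ) *
    (fderiv ℝ (fun z => chartMetric g e z v w) y u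
      + fderiv ℝ (fun z => chartMetric g e z u w) y v
      - fderiv ℝ (fun z => chartMetric g e z u v) y w)

/-! ### Geodesics and the geodesic flow of `N` -/

/-- `γ` is a (complete, affinely parametrized) geodesic: in every chart of the smooth structure,
`⟨γ'', w⟩ + Γ(γ', γ'; w) = 0` for all `w`, that is, `∇_{γ'} γ' = 0`. -/
def IsGeodesic (g : SmoothMetric d N) (γ : ℝ → N) : Prop :=
  ContMDiff 𝓘(ℝ, ℝ) (𝓡 (d + 1)) 2 γ ∧
  ∀ e ∈ IsManifold.maximalAtlas (𝓡 (d + 1)) ∞ N, ∀ t : ℝ, γ t ∈ e.source →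
    ∀ w : EuclideanSpace ℝ (Fin (d + 1)),
      chartMetric g e (e (γ t)) (deriv (deriv fun s => e (γ s)) t) w
        + christoffel g e (e (γ t)) (deriv (fun s => e (γ s)) t) (deriv (fun s => e (γ s)) t) w = 0

/-- The point `(γ(t), γ'(t))` of the tangent bundle. -/
def velocity (γ : ℝ → N) (t : ℝ) : TangentBundle (𝓡 (d + 1)) N :=
  ⟨γ t, mfderiv 𝓘(ℝ, ℝ) (𝓡 (d + 1)) γ t (1 : ℝ)⟩

open Classical in
/-- The geodesic `t ↦ γ(t, x, v)` with `γ(0) = x` and `γ'(0) = v`, where `p = (x, v)`.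
It exists and is unique when `N` is compact and Hausdorff. -/
def geodesic (g : SmoothMetric d N) (p : TangentBundle (𝓡 (d + 1)) N) : ℝ → N :=
  if h : ∃ γ : ℝ → N, IsGeodesic g γ ∧ velocity γ 0 = p then h.choose else fun _ => p.1

/-- The geodesic flow `φ_t(x, v) = (γ(t, x, v), γ'(t, x, v))`. -/
def geodesicFlow (g : SmoothMetric d N) (t : ℝ) (p : TangentBundle (𝓡 (d + 1)) N) :
    TangentBundle (𝓡 (d + 1)) N :=
  velocity (geodesic g p) t

/-- The reversal `(x, v) ↦ (x, -v)`. -/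
def reverse (p : TangentBundle (𝓡 (d + 1)) N) : TangentBundle (𝓡 (d + 1)) N := ⟨p.1, -p.2⟩

/-- The travel time `τ(x, v) = inf {t > 0 : γ(t, x, v) ∈ N \ M}`, with values in `[0, ∞]`. -/
def travelTime (g : SmoothMetric d N) (M : Set N) (p : TangentBundle (𝓡 (d + 1)) N) : ℝ≥0∞ :=
  ⨅ (t : ℝ) (_ : 0 < t ∧ geodesic g p t ∉ M), ENNReal.ofReal t

/-! ### Domains with smooth boundary -/

/-- A boundary chart for `M`: a chart of the smooth structure of `N` in which `M` is the part
`{y : 0 ≤ y_0}`. -/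
def IsBoundaryChart (M : Set N)
    (e : OpenPartialHomeomorph N (EuclideanSpace ℝ (Fin (d + 1)))) : Prop :=
  e ∈ IsManifold.maximalAtlas (𝓡 (d + 1)) ∞ N ∧ ∀ x ∈ e.source, x ∈ M ↔ 0 ≤ e x 0

variable (d) in
/-- `M` is a closed subset of `N` which is a submanifold with smooth boundary of codimension
zero; its boundary `∂M` is then the topological frontier of `M`. -/
def IsSmoothDomain (M : Set N) : Prop :=
  IsClosed M ∧ ∀ x ∈ frontier M,
    ∃ e : OpenPartialHomeomorph N (EuclideanSpace ℝ (Fin (d + 1))), IsBoundaryChart M e ∧ x ∈ e.source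

/-- `ν` is the outer unit normal of `M` at `x`: in boundary charts at `x`, it is orthogonal to
the tangent space `{v : v^0 = 0}` of `∂M` and points out of `M`. -/
def IsOuterUnitNormal (g : SmoothMetric d N) (M : Set N) (x : N)
    (ν : TangentSpace (𝓡 (d + 1)) x) : Prop :=
  g.inner x ν ν = 1 ∧
  ∀ e, IsBoundaryChart M e → x ∈ e.source →
    chartVector e x ν 0 < 0 ∧
    ∀ v : TangentSpace (𝓡 (d + 1)) x, chartVector e x v 0 = 0 → g.inner x ν v = 0

open Classical in
/-- The outer unit normal `ν(x)` at `x ∈ ∂M`. -/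
def outerNormal (g : SmoothMetric d N) (M : Set N) (x : N) : TangentSpace (𝓡 (d + 1)) x :=
  if h : ∃ ν, IsOuterUnitNormal g M x ν then h.choose else 0

/-- The boundary of `M` is strictly convex: its second fundamental form with respect to the outer
unit normal, `Π(v, v) = ⟨∇_v ν, v⟩ = -⟨ν, ∇_v V⟩` (`V` a tangential extension of `v`), is positive
definite. In a boundary chart `V` may be taken with constant coefficients, and
`Π(v, v) = -Γ(v, v; ν)`. -/
def HasStrictlyConvexBoundary (g : SmoothMetric d N) (M : Set N) : Prop :=
  ∀ e, IsBoundaryChart M e → ∀ x ∈ e.source, x ∈ frontier M →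
    ∀ v : EuclideanSpace ℝ (Fin (d + 1)), v 0 = 0 → v ≠ 0 →
      0 < -christoffel g e (e x) v v (chartVector e x (outerNormal g M x))

/-- `M` is non-trapping: `τ(x, v) < ∞` for all `(x, v) ∈ SM`. -/
def IsNonTrapping (g : SmoothMetric d N) (M : Set N) : Prop :=
  ∀ p : TangentBundle (𝓡 (d + 1)) N, p.1 ∈ M → g.inner p.1 p.2 p.2 = 1 → travelTime g M p < ⊤

/-! ### The boundary of the unit sphere bundle -/

/-- `∂(SM) = {(x, v) : x ∈ ∂M, |v|_g = 1}`. -/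
def boundarySM (g : SmoothMetric d N) (M : Set N) : Set (TangentBundle (𝓡 (d + 1)) N) :=
  {p | p.1 ∈ frontier M ∧ g.inner p.1 p.2 p.2 = 1}

/-- `∂₊(SM) = {(x, v) ∈ ∂(SM) : -⟨ν(x), v⟩ ≥ 0}`, the inward pointing unit vectors. -/
def inward (g : SmoothMetric d N) (M : Set N) : Set (boundarySM g M) :=
  {p | 0 ≤ -g.inner p.1.1 (outerNormal g M p.1.1) p.1.2}

/-- `∂₋(SM) = {(x, v) ∈ ∂(SM) : ⟨ν(x), v⟩ ≥ 0}`, the outward pointing unit vectors. -/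
def outward (g : SmoothMetric d N) (M : Set N) : Set (boundarySM g M) :=
  {p | 0 ≤ g.inner p.1.1 (outerNormal g M p.1.1) p.1.2}

/-! ### The measures -/

/-- The tangent bundle carries its Borel σ-algebra. -/
instance : MeasurableSpace (TangentBundle (𝓡 (d + 1)) N) := borel _

instance : BorelSpace (TangentBundle (𝓡 (d + 1)) N) := ⟨rfl⟩

/-- The point of `ℝ^{d+1}` with coordinates `(0, y)`. -/
def zeroCons (y : EuclideanSpace ℝ (Fin d)) : EuclideanSpace ℝ (Fin (d + 1)) :=
  WithLp.toLp 2 (Fin.cons 0 y.ofLp)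

/-- The Riemannian measure of `∂M` in a boundary chart `e`: the image under
`y ↦ e⁻¹(0, y)` of `√det(g_{ij}(0, y))_{1 ≤ i, j ≤ d} dy`. -/
def chartBoundaryVolume [MeasurableSpace N] (g : SmoothMetric d N)
    (e : OpenPartialHomeomorph N (EuclideanSpace ℝ (Fin (d + 1)))) : Measure N :=
  (((volume : Measure (EuclideanSpace ℝ (Fin d))).restrict {y | zeroCons y ∈ e.target}).withDensity
    fun y => ENNReal.ofReal (Real.sqrt (Matrix.det (Matrix.of fun i j : Fin d =>
      chartMetric g e (zeroCons y) (EuclideanSpace.single i.succ 1)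
        (EuclideanSpace.single j.succ 1))))).map
    fun y => e.symm (zeroCons y)

/-- The Riemannian measure `dV^{n-1}` of `∂M` (`n = d + 1`), as a measure on `N` that is
concentrated on `∂M`. The measures of the boundary charts agree on the overlaps of these charts;
their supremum is the measure that restricts to each of them. -/
def boundaryVolume [MeasurableSpace N] (g : SmoothMetric d N) (M : Set N) : Measure N :=
  ⨆ (e : OpenPartialHomeomorph N (EuclideanSpace ℝ (Fin (d + 1)))) (_ : IsBoundaryChart M e),
    chartBoundaryVolume g e

/-- The Lebesgue measure `√det g(x) dv` of the inner product space `(T_x N, g_x)`. -/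
def fiberVolume (g : SmoothMetric d N) (x : N) : Measure (EuclideanSpace ℝ (Fin (d + 1))) :=
  ENNReal.ofReal (Real.sqrt (Matrix.det (Matrix.of fun i j : Fin (d + 1) =>
    g.inner x (EuclideanSpace.single i 1 : EuclideanSpace ℝ (Fin (d + 1)))
      (EuclideanSpace.single j 1 : EuclideanSpace ℝ (Fin (d + 1)))))) • volume

/-- The surface measure `dS_x` of the unit sphere `S_x` of `(T_x N, g_x)`, as a measure on the
tangent bundle: `dS_x(A) = n · vol_x {v : 0 < |v| < 1, v / |v| ∈ A}`, where `n = d + 1`. -/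
def sphereMeasure (g : SmoothMetric d N) (x : N) : Measure (TangentBundle (𝓡 (d + 1)) N) :=
  ((d + 1 : ℕ) : ℝ≥0∞) •
    ((fiberVolume g x).restrict {v | 0 < g.inner x v v ∧ g.inner x v v < 1}).map
      fun v : EuclideanSpace ℝ (Fin (d + 1)) => (⟨x, (Real.sqrt (g.inner x v v))⁻¹ • v⟩ : TangentBundle (𝓡 (d + 1)) N)

/-- The measure `dΣ^{2n-2} = dV^{n-1} ∧ dS_x` on `∂(SM)`:
`Σ(A) = ∫_{∂M} S_x(A ∩ S_x) dV^{n-1}(x)`. -/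
def boundaryMeasure [MeasurableSpace N] (g : SmoothMetric d N) (M : Set N) :
    Measure (boundarySM g M) :=
  ((boundaryVolume g M).bind (sphereMeasure g)).comap Subtype.val

/-- The measure `|μ| dΣ^{2n-2}` on `∂(SM)`, where `|μ(x, v)| = |⟨ν(x), v⟩|`.
The spaces `L²_{|μ|}(∂(SM))` and `L²_μ(∂₊(SM))` are the `L²` spaces of this measure and of its
restriction to `∂₊(SM)`. -/
def weightedMeasure [MeasurableSpace N] (g : SmoothMetric d N) (M : Set N) :
    Measure (boundarySM g M) :=
  (boundaryMeasure g M).withDensity fun p =>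
    ENNReal.ofReal |g.inner p.1.1 (outerNormal g M p.1.1) p.1.2|

/-! ### The scattering relation and the continuation operators -/

/-- The odd part `τ₋⁰(x, v) = (τ(x, v) - τ(x, -v)) / 2` of the travel time. -/
def oddTravelTime (g : SmoothMetric d N) (M : Set N) (p : TangentBundle (𝓡 (d + 1)) N) : ℝ :=
  ((travelTime g M p).toReal - (travelTime g M (reverse p)).toReal) / 2

open Classical in
/-- The scattering relation `α(x, v) = φ_{2 τ₋⁰(x, v)}(x, v)` as a map `∂(SM) → ∂(SM)`. -/
def scattering (g : SmoothMetric d N) (M : Set N) (p : boundarySM g M) : boundarySM g M :=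
  if h : geodesicFlow g (2 * oddTravelTime g M p.1) p.1 ∈ boundarySM g M then ⟨_, h⟩ else p

open Classical in
/-- The continuation of `w` from `∂₊(SM)` to `∂(SM)`: it equals `w` on `∂₊(SM)` and
`ε · (w ∘ α)` on the rest of `∂₋(SM)`. For `ε = 1` this is `A₊ w`, for `ε = -1` it is `A₋ w`;
only the values of `w` on `∂₊(SM)` matter. -/
def continuation (g : SmoothMetric d N) (M : Set N) (ε : ℝ) (w : boundarySM g M → ℝ) :
    boundarySM g M → ℝ :=
  fun p => if p ∈ inward g M then w p else ε * w (scattering g M p)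

end Definitions

end GeodesicScattering

end

open GeodesicScattering

noncomputable section

namespace GeodesicScattering

set_option linter.unusedSectionVars false

open scoped InnerProductSpace

/-! ### Local flows of smooth vector fields -/

section LocalFlow

open Metric Function
open scoped NNReal

/-! The heart of the matter is Liouville's theorem for a Hamiltonian flow, read on a hypersurface.
In position and momentum coordinates (y, ξ) with ξ = G(y)v, where G is the metric in a chart, the
geodesic equation is Hamilton's equation for H = ½⟨ξ, G⁻¹ξ⟩. A change of chart is an isometry; its
cotangent lift is symplectic (`symp_fderiv_cotLift`) and carries one Hamiltonian field to the other
(`fderiv_cotLift_hamField`), so flow lines can be tested in any one chart. Conservation of energy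
and compactness of N make the flow complete. It is continuous, and in every pair of charts it has a
symplectic derivative (`flowSmoothAt`), whose determinant is therefore ±1.

Strict convexity enters through one fact: a geodesic that is tangent to ∂M lies outside M just
before and just after the contact (`eventually_notMem_of_tangential`). Hence a geodesic started
strictly inward stays in the interior until it exits, it exits strictly outward, and a tangential
vector has travel time zero. For every point of ∂(SM) at least one of τ(x, v), τ(x, -v) vanishes, so
α is the exit map on inward vectors and its conjugate under reversal of velocity on outward ones.
Travelling back along a geodesic (`scatter_reverse_scatter`) shows that α is an involution, which
fixes the tangential vectors and exchanges strictly inward and strictly outward ones.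

For the measure, the weight |⟨ν, v⟩| is exactly what makes the density elementary. In a boundary
chart, the area density of ∂M times |⟨ν, v⟩| equals √det g · |v⁰|, and replacing v by ξ in the fibre
contributes 1/√det g to the sphere measure. All determinants cancel, and the weighted measure of A
is n times the integral of |v⁰|/|v| dy dξ over the vectors of length less than 1 in the cone over A
(`weightedMeasure_apply`). Here v⁰ is also the component of the Hamiltonian field across the
hyperplane y⁰ = 0. The exit time of strictly inward vectors is continuous, hence differentiable by
an implicit function argument because the exit is transversal. The resulting Poincaré map P between
two such hyperplanes satisfies |v⁰| = |det P| · |v'⁰|, by the linear algebra of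
`det_mul_eq_of_transversal` and |det D| = 1. Since speed is preserved, the change of variables
formula gives the invariance between two charts (`lintegral_boundaryCone_scatter`), and a finite
cover of ∂M makes it global. Tangential vectors have weight zero.

Finally, A₊w and A₋w equal w on one half of ∂(SM) and ±w∘α on the other. Since α preserves the
measure, null sets are respected and each half contributes ‖w‖² to the square of the norm, whence
the factor √2. -/

/-- Grönwall's inequality for a function on a symmetric interval that vanishes at `0`. -/
theorem norm_le_of_norm_deriv_le_mul_add {F : Type*} [NormedAddCommGroup F] [NormedSpace ℝ F]
    {f f' : ℝ → F} {K δ ε : ℝ} (hK : 0 < K) (h0 : f 0 = 0)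
    (hf : ∀ t ∈ Ioo (-ε) ε, HasDerivAt f (f' t) t)
    (bound : ∀ t ∈ Ioo (-ε) ε, ‖f' t‖ ≤ K * ‖f t‖ + δ) {t : ℝ} (ht : t ∈ Ioo (-ε) ε) :
    ‖f t‖ ≤ δ * ((Real.exp (K * ε) - 1) / K) := by
  have hε : 0 < ε := by linarith [ht.1, ht.2]
  -- The sign σ = ±1 reparametrizes time, so the one-sided inequality covers both halves of the
  -- interval.
  have hδ : ∀ σ : ℝ, |σ| = 1 → ∀ s, 0 ≤ s → s < ε → ‖f (σ * s)‖ ≤ gronwallBound 0 K δ s := by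
    intro σ hσ s hs hsε
    have hmem : ∀ u ∈ Icc 0 s, σ * u ∈ Ioo (-ε) ε := by
      intro u hu
      rw [mem_Ioo, ← abs_lt, abs_mul, hσ, one_mul, abs_of_nonneg hu.1]
      exact hu.2.trans_lt hsε
    have hd : ∀ u ∈ Icc 0 s, HasDerivAt (fun u => f (σ * u)) (σ • f' (σ * u)) u := by
      intro u hu
      have := (hf _ (hmem u hu)).scomp u ((hasDerivAt_id u).const_mul σ)
      simpa using! this
    have := norm_le_gronwallBound_of_norm_deriv_right_le (f := fun u => f (σ * u))
      (f' := fun u => σ • f' (σ * u)) (δ := 0) (K := K) (ε := δ) (a := 0) (b := s)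
      (fun u hu => (hd u hu).continuousAt.continuousWithinAt)
      (fun u hu => (hd u (Ico_subset_Icc_self hu)).hasDerivWithinAt) (by simp [h0])
      (fun u hu => by
        rw [norm_smul, Real.norm_eq_abs, hσ, one_mul]
        exact bound _ (hmem u (Ico_subset_Icc_self hu))) s ⟨hs, le_rfl⟩
    simpa using this
  have hδ0 : 0 ≤ δ := by
    have := bound 0 ⟨by linarith, hε⟩
    rw [h0, norm_zero, mul_zero, zero_add] at this
    exact (norm_nonneg _).trans this
  have key : ‖f t‖ ≤ gronwallBound 0 K δ |t| := by
    have hlt : |t| < ε := abs_lt.2 ht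
    rcases le_total 0 t with h | h
    · have := hδ 1 (by simp) |t| (abs_nonneg _) hlt
      rw [one_mul] at this
      nth_rw 1 [abs_of_nonneg h] at this
      exact this
    · have := hδ (-1) (by simp) |t| (abs_nonneg _) hlt
      rwa [show -1 * |t| = t by rw [abs_of_nonpos h]; ring] at this
  refine key.trans ?_
  simp only [gronwallBound_of_K_ne_0 hK.ne', zero_mul, zero_add]
  rw [div_mul_eq_mul_div, mul_div_assoc]
  have : Real.exp (K * |t|) ≤ Real.exp (K * ε) :=
    Real.exp_le_exp.2 (mul_le_mul_of_nonneg_left (abs_lt.2 ht).le hK.le)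
  gcongr

variable {V : Type*} [NormedAddCommGroup V] [NormedSpace ℝ V] [CompleteSpace V]

/-- A `C²` vector field has a local flow `φ` that is differentiable with respect to the initial
value; the derivative `Y` solves the linearized equation. -/
theorem exists_local_flow {S : V → V} {O : Set V} (hO : IsOpen O) (hS : ContDiffOn ℝ 2 S O)
    {z₀ : V} (hz₀ : z₀ ∈ O) :
    ∃ ε > 0, ∃ r > 0, ∃ (φ : V → ℝ → V) (Y : V → ℝ → V →L[ℝ] V),
      (∀ z ∈ ball z₀ r, φ z 0 = z ∧ Y z 0 = ContinuousLinearMap.id ℝ V ∧ ∀ t ∈ Ioo (-ε) ε,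
        φ z t ∈ O ∧ HasDerivAt (φ z) (S (φ z t)) t ∧
        HasDerivAt (Y z) ((fderiv ℝ S (φ z t)).comp (Y z t)) t ∧
        HasFDerivAt (uncurry φ)
          ((Y z t).coprod (ContinuousLinearMap.toSpanSingleton ℝ (S (φ z t)))) (z, t)) ∧
      ContinuousOn (uncurry φ) (ball z₀ r ×ˢ Ioo (-ε) ε) := by
  have hSat : ∀ z ∈ O, ContDiffAt ℝ 2 S z := fun z hz => hS.contDiffAt (hO.mem_nhds hz)
  have hDS : ContDiffAt ℝ 1 (fderiv ℝ S) z₀ := (hSat z₀ hz₀).fderiv_right (by norm_num)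
  -- the flow of the system for the pair `(z, Y)`
  set S' : V × (V →L[ℝ] V) → V × (V →L[ℝ] V) := fun p => (S p.1, (fderiv ℝ S p.1).comp p.2)
  have hS' : ContDiffAt ℝ 1 S' (z₀, ContinuousLinearMap.id ℝ V) := by
    refine ContDiffAt.prodMk ?_ ?_
    · exact ContDiffAt.comp _ ((hSat z₀ hz₀).of_le (by norm_num)) contDiffAt_fst
    · exact ContDiffAt.clm_comp (hDS.comp _ contDiffAt_fst) contDiffAt_snd
  obtain ⟨ε₁, hε₁, a, r₁, L, K₁, hr₁, hPL⟩ := IsPicardLindelof.of_contDiffAt_one hS'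
  obtain ⟨α, hα, L', hL'⟩ :=
    (hPL 0).exists_forall_mem_closedBall_eq_hasDerivWithinAt_lipschitzOnWith
  -- Continuity in time and a Lipschitz bound in the initial value that is uniform in time give
  -- joint continuity.
  have hαc : ContinuousOn (uncurry α) (closedBall (z₀, ContinuousLinearMap.id ℝ V) r₁ ×ˢ
      Icc (0 - ε₁) (0 + ε₁)) :=
    continuousOn_prod_of_continuousOn_lipschitzOnWith _ L'
      (fun x hx => HasDerivWithinAt.continuousOn (hα x hx).2) hL'
  -- bounds near `z₀`
  obtain ⟨K, s₁, hs₁, hK⟩ := ContDiffAt.exists_lipschitzOnWith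
    ((hSat z₀ hz₀).of_le (by norm_num : (1 : WithTop ℕ∞) ≤ 2))
  obtain ⟨C, s₂, hs₂, hC⟩ := hDS.exists_lipschitzOnWith
  obtain ⟨ρ, hρ, hball⟩ := Metric.mem_nhds_iff.1 (inter_mem (inter_mem hs₁ hs₂) (hO.mem_nhds hz₀))
  have hballO : ball z₀ ρ ⊆ O := fun z hz => (hball hz).2
  -- Taylor's formula with quadratic remainder: the derivative of S varies by at most C‖y - x‖ along
  -- the segment.
  have hquad : ∀ x ∈ ball z₀ ρ, ∀ y ∈ ball z₀ ρ,
      ‖S y - S x - fderiv ℝ S x (y - x)‖ ≤ C * ‖y - x‖ * ‖y - x‖ := by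
    intro x hx y hy
    have hsub : segment ℝ x y ⊆ ball z₀ ρ := (convex_ball z₀ ρ).segment_subset hx hy
    refine (convex_segment x y).norm_image_sub_le_of_norm_fderiv_le' (𝕜 := ℝ) (f := S)
      (φ := fderiv ℝ S x) (C := C * ‖y - x‖) (fun u hu => ?_) (fun u hu => ?_)
      (left_mem_segment ℝ x y) (right_mem_segment ℝ x y)
    · exact (hSat u (hballO (hsub hu))).differentiableAt (by norm_num)
    · refine (hC.norm_sub_le (hball (hsub hu)).1.2 (hball hx).1.2).trans ?_
      gcongr
      have := norm_sub_le_of_mem_segment hu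
      exact this
  have hbd : ∀ x ∈ ball z₀ ρ, ‖fderiv ℝ S x‖ ≤ K := fun x hx =>
    norm_fderiv_le_of_lipschitzOn ℝ (mem_of_superset (isOpen_ball.mem_nhds hx) fun u hu =>
      (hball hu).1.1) hK
  -- shrink the time and the radius
  have hnear : ∀ᶠ q : (V × (V →L[ℝ] V)) × ℝ in
      𝓝 ((z₀, ContinuousLinearMap.id ℝ V), (0 : ℝ)), (uncurry α q).1 ∈ ball z₀ ρ := by
    have hc : ContinuousAt (uncurry α) ((z₀, ContinuousLinearMap.id ℝ V), (0 : ℝ)) :=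
      hαc.continuousAt (prod_mem_nhds (closedBall_mem_nhds _ hr₁)
        (Icc_mem_nhds (by linarith) (by linarith)))
    have h0 : uncurry α ((z₀, ContinuousLinearMap.id ℝ V), (0 : ℝ))
        = (z₀, ContinuousLinearMap.id ℝ V) := (hα _ (mem_closedBall_self r₁.2)).1
    have : Tendsto (fun q => (uncurry α q).1) (𝓝 ((z₀, ContinuousLinearMap.id ℝ V), (0 : ℝ)))
        (𝓝 z₀) := by
      have := (continuous_fst.tendsto _).comp hc.tendsto
      rwa [h0] at this
    exact this (ball_mem_nhds z₀ hρ)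
  obtain ⟨η, hη, hηb⟩ := Metric.eventually_nhds_iff_ball.1 hnear
  set φ : V → ℝ → V := fun z t => (α (z, ContinuousLinearMap.id ℝ V) t).1
  set Y : V → ℝ → V →L[ℝ] V := fun z t => (α (z, ContinuousLinearMap.id ℝ V) t).2
  set ε := min ε₁ η
  set r := min (r₁ : ℝ) η
  have hr : 0 < r := lt_min hr₁ hη
  have hε : 0 < ε := lt_min hε₁ hη
  have hmem : ∀ z ∈ ball z₀ r, ((z, ContinuousLinearMap.id ℝ V) : V × (V →L[ℝ] V)) ∈
      closedBall (z₀, ContinuousLinearMap.id ℝ V) (r₁ : ℝ) := by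
    intro z hz
    rw [mem_closedBall, Prod.dist_eq, dist_self]
    exact max_le ((mem_ball.1 hz).le.trans (min_le_left _ _)) r₁.2
  have htime : ∀ t ∈ Ioo (-ε) ε, t ∈ Ioo (0 - ε₁) (0 + ε₁) := by
    intro t ht
    have := min_le_left ε₁ η
    constructor <;> linarith [ht.1, ht.2]
  have hφb : ∀ z ∈ ball z₀ r, ∀ t ∈ Ioo (-ε) ε, φ z t ∈ ball z₀ ρ := by
    intro z hz t ht
    refine hηb ((z, ContinuousLinearMap.id ℝ V), t) ?_
    rw [mem_ball, Prod.dist_eq, Prod.dist_eq, dist_self, max_lt_iff, max_lt_iff]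
    refine ⟨⟨(mem_ball.1 hz).trans_le (min_le_right _ _), hη⟩, ?_⟩
    rw [Real.dist_eq, sub_zero]
    exact (abs_lt.2 ht).trans_le (min_le_right _ _)
  have hα' : ∀ z ∈ ball z₀ r, ∀ t ∈ Ioo (-ε) ε, HasDerivAt (α (z, ContinuousLinearMap.id ℝ V))
      (S' (α (z, ContinuousLinearMap.id ℝ V) t)) t := fun z hz t ht =>
    ((hα _ (hmem z hz)).2 t (Ioo_subset_Icc_self (htime t ht))).hasDerivAt
      (Icc_mem_nhds (htime t ht).1 (htime t ht).2)
  have hφ' : ∀ z ∈ ball z₀ r, ∀ t ∈ Ioo (-ε) ε, HasDerivAt (φ z) (S (φ z t)) t :=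
    fun z hz t ht => (hα' z hz t ht).fst
  have hY' : ∀ z ∈ ball z₀ r, ∀ t ∈ Ioo (-ε) ε,
      HasDerivAt (Y z) ((fderiv ℝ S (φ z t)).comp (Y z t)) t :=
    fun z hz t ht => (hα' z hz t ht).snd
  have hφ0 : ∀ z ∈ ball z₀ r, φ z 0 = z := fun z hz =>
    congrArg Prod.fst (hα _ (hmem z hz)).1
  have hY0 : ∀ z ∈ ball z₀ r, Y z 0 = ContinuousLinearMap.id ℝ V := fun z hz =>
    congrArg Prod.snd (hα _ (hmem z hz)).1
  have hαc' : ContinuousOn (fun q : V × ℝ => α (q.1, ContinuousLinearMap.id ℝ V) q.2)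
      (ball z₀ r ×ˢ Ioo (-ε) ε) := by
    refine hαc.comp (f := fun q : V × ℝ => ((q.1, ContinuousLinearMap.id ℝ V), q.2))
      (by fun_prop) ?_
    rintro ⟨z, t⟩ ⟨hz, ht⟩
    exact ⟨hmem z hz, Ioo_subset_Icc_self (htime t ht)⟩
  have hopen : ∀ z ∈ ball z₀ r, ∀ t ∈ Ioo (-ε) ε, ball z₀ r ×ˢ Ioo (-ε) ε ∈ 𝓝 (z, t) :=
    fun z hz t ht => (isOpen_ball.prod isOpen_Ioo).mem_nhds ⟨hz, ht⟩
  have hφL : ∀ z ∈ ball z₀ r, ∀ z' ∈ ball z₀ r, ∀ t ∈ Ioo (-ε) ε,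
      ‖φ z' t - φ z t‖ ≤ L' * ‖z' - z‖ := by
    intro z hz z' hz' t ht
    have h := (hL' t (Ioo_subset_Icc_self (htime t ht))).norm_sub_le (hmem z' hz') (hmem z hz)
    have h1 : ‖(z', ContinuousLinearMap.id ℝ V) - (z, ContinuousLinearMap.id ℝ V)‖ = ‖z' - z‖ := by
      rw [Prod.mk_sub_mk, sub_self, Prod.norm_mk, norm_zero, max_eq_left (norm_nonneg _)]
    rw [h1] at h
    exact (norm_fst_le (α (z', ContinuousLinearMap.id ℝ V) t -
      α (z, ContinuousLinearMap.id ℝ V) t)).trans h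
  -- differentiability in the initial value
  have hder : ∀ z ∈ ball z₀ r, ∀ t ∈ Ioo (-ε) ε, HasFDerivAt (fun z => φ z t) (Y z t) z := by
    intro z hz t ht
    -- The error of the linear approximation vanishes at time 0 and satisfies a linear differential
    -- inequality whose inhomogeneity is of order ‖z' - z‖²; Grönwall preserves this order. The
    -- constant K + 1 replaces K so that it is positive.
    have hest : ∀ z' ∈ ball z₀ r, ‖φ z' t - φ z t - Y z t (z' - z)‖ ≤
        C * (L' * L') * ((Real.exp ((K + 1) * ε) - 1) / (K + 1)) * ‖z' - z‖ ^ 2 := by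
      intro z' hz'
      have := norm_le_of_norm_deriv_le_mul_add (ε := ε) (K := K + 1)
        (δ := C * (L' * L') * ‖z' - z‖ ^ 2)
        (f := fun s => φ z' s - φ z s - Y z s (z' - z))
        (f' := fun s => S (φ z' s) - S (φ z s) - fderiv ℝ S (φ z s) (Y z s (z' - z)))
        (by positivity) (by simp [hφ0 z hz, hφ0 z' hz', hY0 z hz])
        (fun s hs => ((hφ' z' hz' s hs).sub (hφ' z hz s hs)).sub
          (by simpa using (hY' z hz s hs).clm_apply (hasDerivAt_const s (z' - z))))
        (fun s hs => ?_) ht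
      · refine this.trans (le_of_eq ?_)
        ring
      · have e1 : S (φ z' s) - S (φ z s) - fderiv ℝ S (φ z s) (Y z s (z' - z))
            = (S (φ z' s) - S (φ z s) - fderiv ℝ S (φ z s) (φ z' s - φ z s))
              + fderiv ℝ S (φ z s) (φ z' s - φ z s - Y z s (z' - z)) := by
          simp only [map_sub]
          abel
        rw [e1]
        refine (norm_add_le _ _).trans ?_
        have h1 := hquad _ (hφb z hz s hs) _ (hφb z' hz' s hs)
        have h2 := (fderiv ℝ S (φ z s)).le_opNorm (φ z' s - φ z s - Y z s (z' - z))
        have h3 := hbd _ (hφb z hz s hs)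
        have h4 := hφL z hz z' hz' s hs
        have h5 : C * ‖φ z' s - φ z s‖ * ‖φ z' s - φ z s‖ ≤ C * (L' * L') * ‖z' - z‖ ^ 2 :=
          calc C * ‖φ z' s - φ z s‖ * ‖φ z' s - φ z s‖
              ≤ C * (L' * ‖z' - z‖) * (L' * ‖z' - z‖) := by gcongr
            _ = _ := by ring
        have h6 : ‖fderiv ℝ S (φ z s)‖ * ‖φ z' s - φ z s - Y z s (z' - z)‖ ≤
            (K + 1) * ‖φ z' s - φ z s - Y z s (z' - z)‖ := by
          gcongr
          linarith
        linarith
    rw [hasFDerivAt_iff_isLittleO]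
    have hbig : (fun z' => φ z' t - φ z t - Y z t (z' - z)) =O[𝓝 z] fun z' => ‖z' - z‖ ^ 2 := by
      refine Asymptotics.IsBigO.of_bound
        (C * (L' * L') * ((Real.exp ((K + 1) * ε) - 1) / (K + 1))) ?_
      filter_upwards [isOpen_ball.mem_nhds hz] with z' hz'
      rw [norm_pow, norm_norm]
      exact hest z' hz'
    refine hbig.trans_isLittleO ?_
    exact (Asymptotics.isLittleO_norm_pow_id one_lt_two).comp_tendsto
      (tendsto_sub_nhds_zero_iff.2 tendsto_id)
  refine ⟨ε, hε, r, hr, φ, Y, fun z hz => ⟨hφ0 z hz, hY0 z hz, fun t ht =>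
    ⟨hballO (hφb z hz t ht), hφ' z hz t ht, hY' z hz t ht, ?_⟩⟩, continuous_fst.comp_continuousOn hαc'⟩
  have hcα := hαc'.continuousAt (hopen z hz t ht)
  -- Both partial derivatives exist nearby and are continuous at the point, hence the flow is
  -- differentiable jointly in initial value and time.
  refine (hasStrictFDerivAt_uncurry_coprod (𝕜 := ℝ) (u := (z, t)) (f := φ) (f₁ := Y)
    (f₂ := fun z t => ContinuousLinearMap.toSpanSingleton ℝ (S (φ z t))) ?_ ?_ ?_ ?_).hasFDerivAt
  · filter_upwards [hopen z hz t ht] with q hq using hder q.1 hq.1 q.2 hq.2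
  · filter_upwards [hopen z hz t ht] with q hq using (hφ' q.1 hq.1 q.2 hq.2).hasFDerivAt
  · exact continuous_snd.continuousAt.comp hcα
  · have h1 : ContinuousAt (fun q : V × ℝ => S (φ q.1 q.2)) (z, t) :=
      ContinuousAt.comp (f := fun q : V × ℝ => φ q.1 q.2) (g := S)
        (hSat _ (hballO (hφb z hz t ht))).continuousAt
        (continuous_fst.continuousAt.comp hcα)
    exact ((ContinuousLinearMap.toSpanSingletonCLE (𝕜 := ℝ) (E := V)).continuous.continuousAt).comp h1

end LocalFlow

/-! ### Symplectic linear algebra -/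

section LinearAlgebra

/-- A linear map preserving a nondegenerate bilinear form has determinant `± 1`. -/
theorem abs_det_eq_one_of_preserves {V : Type*} [AddCommGroup V] [Module ℝ V]
    [FiniteDimensional ℝ V] {B : LinearMap.BilinForm ℝ V} (hB : B.Nondegenerate) {D : V →ₗ[ℝ] V}
    (hD : ∀ h k, B (D h) (D k) = B h k) : |LinearMap.det D| = 1 := by
  classical
  let b := Module.finBasis ℝ V
  have h1 : B.comp D D = B := by
    ext h k
    exact hD h k
  have h2 := LinearMap.BilinForm.toMatrix_comp b b B D D
  rw [h1] at h2
  have h3 := congrArg Matrix.det h2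
  rw [Matrix.det_mul, Matrix.det_mul, Matrix.det_transpose, LinearMap.det_toMatrix] at h3
  have h4 : (LinearMap.BilinForm.toMatrix b B).det ≠ 0 :=
    (LinearMap.BilinForm.nondegenerate_iff_det_ne_zero b).1 hB
  have h5 : LinearMap.det D * LinearMap.det D = 1 := by
    apply mul_right_cancel₀ h4
    rw [one_mul]
    nth_rw 2 [h3]
    ring
  rw [← abs_one, ← sq_eq_sq_iff_abs_eq_abs, sq, h5, one_pow]

variable {E : Type*} [NormedAddCommGroup E] [InnerProductSpace ℝ E]

/-- The standard symplectic form of `E × E`. -/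
def symp (h k : E × E) : ℝ := ⟪h.1, k.2⟫_ℝ - ⟪k.1, h.2⟫_ℝ

/-- Nondegeneracy of the symplectic form, tested on the two coordinate Lagrangian subspaces. -/
theorem symp_eq_of_forall {h h' : E × E} (H : ∀ k, symp h k = symp h' k) : h = h' := by
  have h1 : h.1 = h'.1 := ext_inner_right ℝ fun v => by simpa [symp] using H (0, v)
  have h2 : h.2 = h'.2 := ext_inner_left ℝ fun v => by simpa [symp] using H (v, 0)
  exact Prod.ext h1 h2

/-- A linear map preserving the standard symplectic form has determinant `± 1`. -/
theorem abs_det_eq_one_of_symp [FiniteDimensional ℝ E] {D : E × E →L[ℝ] E × E}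
    (hD : ∀ h k, symp (D h) (D k) = symp h k) : |D.det| = 1 := by
  let B : LinearMap.BilinForm ℝ (E × E) := LinearMap.mk₂ ℝ (fun h k => symp h k)
    (fun h h' k => by simp only [symp, Prod.fst_add, Prod.snd_add, inner_add_left,
      inner_add_right]; ring)
    (fun c h k => by simp only [symp, Prod.smul_fst, Prod.smul_snd, inner_smul_left,
      inner_smul_right, smul_eq_mul, RCLike.conj_to_real]; ring)
    (fun h k k' => by simp only [symp, Prod.fst_add, Prod.snd_add, inner_add_left,
      inner_add_right]; ring)
    (fun c h k => by simp only [symp, Prod.smul_fst, Prod.smul_snd, inner_smul_left,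
      inner_smul_right, smul_eq_mul, RCLike.conj_to_real]; ring)
  have hB : B.Nondegenerate := by
    constructor
    · intro h H
      refine symp_eq_of_forall fun k => ?_
      rw [show symp h k = 0 from H k]
      simp [symp]
    · intro k H
      refine symp_eq_of_forall fun h => ?_
      have h1 : symp k h = - symp h k := by simp only [symp]; ring
      rw [h1, show symp h k = 0 from H h]
      simp [symp]
  exact abs_det_eq_one_of_preserves hB (D := (D : E × E →ₗ[ℝ] E × E)) hD

/-- The transversal Jacobian: if `D S = S'` and `P` is the linear map between the hyperplanes
`ker ℓ` obtained from `D` by projecting along `S'`, then `det D · ℓ(S) = ℓ(S') · det P`. -/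
theorem det_mul_eq_of_transversal {V W : Type*} [AddCommGroup V] [Module ℝ V]
    [FiniteDimensional ℝ V] [AddCommGroup W] [Module ℝ W] [FiniteDimensional ℝ W]
    {ι : W →ₗ[ℝ] V} {pr : V →ₗ[ℝ] W} {l : V →ₗ[ℝ] ℝ} {e : V}
    (hpi : ∀ w, pr (ι w) = w) (hli : ∀ w, l (ι w) = 0) (hpe : pr e = 0) (hle : l e = 1)
    (hdec : ∀ v, l v • e + ι (pr v) = v) {D : V →ₗ[ℝ] V} {P : W →ₗ[ℝ] W} {θ : W →ₗ[ℝ] ℝ}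
    {S S' : V} (hS : D S = S') (hP : ∀ w, ι (P w) = D (ι w) + θ w • S') :
    LinearMap.det D * l S = l S' * LinearMap.det P := by
  -- This transvection sends e to S and fixes ker l, so its determinant is the e-component of S.
  have hA : LinearMap.det (LinearMap.transvection l (S - e)) = l S := by
    rw [LinearMap.transvection.det, map_sub, hle]; ring
  have hT : LinearMap.det (LinearMap.transvection l (S' - e)) = l S' := by
    rw [LinearMap.transvection.det, map_sub, hle]; ring
  have hC : LinearMap.det (LinearMap.transvection (-(θ ∘ₗ pr)) e) = 1 := by
    rw [LinearMap.transvection.det]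
    simp [hpe]
  let M : V →ₗ[ℝ] V := l.smulRight e + ι ∘ₗ P ∘ₗ pr
  have hM : LinearMap.det M = LinearMap.det P := by
    let q : V ≃ₗ[ℝ] ℝ × W := LinearEquiv.ofLinearMap (l.prod pr)
      (((LinearMap.fst ℝ ℝ W).smulRight e) + ι ∘ₗ LinearMap.snd ℝ ℝ W)
      (by
        refine LinearMap.ext fun p => ?_
        simp [hpi, hli, hpe, hle])
      (by
        refine LinearMap.ext fun v => ?_
        simpa using hdec v)
    rw [← LinearMap.det_conj M q]
    have : (q : V →ₗ[ℝ] ℝ × W) ∘ₗ M ∘ₗ (q.symm : ℝ × W →ₗ[ℝ] V)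
        = LinearMap.prodMap LinearMap.id P := by
      refine LinearMap.ext fun p => ?_
      simp [q, M, hpi, hli, hpe, hle]
    rw [this, LinearMap.det_prodMap, LinearMap.det_id, one_mul]
  -- In the splitting ℝe ⊕ ker l: D after e ↦ S equals a shear along e, then id ⊕ P, then e ↦ S'.
  -- The shear absorbs the correction θ and has determinant 1, so taking determinants gives the
  -- formula.
  have key : D ∘ₗ LinearMap.transvection l (S - e)
      = LinearMap.transvection l (S' - e) ∘ₗ M ∘ₗ LinearMap.transvection (-(θ ∘ₗ pr)) e := by
    refine LinearMap.ext fun v => ?_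
    have h1 : D (v + l v • (S - e)) = l v • S' + D (ι (pr v)) := by
      nth_rw 1 [← hdec v]
      simp only [map_add, map_smul, map_sub, hS, smul_sub]
      abel
    have h2 : LinearMap.transvection (-(θ ∘ₗ pr)) e v = v - θ (pr v) • e := by
      rw [LinearMap.transvection.apply, LinearMap.neg_apply, LinearMap.comp_apply, neg_smul,
        sub_eq_add_neg]
    have h3 : M (v - θ (pr v) • e) = (l v - θ (pr v)) • e + ι (P (pr v)) := by
      have h4 : pr (v - θ (pr v) • e) = pr v := by rw [map_sub, map_smul, hpe, smul_zero, sub_zero]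
      have h5 : l (v - θ (pr v) • e) = l v - θ (pr v) := by
        rw [map_sub, map_smul, hle, smul_eq_mul, mul_one]
      simp only [M, LinearMap.add_apply, LinearMap.smulRight_apply, LinearMap.comp_apply, h4, h5]
    have h6 : l ((l v - θ (pr v)) • e + ι (P (pr v))) = l v - θ (pr v) := by
      rw [map_add, map_smul, hle, hli, smul_eq_mul, mul_one, add_zero]
    simp only [LinearMap.comp_apply, h2, h3]
    rw [LinearMap.transvection.apply, LinearMap.transvection.apply, h1, h6, hP]
    module
  have := congrArg LinearMap.det key
  rw [LinearMap.det_comp, LinearMap.det_comp, LinearMap.det_comp, hA, hT, hC, hM, mul_one] at this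
  exact this

/-- The Gram matrix of the images of a basis under a linear map. -/
theorem det_gram_comp {ι V : Type*} [Fintype ι] [DecidableEq ι] [AddCommGroup V] [Module ℝ V]
    (b : Module.Basis ι ℝ V) (B : LinearMap.BilinForm ℝ V) (L : V →ₗ[ℝ] V) :
    (Matrix.of fun i j => B (L (b i)) (L (b j))).det
      = LinearMap.det L ^ 2 * (Matrix.of fun i j => B (b i) (b j)).det := by
  have h2 := LinearMap.BilinForm.toMatrix_comp b b B L L
  have h3 := congrArg Matrix.det h2
  rw [Matrix.det_mul, Matrix.det_mul, Matrix.det_transpose, LinearMap.det_toMatrix] at h3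
  have e1 : (Matrix.of fun i j => B (L (b i)) (L (b j)))
      = LinearMap.BilinForm.toMatrix b (B.comp L L) := by
    ext i j
    rw [LinearMap.BilinForm.toMatrix_apply]
    rfl
  have e2 : (Matrix.of fun i j => B (b i) (b j)) = LinearMap.BilinForm.toMatrix b B := by
    ext i j
    rw [LinearMap.BilinForm.toMatrix_apply]
    rfl
  rw [e1, e2, h3]
  ring

/-- The coordinates `ℝ^{d+1}`. -/
abbrev Coord (d : ℕ) := EuclideanSpace ℝ (Fin (d + 1))

variable {d : ℕ}

/-- The Gram determinant of a hyperplane in terms of the unit normal. -/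
theorem sqrt_det_gram_mul_abs_normal {B : LinearMap.BilinForm ℝ (Coord d)}
    (hsymm : ∀ u w, B u w = B w u) {ν : Coord d} (hν : B ν ν = 1)
    (horth : ∀ w : Coord d, w 0 = 0 → B ν w = 0) (v : Coord d) :
    Real.sqrt (Matrix.of fun i j : Fin d => B (EuclideanSpace.single i.succ 1)
        (EuclideanSpace.single j.succ 1)).det * |B ν v|
      = Real.sqrt (Matrix.of fun i j : Fin (d + 1) => B (EuclideanSpace.single i 1)
        (EuclideanSpace.single j 1)).det * |v 0| := by
  let b := (EuclideanSpace.basisFun (Fin (d + 1)) ℝ).toBasis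
  have hb : ∀ i, b i = EuclideanSpace.single i 1 := fun i => by simp [b]
  let l : Coord d →ₗ[ℝ] ℝ := (EuclideanSpace.proj (0 : Fin (d + 1)) : Coord d →L[ℝ] ℝ)
  have hl : ∀ u : Coord d, l u = u 0 := fun u => rfl
  -- L exchanges the basis vector e₀ for ν and fixes the others. The Gram matrix of the new basis
  -- splits into the entry 1 and the hyperplane block, so that block has determinant (ν⁰)² times the
  -- full Gram determinant.
  let L := LinearMap.transvection l (ν - EuclideanSpace.single 0 1)
  have hL : LinearMap.det L = ν 0 := by
    rw [LinearMap.transvection.det, map_sub, hl, hl]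
    simp
  have hL0 : L (b 0) = ν := by
    simp only [L, LinearMap.transvection.apply, hb, hl]
    simp
  have hLs : ∀ i : Fin d, L (b i.succ) = EuclideanSpace.single i.succ 1 := by
    intro i
    simp only [L, LinearMap.transvection.apply, hb, hl]
    simp [Fin.succ_ne_zero]
  have h1 := det_gram_comp b B L
  rw [hL, Matrix.det_succ_column_zero, Fin.sum_univ_succ] at h1
  have hz : ∀ i : Fin d, B (EuclideanSpace.single i.succ 1) ν = 0 := fun i => by
    rw [hsymm]
    exact horth _ (by simp [Fin.succ_ne_zero])
  simp only [Matrix.of_apply, hL0, hLs, hν, hz, mul_zero, zero_mul, Finset.sum_const_zero,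
    add_zero, Fin.val_zero, pow_zero, one_mul] at h1
  have h2 : ((Matrix.of fun i j => B (L (b i)) (L (b j))).submatrix (Fin.succAbove 0) Fin.succ)
      = Matrix.of fun i j : Fin d => B (EuclideanSpace.single i.succ 1)
        (EuclideanSpace.single j.succ 1) := by
    ext i j
    simp [hLs]
  rw [h2] at h1
  simp only [hb] at h1
  have h3 : B ν v * ν 0 = v 0 := by
    -- The tangential part of v, cleared of the denominator ν⁰.
    have h4 := horth (ν 0 • v - v 0 • ν) (by simp [mul_comm])
    simp only [map_sub, map_smul, smul_eq_mul, hν] at h4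
    linarith
  rw [h1, Real.sqrt_mul (sq_nonneg _), Real.sqrt_sq_eq_abs, ← h3, abs_mul]
  ring

end LinearAlgebra

/-! ### The metric in charts -/

section

variable {d : ℕ} {N : Type*} [TopologicalSpace N]
  [ChartedSpace (EuclideanSpace ℝ (Fin (d + 1))) N] [IsManifold (𝓡 (d + 1)) ∞ N]
  {g : SmoothMetric d N} {e e' : OpenPartialHomeomorph N (EuclideanSpace ℝ (Fin (d + 1)))}

theorem mdifferentiable_of_mem_maximalAtlas
    (he : e ∈ IsManifold.maximalAtlas (𝓡 (d + 1)) ∞ N) :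
    e.MDifferentiable (𝓡 (d + 1)) (𝓡 (d + 1)) :=
  ⟨(contMDiffOn_of_mem_maximalAtlas he).mdifferentiableOn (by simp),
    (contMDiffOn_symm_of_mem_maximalAtlas he).mdifferentiableOn (by simp)⟩

theorem chartVector_mfderiv_symm (he : e ∈ IsManifold.maximalAtlas (𝓡 (d + 1)) ∞ N)
    {y : Coord d} (hy : y ∈ e.target) (u : Coord d) :
    chartVector e (e.symm y) (mfderiv (𝓡 (d + 1)) (𝓡 (d + 1)) e.symm y u) = u := 
  DFunLike.congr_fun ((mdifferentiable_of_mem_maximalAtlas he).comp_symm_deriv hy) u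

theorem mfderiv_symm_chartVector (he : e ∈ IsManifold.maximalAtlas (𝓡 (d + 1)) ∞ N)
    {x : N} (hx : x ∈ e.source) (v : TangentSpace (𝓡 (d + 1)) x) :
    (mfderiv (𝓡 (d + 1)) (𝓡 (d + 1)) e.symm (e x) (chartVector e x v) : Coord d) = v := 
  DFunLike.congr_fun ((mdifferentiable_of_mem_maximalAtlas he).symm_comp_deriv hx) v

/-- Coordinate vector fields with constant coefficients are smooth sections; evaluating g on them
shows that the metric coefficients are smooth. -/
theorem contMDiffOn_tangent_symm (he : e ∈ IsManifold.maximalAtlas (𝓡 (d + 1)) ∞ N) (u : Coord d) :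
    ContMDiffOn (𝓡 (d + 1)) (𝓡 (d + 1)).tangent ∞
      (fun y : Coord d => (⟨e.symm y, mfderiv (𝓡 (d + 1)) (𝓡 (d + 1)) e.symm y u⟩ :
        TangentBundle (𝓡 (d + 1)) N)) e.target := by
  have h1 := (contMDiffOn_symm_of_mem_maximalAtlas he).contMDiffOn_tangentMapWithin (m := ∞)
    (by simp) e.open_target.uniqueMDiffOn
  have h2 : ContMDiff (𝓡 (d + 1)) (𝓡 (d + 1)).tangent ∞
      (fun y : Coord d => (⟨y, u⟩ : TangentBundle (𝓡 (d + 1)) (Coord d))) :=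
    (contMDiff_vectorSpace_iff_contDiff (V := fun _ => u)).2 contDiff_const
  refine (h1.comp h2.contMDiffOn fun y hy => hy).congr fun y hy => ?_
  change _ = tangentMapWithin (𝓡 (d + 1)) (𝓡 (d + 1)) e.symm e.target ⟨y, u⟩
  rw [tangentMapWithin, mfderivWithin_of_isOpen e.open_target hy]

theorem continuousOn_tangent_symm (he : e ∈ IsManifold.maximalAtlas (𝓡 (d + 1)) ∞ N) :
    ContinuousOn
      (fun p : Coord d × Coord d => (⟨e.symm p.1, mfderiv (𝓡 (d + 1)) (𝓡 (d + 1)) e.symm p.1 p.2⟩ :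
        TangentBundle (𝓡 (d + 1)) N)) (e.target ×ˢ univ) := by
  have h1 := (contMDiffOn_symm_of_mem_maximalAtlas he).continuousOn_tangentMapWithin
    (by simp) e.open_target.uniqueMDiffOn
  refine (h1.comp (tangentBundleModelSpaceHomeomorph (𝓡 (d + 1))).symm.continuous.continuousOn
    (fun p hp => hp.1)).congr fun y hy => ?_
  change _ = tangentMapWithin (𝓡 (d + 1)) (𝓡 (d + 1)) e.symm e.target ⟨y.1, y.2⟩
  rw [tangentMapWithin, mfderivWithin_of_isOpen e.open_target hy.1]

theorem continuousOn_chartVector (he : e ∈ IsManifold.maximalAtlas (𝓡 (d + 1)) ∞ N) :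
    ContinuousOn (fun p : TangentBundle (𝓡 (d + 1)) N => (e p.1, chartVector e p.1 p.2))
      {p | p.1 ∈ e.source} := by
  have h1 := (contMDiffOn_of_mem_maximalAtlas he).continuousOn_tangentMapWithin
    (by simp) e.open_source.uniqueMDiffOn
  refine ((tangentBundleModelSpaceHomeomorph (𝓡 (d + 1))).continuous.comp_continuousOn h1).congr
    fun p hp => ?_
  change _ = tangentBundleModelSpaceHomeomorph (𝓡 (d + 1))
    (tangentMapWithin (𝓡 (d + 1)) (𝓡 (d + 1)) e e.source p)
  rw [tangentMapWithin, mfderivWithin_of_isOpen e.open_source hp]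
  rfl

theorem contDiffOn_chartMetric (g : SmoothMetric d N)
    (he : e ∈ IsManifold.maximalAtlas (𝓡 (d + 1)) ∞ N) (u w : Coord d) :
    ContDiffOn ℝ ∞ (fun y => chartMetric g e y u w) e.target := by
  rw [← contMDiffOn_iff_contDiffOn]
  have h := ContMDiffOn.clm_bundle_apply₂ (F₁ := Coord d) (F₂ := Coord d) (F₃ := ℝ)
    (E₁ := fun x : N => TangentSpace (𝓡 (d + 1)) x) (E₂ := fun x : N => TangentSpace (𝓡 (d + 1)) x)
    (E₃ := Bundle.Trivial N ℝ) (b := e.symm) (ψ := fun y => g.inner (e.symm y))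
    (g.contMDiff.comp_contMDiffOn (contMDiffOn_symm_of_mem_maximalAtlas he))
    (contMDiffOn_tangent_symm he u) (contMDiffOn_tangent_symm he w)
  intro y hy
  have := h y hy
  simp only [contMDiffWithinAt_totalSpace] at this
  exact this.2

/-- The metric in the chart `e`, as a field of continuous bilinear forms. -/
def chartForm (g : SmoothMetric d N) (e : OpenPartialHomeomorph N (Coord d)) (y : Coord d) :
    Coord d →L[ℝ] Coord d →L[ℝ] ℝ :=
  ContinuousLinearMap.bilinearComp (E := Coord d) (F := Coord d) (E' := Coord d) (F' := Coord d)
    (g.inner (e.symm y)) (mfderiv (𝓡 (d + 1)) (𝓡 (d + 1)) e.symm y)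
    (mfderiv (𝓡 (d + 1)) (𝓡 (d + 1)) e.symm y)

theorem chartForm_apply (g : SmoothMetric d N) (e : OpenPartialHomeomorph N (Coord d))
    (y u w : Coord d) : chartForm g e y u w = chartMetric g e y u w := rfl

theorem contDiffOn_chartForm (g : SmoothMetric d N)
    (he : e ∈ IsManifold.maximalAtlas (𝓡 (d + 1)) ∞ N) :
    ContDiffOn ℝ ∞ (chartForm g e) e.target :=
  contDiffOn_clm_apply.2 fun u => contDiffOn_clm_apply.2 fun w => contDiffOn_chartMetric g he u w

theorem chartMetric_symm (g : SmoothMetric d N) (y u w : Coord d) :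
    chartMetric g e y u w = chartMetric g e y w u := g.symm _ _ _

theorem chartMetric_chartVector (g : SmoothMetric d N)
    (he : e ∈ IsManifold.maximalAtlas (𝓡 (d + 1)) ∞ N) {x : N} (hx : x ∈ e.source)
    (v w : TangentSpace (𝓡 (d + 1)) x) :
    chartMetric g e (e x) (chartVector e x v) (chartVector e x w) = g.inner x v w := by
  unfold chartMetric
  have h1 := mfderiv_symm_chartVector he hx v
  have h2 := mfderiv_symm_chartVector he hx w
  -- The points e⁻¹(e(x)) and x are only propositionally equal and their tangent spaces are
  -- different types, so the equality is eliminated for a variable base point.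
  have key : ∀ (x' : N), x' = x → ∀ (a b : Coord d), a = v → b = w →
      g.inner x' (a : TangentSpace (𝓡 (d + 1)) x') (b : TangentSpace (𝓡 (d + 1)) x')
        = g.inner x v w := by
    rintro x' rfl a b rfl rfl
    rfl
  exact key _ (e.left_inv hx) _ _ h1 h2

theorem chartMetric_pos (g : SmoothMetric d N)
    (he : e ∈ IsManifold.maximalAtlas (𝓡 (d + 1)) ∞ N) {y : Coord d} (hy : y ∈ e.target)
    {u : Coord d} (hu : u ≠ 0) : 0 < chartMetric g e y u u := by
  refine g.pos _ _ fun h => hu ?_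
  rw [← chartVector_mfderiv_symm he hy u, h]
  exact map_zero (mfderiv (𝓡 (d + 1)) (𝓡 (d + 1)) e (e.symm y))

/-- The chart transition is smooth. -/
theorem contDiffAt_transition (he : e ∈ IsManifold.maximalAtlas (𝓡 (d + 1)) ∞ N)
    (he' : e' ∈ IsManifold.maximalAtlas (𝓡 (d + 1)) ∞ N) {y : Coord d} (hy : y ∈ e.target)
    (hy' : e.symm y ∈ e'.source) : ContDiffAt ℝ ∞ (fun z => e' (e.symm z)) y := by
  rw [← contMDiffAt_iff_contDiffAt]
  exact (contMDiffAt_of_mem_maximalAtlas he' hy').comp y (contMDiffAt_symm_of_mem_maximalAtlas he hy)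

theorem fderiv_transition (he : e ∈ IsManifold.maximalAtlas (𝓡 (d + 1)) ∞ N)
    (he' : e' ∈ IsManifold.maximalAtlas (𝓡 (d + 1)) ∞ N) {y : Coord d} (hy : y ∈ e.target)
    (hy' : e.symm y ∈ e'.source) (u : Coord d) :
    fderiv ℝ (fun z => e' (e.symm z)) y u
      = chartVector e' (e.symm y) (mfderiv (𝓡 (d + 1)) (𝓡 (d + 1)) e.symm y u) := by
  have h := mfderiv_comp y ((mdifferentiable_of_mem_maximalAtlas he').mdifferentiableAt hy')
    ((mdifferentiable_of_mem_maximalAtlas he).mdifferentiableAt_symm hy)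
  rw [← mfderiv_eq_fderiv]
  exact DFunLike.congr_fun h u

theorem chartMetric_transition (g : SmoothMetric d N)
    (he : e ∈ IsManifold.maximalAtlas (𝓡 (d + 1)) ∞ N)
    (he' : e' ∈ IsManifold.maximalAtlas (𝓡 (d + 1)) ∞ N) {y : Coord d} (hy : y ∈ e.target)
    (hy' : e.symm y ∈ e'.source) (u w : Coord d) :
    chartMetric g e' (e' (e.symm y)) (fderiv ℝ (fun z => e' (e.symm z)) y u)
      (fderiv ℝ (fun z => e' (e.symm z)) y w) = chartMetric g e y u w := by
  rw [fderiv_transition he he' hy hy', fderiv_transition he he' hy hy',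
    chartMetric_chartVector g he' hy']
  rfl

theorem chartVector_transition (he : e ∈ IsManifold.maximalAtlas (𝓡 (d + 1)) ∞ N)
    (he' : e' ∈ IsManifold.maximalAtlas (𝓡 (d + 1)) ∞ N) {x : N} (hx : x ∈ e.source)
    (hx' : x ∈ e'.source) (v : TangentSpace (𝓡 (d + 1)) x) :
    fderiv ℝ (fun z => e' (e.symm z)) (e x) (chartVector e x v) = chartVector e' x v := by
  rw [fderiv_transition he he' (e.map_source hx) (by rwa [e.left_inv hx])]
  have h1 := mfderiv_symm_chartVector he hx v
  have key : ∀ (x' : N), x' = x → ∀ a : Coord d, a = v →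
      chartVector e' x' (a : TangentSpace (𝓡 (d + 1)) x') = chartVector e' x v := by
    rintro x' rfl a rfl
    rfl
  exact key _ (e.left_inv hx) _ h1

end

/-! ### Fields of inner products -/

section

variable {d : ℕ}

/-- The vector representing a linear functional. -/
def dualVec : (Coord d →L[ℝ] ℝ) →L[ℝ] Coord d :=
  ∑ i, (ContinuousLinearMap.apply ℝ ℝ (EuclideanSpace.single i 1 : Coord d)).smulRight
    (EuclideanSpace.single i 1 : Coord d)

theorem inner_dualVec (F : Coord d →L[ℝ] ℝ) (w : Coord d) : ⟪dualVec F, w⟫_ℝ = F w := by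
  have hw : w = ∑ i, w i • (EuclideanSpace.single i 1 : Coord d) := by
    have := (EuclideanSpace.basisFun (Fin (d + 1)) ℝ).sum_repr w
    simpa using this.symm
  conv_rhs => rw [hw]
  simp only [dualVec, sum_apply, ContinuousLinearMap.smulRight_apply,
    ContinuousLinearMap.apply_apply, sum_inner, inner_smul_left, map_sum, map_smul, smul_eq_mul,
    RCLike.conj_to_real, EuclideanSpace.inner_single_left, map_one, one_mul]
  exact Finset.sum_congr rfl fun i _ => mul_comm _ _

/-- A smooth field of positive definite symmetric bilinear forms on an open subset of
`ℝ^{d+1}`. -/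
structure IsMetricOn (B : Coord d → Coord d →L[ℝ] Coord d →L[ℝ] ℝ) (O : Set (Coord d)) : Prop where
  isOpen : IsOpen O
  contDiffOn : ContDiffOn ℝ ∞ B O
  symm : ∀ y u w, B y u w = B y w u
  pos : ∀ y ∈ O, ∀ u, u ≠ 0 → 0 < B y u u

/-- The operator `G` with `⟪G v, w⟫ = B(v, w)`. -/
def metricOp (B : Coord d → Coord d →L[ℝ] Coord d →L[ℝ] ℝ) (y : Coord d) : Coord d →L[ℝ] Coord d :=
  dualVec.comp (B y)

/-- The Hamiltonian `H(y, ξ) = ½ ⟪ξ, G⁻¹ ξ⟫` of the geodesic flow. -/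
def ham (B : Coord d → Coord d →L[ℝ] Coord d →L[ℝ] ℝ) (z : Coord d × Coord d) : ℝ :=
  (1 / 2 : ℝ) * ⟪z.2, (metricOp B z.1).inverse z.2⟫_ℝ

/-- The Hamiltonian vector field. -/
def hamField (B : Coord d → Coord d →L[ℝ] Coord d →L[ℝ] ℝ) (z : Coord d × Coord d) :
    Coord d × Coord d :=
  (dualVec ((fderiv ℝ (ham B) z).comp (ContinuousLinearMap.inr ℝ (Coord d) (Coord d))),
    -dualVec ((fderiv ℝ (ham B) z).comp (ContinuousLinearMap.inl ℝ (Coord d) (Coord d))))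

/-- The coordinate-free property ω(X, ·) = dH of the Hamiltonian field. With it, behaviour under
symplectic maps becomes formal. -/
theorem symp_hamField (B : Coord d → Coord d →L[ℝ] Coord d →L[ℝ] ℝ) (z k : Coord d × Coord d) :
    symp (hamField B z) k = fderiv ℝ (ham B) z k := by
  have h1 : k = ContinuousLinearMap.inl ℝ (Coord d) (Coord d) k.1
      + ContinuousLinearMap.inr ℝ (Coord d) (Coord d) k.2 := by simp
  conv_rhs => rw [h1, map_add]
  simp only [symp, hamField, inner_neg_right, inner_dualVec, real_inner_comm (dualVec _) k.1]
  simp only [ContinuousLinearMap.comp_apply]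
  ring

theorem inner_metricOp (B : Coord d → Coord d →L[ℝ] Coord d →L[ℝ] ℝ) (y u w : Coord d) :
    ⟪metricOp B y u, w⟫_ℝ = B y u w := inner_dualVec _ _

namespace IsMetricOn

variable {B B' : Coord d → Coord d →L[ℝ] Coord d →L[ℝ] ℝ} {O O' : Set (Coord d)}

theorem isInvertible (h : IsMetricOn B O) {y : Coord d} (hy : y ∈ O) :
    (metricOp B y).IsInvertible := by
  have hinj : Function.Injective (metricOp B y).toLinearMap := by
    rw [← LinearMap.ker_eq_bot, LinearMap.ker_eq_bot']
    intro u hu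
    by_contra hne
    have := h.pos y hy u hne
    rw [← inner_metricOp, show metricOp B y u = 0 from hu, inner_zero_left] at this
    exact lt_irrefl _ this
  exact ⟨(LinearEquiv.ofInjectiveEndo _ hinj).toContinuousLinearEquiv, by ext; rfl⟩

theorem metricOp_inverse (h : IsMetricOn B O) {y : Coord d} (hy : y ∈ O) (ξ : Coord d) :
    metricOp B y ((metricOp B y).inverse ξ) = ξ := (h.isInvertible hy).self_apply_inverse ξ

theorem inverse_metricOp (h : IsMetricOn B O) {y : Coord d} (hy : y ∈ O) (u : Coord d) :
    (metricOp B y).inverse (metricOp B y u) = u := (h.isInvertible hy).inverse_apply_self u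

theorem form_inverse (h : IsMetricOn B O) {y : Coord d} (hy : y ∈ O) (ξ w : Coord d) :
    B y ((metricOp B y).inverse ξ) w = ⟪ξ, w⟫_ℝ := by
  rw [← inner_metricOp, h.metricOp_inverse hy]

theorem ham_metricOp (h : IsMetricOn B O) {y : Coord d} (hy : y ∈ O) (u : Coord d) :
    ham B (y, metricOp B y u) = (1 / 2 : ℝ) * B y u u := by
  simp only [ham, h.inverse_metricOp hy, inner_metricOp]

theorem ham_eq (h : IsMetricOn B O) {z : Coord d × Coord d} (hz : z.1 ∈ O) :
    ham B z = (1 / 2 : ℝ) * B z.1 ((metricOp B z.1).inverse z.2) ((metricOp B z.1).inverse z.2) := by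
  rw [h.form_inverse hz]; rfl

theorem contDiffOn_metricOp (h : IsMetricOn B O) : ContDiffOn ℝ ∞ (metricOp B) O :=
  contDiffOn_const.clm_comp h.contDiffOn

theorem contDiffOn_inverse (h : IsMetricOn B O) :
    ContDiffOn ℝ ∞ (fun y => (metricOp B y).inverse) O := fun y hy =>
  ContDiffAt.comp_contDiffWithinAt y ((h.isInvertible hy).contDiffAt_map_inverse)
    (h.contDiffOn_metricOp y hy)

theorem contDiffOn_velocity (h : IsMetricOn B O) :
    ContDiffOn ℝ ∞ (fun z : Coord d × Coord d => (metricOp B z.1).inverse z.2) (O ×ˢ univ) :=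
  (h.contDiffOn_inverse.comp contDiffOn_fst fun _ hz => hz.1).clm_apply contDiffOn_snd

theorem contDiffOn_momentum (h : IsMetricOn B O) :
    ContDiffOn ℝ ∞ (fun z : Coord d × Coord d => metricOp B z.1 z.2) (O ×ˢ univ) :=
  (h.contDiffOn_metricOp.comp contDiffOn_fst fun _ hz => hz.1).clm_apply contDiffOn_snd

theorem isOpen_prod (h : IsMetricOn B O) : IsOpen (O ×ˢ (univ : Set (Coord d))) :=
  h.isOpen.prod isOpen_univ

theorem contDiffOn_ham (h : IsMetricOn B O) : ContDiffOn ℝ ∞ (ham B) (O ×ˢ univ) :=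
  contDiffOn_const.mul (contDiffOn_snd.inner ℝ h.contDiffOn_velocity)

theorem contDiffOn_fderiv_ham (h : IsMetricOn B O) :
    ContDiffOn ℝ ∞ (fderiv ℝ (ham B)) (O ×ˢ univ) :=
  h.contDiffOn_ham.fderiv_of_isOpen h.isOpen_prod (by simp)

theorem contDiffOn_hamField (h : IsMetricOn B O) : ContDiffOn ℝ ∞ (hamField B) (O ×ˢ univ) := by
  have h1 := h.contDiffOn_fderiv_ham
  exact (dualVec.contDiff.comp_contDiffOn (h1.clm_comp contDiffOn_const)).prodMk
    (dualVec.contDiff.comp_contDiffOn (h1.clm_comp contDiffOn_const)).neg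

/-- Since ω(DX p, q) = D²H(p, q), the identity is the symmetry of the second derivative of H. It
says that the linearized flow preserves ω infinitesimally. -/
theorem symp_fderiv_hamField (h : IsMetricOn B O) {z : Coord d × Coord d} (hz : z.1 ∈ O)
    (a b : Coord d × Coord d) :
    symp (fderiv ℝ (hamField B) z a) b + symp a (fderiv ℝ (hamField B) z b) = 0 := by
  have hmem : O ×ˢ (univ : Set (Coord d)) ∈ 𝓝 z := h.isOpen_prod.mem_nhds ⟨hz, mem_univ _⟩
  have hS : DifferentiableAt ℝ (hamField B) z :=
    (h.contDiffOn_hamField.contDiffAt hmem).differentiableAt (by simp)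
  have hD : DifferentiableAt ℝ (fderiv ℝ (ham B)) z :=
    (h.contDiffOn_fderiv_ham.contDiffAt hmem).differentiableAt (by simp)
  have key : ∀ p q, symp (fderiv ℝ (hamField B) z p) q = fderiv ℝ (fderiv ℝ (ham B)) z p q := by
    intro p q
    have h1 : HasFDerivAt (fun z => fderiv ℝ (ham B) z q)
        ((fderiv ℝ (fderiv ℝ (ham B)) z).flip q) z := by
      simpa using! hD.hasFDerivAt.clm_apply (hasFDerivAt_const q z)
    have h2 : HasFDerivAt (fun z => symp (hamField B z) q) _ z :=
      (hS.hasFDerivAt.fst.inner ℝ (hasFDerivAt_const q.2 z)).sub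
        ((hasFDerivAt_const q.1 z).inner ℝ hS.hasFDerivAt.snd)
    simp only [symp_hamField] at h2
    have h3 := DFunLike.congr_fun (h1.unique h2) p
    simp only [ContinuousLinearMap.flip_apply] at h3
    rw [h3]
    simp [symp, fderivInnerCLM_apply]
  have hsym : IsSymmSndFDerivAt ℝ (ham B) z :=
    (h.contDiffOn_ham.contDiffAt hmem).isSymmSndFDerivAt
      (by simpa using! WithTop.coe_le_coe.2 (le_top : (2 : ℕ∞) ≤ ⊤))
  have h1 : symp a (fderiv ℝ (hamField B) z b) = - symp (fderiv ℝ (hamField B) z b) a := by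
    simp only [symp]; ring
  rw [h1, key, key, hsym.eq]
  ring

/-- Hamilton's first equation: G⁻¹ is symmetric, so the ξ-gradient of ½⟨ξ, G⁻¹ξ⟩ is G⁻¹ξ, which is
the velocity. -/
theorem hamField_fst (h : IsMetricOn B O) {z : Coord d × Coord d} (hz : z.1 ∈ O) :
    (hamField B z).1 = (metricOp B z.1).inverse z.2 := by
  refine ext_inner_right ℝ fun w => ?_
  have hmem : O ×ˢ (univ : Set (Coord d)) ∈ 𝓝 z := h.isOpen_prod.mem_nhds ⟨hz, mem_univ _⟩
  have hd : DifferentiableAt ℝ (ham B) z :=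
    (h.contDiffOn_ham.contDiffAt hmem).differentiableAt (by simp)
  set A := (metricOp B z.1).inverse
  have hA : ∀ p q, ⟪A p, q⟫_ℝ = ⟪p, A q⟫_ℝ := by
    intro p q
    rw [real_inner_comm, ← h.form_inverse hz q (A p), h.symm, h.form_inverse hz p]
  have h1 : HasFDerivAt (fun ξ => ham B (z.1, ξ))
      ((fderiv ℝ (ham B) z).comp (ContinuousLinearMap.inr ℝ (Coord d) (Coord d))) z.2 :=
    HasFDerivAt.comp (f := fun ξ => (z.1, ξ)) z.2 hd.hasFDerivAt (hasFDerivAt_prodMk_right z.1 z.2)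
  have h2 : HasFDerivAt (fun ξ => ham B (z.1, ξ)) _ z.2 :=
    (((hasFDerivAt_id z.2).inner ℝ (A.hasFDerivAt (x := z.2))).const_mul (1 / 2 : ℝ))
  have h3 := DFunLike.congr_fun (h1.unique h2) w
  change ⟪dualVec _, w⟫_ℝ = _
  rw [inner_dualVec, h3]
  simp only [smul_apply, ContinuousLinearMap.comp_apply, fderivInnerCLM_apply,
    ContinuousLinearMap.prod_apply, ContinuousLinearMap.id_apply, id, smul_eq_mul]
  rw [← hA, real_inner_comm (A z.2) w]
  ring

/-- The inverse of G need not be differentiated: along y' ↦ (y', G(y')u) with u fixed, H is ½B(u,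
u). The chain rule subtracts the contribution of the moving momentum, which is twice as large, and
this produces the sign +½. -/
theorem inner_hamField_snd (h : IsMetricOn B O) {y : Coord d} (hy : y ∈ O) (u w : Coord d) :
    ⟪(hamField B (y, metricOp B y u)).2, w⟫_ℝ
      = (1 / 2 : ℝ) * fderiv ℝ (fun z => B z u u) y w := by
  set z : Coord d × Coord d := (y, metricOp B y u)
  have hmem : O ×ˢ (univ : Set (Coord d)) ∈ 𝓝 z := h.isOpen_prod.mem_nhds ⟨hy, mem_univ _⟩
  have hd : DifferentiableAt ℝ (ham B) z :=
    (h.contDiffOn_ham.contDiffAt hmem).differentiableAt (by simp)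
  have hB : DifferentiableAt ℝ B y :=
    (h.contDiffOn.contDiffAt (h.isOpen.mem_nhds hy)).differentiableAt (by simp)
  have hG : HasFDerivAt (fun y' => metricOp B y' u) (dualVec.comp ((fderiv ℝ B y).flip u)) y := by
    have h1 : HasFDerivAt (fun y' => B y' u) ((fderiv ℝ B y).flip u) y := by
      simpa using! hB.hasFDerivAt.clm_apply (hasFDerivAt_const u y)
    exact dualVec.hasFDerivAt.comp y h1
  have hBu : HasFDerivAt (fun y' => B y' u u) (((fderiv ℝ B y).flip u).flip u) y := by
    have h1 : HasFDerivAt (fun y' => B y' u) ((fderiv ℝ B y).flip u) y := by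
      simpa using! hB.hasFDerivAt.clm_apply (hasFDerivAt_const u y)
    simpa using! h1.clm_apply (hasFDerivAt_const u y)
  have h1 : HasFDerivAt (fun y' => ham B (y', metricOp B y' u))
      ((fderiv ℝ (ham B) z).comp ((ContinuousLinearMap.id ℝ (Coord d)).prod
        (dualVec.comp ((fderiv ℝ B y).flip u)))) y :=
    HasFDerivAt.comp (f := fun y' => (y', metricOp B y' u)) y hd.hasFDerivAt
      ((hasFDerivAt_id y).prodMk hG)
  have h2 : HasFDerivAt (fun y' => ham B (y', metricOp B y' u))
      ((1 / 2 : ℝ) • (((fderiv ℝ B y).flip u).flip u)) y := by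
    refine (hBu.const_mul (1 / 2 : ℝ)).congr_of_eventuallyEq ?_
    filter_upwards [h.isOpen.mem_nhds hy] with y' hy'
    exact h.ham_metricOp hy' u
  have h3 := DFunLike.congr_fun (h1.unique h2) w
  have h4 := h.hamField_fst (z := z) hy
  rw [show (metricOp B z.1).inverse z.2 = u from h.inverse_metricOp hy u] at h4
  have h5 := symp_hamField B z (w, dualVec ((fderiv ℝ B y).flip u w))
  have h6 : fderiv ℝ (ham B) z (w, dualVec ((fderiv ℝ B y).flip u w))
      = (1 / 2 : ℝ) * (fderiv ℝ B y w u u) := h3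
  rw [h6, symp, h4, real_inner_comm, inner_dualVec, real_inner_comm] at h5
  rw [hBu.fderiv]
  simp only [ContinuousLinearMap.flip_apply] at h5 ⊢
  linarith

end IsMetricOn

end

/-! ### Isometries and the geodesic equation -/

section

variable {d : ℕ}

/-- The Christoffel symbols of the first kind of a field of bilinear forms. -/
def formChristoffel (B : Coord d → Coord d →L[ℝ] Coord d →L[ℝ] ℝ) (y u v w : Coord d) : ℝ :=
  (1 / 2 : ℝ) *
    (fderiv ℝ (fun z => B z v w) y u + fderiv ℝ (fun z => B z u w) y v
      - fderiv ℝ (fun z => B z u v) y w)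

theorem hasDerivAt_clm_comp_apply {E F G : Type*} [NormedAddCommGroup E] [NormedSpace ℝ E]
    [NormedAddCommGroup F] [NormedSpace ℝ F] [NormedAddCommGroup G] [NormedSpace ℝ G]
    {B : E → F →L[ℝ] G} {B' : E →L[ℝ] F →L[ℝ] G} {u : ℝ → E} {v : ℝ → F} {t : ℝ} {u' : E} {a : F}
    (hB : HasFDerivAt B B' (u t)) (hu : HasDerivAt u u' t) (hv : HasDerivAt v a t) :
    HasDerivAt (fun s => B (u s) (v s)) (B' u' (v t) + B (u t) a) t :=
  (hB.comp_hasDerivAt t hu).clm_apply hv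

namespace IsMetricOn

variable {B B' : Coord d → Coord d →L[ℝ] Coord d →L[ℝ] ℝ} {O O' : Set (Coord d)}

theorem differentiableAt (h : IsMetricOn B O) {y : Coord d} (hy : y ∈ O) :
    DifferentiableAt ℝ B y :=
  (h.contDiffOn.contDiffAt (h.isOpen.mem_nhds hy)).differentiableAt (by simp)

theorem fderiv_apply_apply (h : IsMetricOn B O) {y : Coord d} (hy : y ∈ O) (a u w : Coord d) :
    fderiv ℝ (fun z => B z u w) y a = fderiv ℝ B y a u w := by
  have h1 : HasFDerivAt (fun y' => B y' u) ((fderiv ℝ B y).flip u) y := by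
    simpa using! (h.differentiableAt hy).hasFDerivAt.clm_apply (hasFDerivAt_const u y)
  have h2 : HasFDerivAt (fun y' => B y' u w) (((fderiv ℝ B y).flip u).flip w) y := by
    simpa using! h1.clm_apply (hasFDerivAt_const w y)
  rw [h2.fderiv]
  rfl

theorem hasDerivAt_momentum (h : IsMetricOn B O) {u v : ℝ → Coord d} {t : ℝ} {a : Coord d}
    (hu : u t ∈ O) (hu' : HasDerivAt u (v t) t) (hv : HasDerivAt v a t) :
    HasDerivAt (fun s => metricOp B (u s) (v s))
      (dualVec (fderiv ℝ B (u t) (v t) (v t) + B (u t) a)) t := by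
  exact dualVec.hasFDerivAt.comp_hasDerivAt t
    (hasDerivAt_clm_comp_apply (h.differentiableAt hu).hasFDerivAt hu' hv)

/-- The geodesic equation in Hamiltonian form. -/
theorem hasDerivAt_iff_geodesic (h : IsMetricOn B O) {u v : ℝ → Coord d} {t : ℝ} {a : Coord d}
    (hu : u t ∈ O) (hu' : HasDerivAt u (v t) t) (hv : HasDerivAt v a t) :
    HasDerivAt (fun s => (u s, metricOp B (u s) (v s)))
        (hamField B (u t, metricOp B (u t) (v t))) t ↔
      ∀ w, B (u t) a w + formChristoffel B (u t) (v t) (v t) w = 0 := by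
  have h1 := h.hasDerivAt_momentum hu hu' hv
  have h2 : (hamField B (u t, metricOp B (u t) (v t))).1 = v t := by
    rw [h.hamField_fst (z := (u t, metricOp B (u t) (v t))) hu]
    exact h.inverse_metricOp hu _
  have h3 : (HasDerivAt (fun s => (u s, metricOp B (u s) (v s)))
        (hamField B (u t, metricOp B (u t) (v t))) t) ↔
      dualVec (fderiv ℝ B (u t) (v t) (v t) + B (u t) a)
        = (hamField B (u t, metricOp B (u t) (v t))).2 := by
    constructor
    · intro H
      exact h1.unique H.snd
    · intro H
      refine (hu'.prodMk h1).congr_deriv (Prod.ext h2.symm H)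
  rw [h3]
  constructor
  · intro H w
    have h4 := congrArg (fun x => ⟪x, w⟫_ℝ) H
    simp only [inner_dualVec, h.inner_hamField_snd hu, add_apply] at h4
    simp only [formChristoffel, h.fderiv_apply_apply hu] at h4 ⊢
    linarith
  · intro H
    refine ext_inner_right ℝ fun w => ?_
    have h4 := H w
    rw [inner_dualVec, h.inner_hamField_snd hu, add_apply]
    simp only [formChristoffel, h.fderiv_apply_apply hu] at h4 ⊢
    linarith

/-- Integral curves of the Hamiltonian field are `C²` and their base curves satisfy the geodesic
equation. -/
theorem geodesic_of_hasDerivAt (h : IsMetricOn B O) {z : ℝ → Coord d × Coord d} {J : Set ℝ}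
    (hJ : IsOpen J) (hzO : ∀ t ∈ J, (z t).1 ∈ O)
    (hz : ∀ t ∈ J, HasDerivAt z (hamField B (z t)) t) :
    ContDiffOn ℝ 2 z J ∧ ∀ t ∈ J,
      deriv (fun s => (z s).1) t = (metricOp B (z t).1).inverse (z t).2 ∧
      ∀ w, B (z t).1 (deriv (deriv fun s => (z s).1) t) w
        + formChristoffel B (z t).1 (deriv (fun s => (z s).1) t) (deriv (fun s => (z s).1) t) w
          = 0 := by
  have hcont : ContinuousOn z J := fun t ht => (hz t ht).continuousAt.continuousWithinAt
  have hderiv : ∀ t ∈ J, deriv z t = hamField B (z t) := fun t ht => (hz t ht).deriv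
  have hdiff : DifferentiableOn ℝ z J := fun t ht =>
    (hz t ht).differentiableAt.differentiableWithinAt
  have hmaps : MapsTo z J (O ×ˢ univ) := fun t ht => ⟨hzO t ht, mem_univ _⟩
  -- Bootstrapping: z is continuous, so z' = X(z) is continuous, so z is C¹, and then z' is C¹.
  have h1 : ContDiffOn ℝ 1 z J := by
    rw [show (1 : WithTop ℕ∞) = 0 + 1 by norm_num, contDiffOn_succ_iff_deriv_of_isOpen hJ]
    refine ⟨hdiff, by simp, ?_⟩
    rw [contDiffOn_zero]
    exact (h.contDiffOn_hamField.continuousOn.comp hcont hmaps).congr hderiv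
  have h2 : ContDiffOn ℝ 2 z J := by
    rw [show (2 : WithTop ℕ∞) = 1 + 1 by norm_num, contDiffOn_succ_iff_deriv_of_isOpen hJ]
    refine ⟨hdiff, by simp, ?_⟩
    exact ((h.contDiffOn_hamField.of_le (by simp)).comp h1 hmaps).congr hderiv
  refine ⟨h2, fun t ht => ?_⟩
  set v : ℝ → Coord d := fun s => (metricOp B (z s).1).inverse (z s).2
  have hu' : ∀ s ∈ J, HasDerivAt (fun s => (z s).1) (v s) s := by
    intro s hs
    have this : HasDerivAt (fun s => (z s).1) (hamField B (z s)).1 s := (hz s hs).fst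
    rwa [h.hamField_fst (hzO s hs)] at this
  have hdv : ∀ s ∈ J, deriv (fun s => (z s).1) s = v s := fun s hs => (hu' s hs).deriv
  have hv : DifferentiableAt ℝ v t :=
    DifferentiableAt.comp (g := fun z : Coord d × Coord d => (metricOp B z.1).inverse z.2) t
      ((h.contDiffOn_velocity.contDiffAt (h.isOpen_prod.mem_nhds (hmaps ht))).differentiableAt
        (by simp)) (hz t ht).differentiableAt
  have hev : deriv (fun s => (z s).1) =ᶠ[𝓝 t] v := by
    filter_upwards [hJ.mem_nhds ht] with s hs using hdv s hs
  refine ⟨hdv t ht, ?_⟩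
  rw [hev.deriv_eq, hdv t ht]
  refine (h.hasDerivAt_iff_geodesic (u := fun s => (z s).1) (hzO t ht) (hu' t ht)
    hv.hasDerivAt).1 ?_
  have hz2 : ∀ s ∈ J, ((z s).1, metricOp B (z s).1 (v s)) = z s := fun s hs =>
    Prod.ext rfl (h.metricOp_inverse (hzO s hs) _)
  rw [hz2 t ht]
  refine (hz t ht).congr_of_eventuallyEq ?_
  filter_upwards [hJ.mem_nhds ht] with s hs using hz2 s hs

end IsMetricOn

/-- The cotangent lift of the map `f`. -/
def cotLift (B B' : Coord d → Coord d →L[ℝ] Coord d →L[ℝ] ℝ) (f : Coord d → Coord d)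
    (z : Coord d × Coord d) : Coord d × Coord d :=
  (f z.1, metricOp B' (f z.1) (fderiv ℝ f z.1 ((metricOp B z.1).inverse z.2)))

/-- `f` is a local isometry on the open set `U`. -/
structure IsIsometryOn (B B' : Coord d → Coord d →L[ℝ] Coord d →L[ℝ] ℝ) (f : Coord d → Coord d)
    (U : Set (Coord d)) : Prop where
  isOpen : IsOpen U
  contDiffOn : ContDiffOn ℝ ∞ f U
  form_eq : ∀ y ∈ U, ∀ u w, B' (f y) (fderiv ℝ f y u) (fderiv ℝ f y w) = B y u w

namespace IsIsometryOn

variable {B B' : Coord d → Coord d →L[ℝ] Coord d →L[ℝ] ℝ} {O O' U : Set (Coord d)}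
  {f : Coord d → Coord d}

theorem contDiffOn_cotLift (hf : IsIsometryOn B B' f U) (h : IsMetricOn B O)
    (h' : IsMetricOn B' O') (hU : U ⊆ O) (hU' : MapsTo f U O') :
    ContDiffOn ℝ ∞ (cotLift B B' f) (U ×ˢ univ) := by
  have h1 : ContDiffOn ℝ ∞ (fun z : Coord d × Coord d => f z.1) (U ×ˢ univ) :=
    hf.contDiffOn.comp contDiffOn_fst fun z hz => hz.1
  have h2 : ContDiffOn ℝ ∞ (fun z : Coord d × Coord d => fderiv ℝ f z.1) (U ×ˢ univ) :=
    (hf.contDiffOn.fderiv_of_isOpen hf.isOpen (m := ∞) (by simp)).comp contDiffOn_fst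
      fun z hz => hz.1
  have h3 := h.contDiffOn_velocity.mono (prod_mono_left hU)
  exact h1.prodMk (h'.contDiffOn_momentum.comp (h1.prodMk (h2.clm_apply h3))
    fun z hz => ⟨hU' hz.1, mem_univ _⟩)

/-- The lift acts on momenta by the inverse transpose of Df. Equivalently, it preserves the
canonical one-form ξ·dy; differentiating this identity yields symplecticity. -/
theorem inner_cotLift (hf : IsIsometryOn B B' f U) (h : IsMetricOn B O) (hU : U ⊆ O)
    {z : Coord d × Coord d} (hz : z.1 ∈ U) (a : Coord d) :
    ⟪(cotLift B B' f z).2, fderiv ℝ f z.1 a⟫_ℝ = ⟪z.2, a⟫_ℝ := by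
  rw [cotLift, inner_metricOp, hf.form_eq _ hz, h.form_inverse (hU hz)]

theorem ham_cotLift (hf : IsIsometryOn B B' f U) (h : IsMetricOn B O)
    (h' : IsMetricOn B' O') (hU : U ⊆ O) (hU' : MapsTo f U O') {z : Coord d × Coord d}
    (hz : z.1 ∈ U) : ham B' (cotLift B B' f z) = ham B z := by
  rw [cotLift, h'.ham_metricOp (hU' hz), hf.form_eq _ hz, h.ham_eq (hU hz)]

theorem differentiableAt_cotLift (hf : IsIsometryOn B B' f U) (h : IsMetricOn B O)
    (h' : IsMetricOn B' O') (hU : U ⊆ O) (hU' : MapsTo f U O') {z : Coord d × Coord d}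
    (hz : z.1 ∈ U) : DifferentiableAt ℝ (cotLift B B' f) z :=
  ((hf.contDiffOn_cotLift h h' hU hU').contDiffAt
    ((hf.isOpen.prod isOpen_univ).mem_nhds ⟨hz, mem_univ _⟩)).differentiableAt (by simp)

/-- The cotangent lift is symplectic. -/
theorem symp_fderiv_cotLift (hf : IsIsometryOn B B' f U) (h : IsMetricOn B O)
    (h' : IsMetricOn B' O') (hU : U ⊆ O) (hU' : MapsTo f U O') {z : Coord d × Coord d}
    (hz : z.1 ∈ U) (a b : Coord d × Coord d) :
    symp (fderiv ℝ (cotLift B B' f) z a) (fderiv ℝ (cotLift B B' f) z b) = symp a b := by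
  have hT := (hf.differentiableAt_cotLift h h' hU hU' hz).hasFDerivAt
  have hmem := hf.isOpen.mem_nhds hz
  have hDf : DifferentiableAt ℝ (fderiv ℝ f) z.1 :=
    ((hf.contDiffOn.fderiv_of_isOpen hf.isOpen (m := ∞) (by simp)).contDiffAt
      hmem).differentiableAt (by simp)
  have hsym : IsSymmSndFDerivAt ℝ f z.1 := (hf.contDiffOn.contDiffAt hmem).isSymmSndFDerivAt
    (by simpa using! WithTop.coe_le_coe.2 (le_top : (2 : ℕ∞) ≤ ⊤))
  have hfst : ∀ k, (fderiv ℝ (cotLift B B' f) z k).1 = fderiv ℝ f z.1 k.1 := by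
    intro k
    have h1 : HasFDerivAt (fun z : Coord d × Coord d => f z.1) _ z :=
      HasFDerivAt.comp z
        ((hf.contDiffOn.contDiffAt hmem).differentiableAt (by simp)).hasFDerivAt hasFDerivAt_fst
    exact DFunLike.congr_fun (hT.fst.unique h1) k
  -- The derivative of the identity ⟨ξ', Df c⟩ = ⟨ξ, c⟩. The terms with D²f disappear in the
  -- antisymmetric form because D²f is symmetric.
  have key : ∀ k c, ⟪(fderiv ℝ (cotLift B B' f) z k).2, fderiv ℝ f z.1 c⟫_ℝ
      = ⟪k.2, c⟫_ℝ - ⟪(cotLift B B' f z).2, fderiv ℝ (fderiv ℝ f) z.1 k.1 c⟫_ℝ := by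
    intro k c
    have h1 : HasFDerivAt (fun z : Coord d × Coord d => fderiv ℝ f z.1 c)
        (((fderiv ℝ (fderiv ℝ f) z.1).comp (ContinuousLinearMap.fst ℝ _ _)).flip c) z := by
      simpa using! (hDf.hasFDerivAt.comp z hasFDerivAt_fst).clm_apply (hasFDerivAt_const c z)
    have h2 := hT.snd.inner ℝ h1
    have h3 : HasFDerivAt (fun z : Coord d × Coord d => ⟪z.2, c⟫_ℝ) _ z :=
      (hasFDerivAt_snd (p := z)).inner ℝ (hasFDerivAt_const c z)
    have h4 : (fun z : Coord d × Coord d =>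
        ⟪(cotLift B B' f z).2, fderiv ℝ f z.1 c⟫_ℝ) =ᶠ[𝓝 z] fun z => ⟪z.2, c⟫_ℝ := by
      filter_upwards [(hf.isOpen.prod isOpen_univ).mem_nhds
        (show z ∈ U ×ˢ (univ : Set (Coord d)) from ⟨hz, mem_univ _⟩)] with z' hz'
      exact hf.inner_cotLift h hU hz'.1 c
    have h5 := DFunLike.congr_fun (h2.unique (h3.congr_of_eventuallyEq h4)) k
    simp only [ContinuousLinearMap.comp_apply, fderivInnerCLM_apply,
      ContinuousLinearMap.prod_apply, ContinuousLinearMap.flip_apply,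
      ContinuousLinearMap.coe_fst', ContinuousLinearMap.coe_snd', zero_apply,
      inner_zero_right, zero_add] at h5
    linarith
  have hs := hsym.eq a.1 b.1
  simp only [symp, hfst]
  rw [real_inner_comm _ (fderiv ℝ f z.1 a.1), real_inner_comm _ (fderiv ℝ f z.1 b.1), key, key, hs,
    real_inner_comm a.1, real_inner_comm b.1]
  ring

/-- A symplectic map that carries one Hamiltonian to another carries the Hamiltonian fields to each
other, because these are determined by ω and dH. This makes the flow independent of the chart. -/
theorem fderiv_cotLift_hamField (hf : IsIsometryOn B B' f U) (h : IsMetricOn B O)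
    (h' : IsMetricOn B' O') (hU : U ⊆ O) (hU' : MapsTo f U O') {z : Coord d × Coord d}
    (hz : z.1 ∈ U) :
    fderiv ℝ (cotLift B B' f) z (hamField B z) = hamField B' (cotLift B B' f z) := by
  have hsymp := hf.symp_fderiv_cotLift h h' hU hU' hz
  set D := fderiv ℝ (cotLift B B' f) z
  have hinj : Function.Injective D.toLinearMap := by
    intro p q hpq
    refine symp_eq_of_forall fun k => ?_
    rw [← hsymp p k, ← hsymp q k, show D p = D q from hpq]
  -- A symplectic derivative is injective, hence bijective in finite dimension, so both sides may be
  -- tested against vectors of the form D k.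
  have hsurj := LinearMap.injective_iff_surjective.1 hinj
  refine symp_eq_of_forall fun k' => ?_
  obtain ⟨k, rfl⟩ := hsurj k'
  have hT := (hf.differentiableAt_cotLift h h' hU hU' hz).hasFDerivAt
  have hH' : DifferentiableAt ℝ (ham B') (cotLift B B' f z) :=
    (h'.contDiffOn_ham.contDiffAt (h'.isOpen_prod.mem_nhds ⟨hU' hz, mem_univ _⟩)).differentiableAt
      (by simp)
  have hH : DifferentiableAt ℝ (ham B) z :=
    (h.contDiffOn_ham.contDiffAt (h.isOpen_prod.mem_nhds ⟨hU hz, mem_univ _⟩)).differentiableAt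
      (by simp)
  have h4 : (fun z => ham B' (cotLift B B' f z)) =ᶠ[𝓝 z] ham B := by
    filter_upwards [(hf.isOpen.prod isOpen_univ).mem_nhds
      (show z ∈ U ×ˢ (univ : Set (Coord d)) from ⟨hz, mem_univ _⟩)] with z' hz'
    exact hf.ham_cotLift h h' hU hU' hz'.1
  have h5 := DFunLike.congr_fun
    ((hH'.hasFDerivAt.comp z hT).unique (hH.hasFDerivAt.congr_of_eventuallyEq h4)) k
  change symp (D (hamField B z)) (D k) = symp _ (D k)
  rw [hsymp, symp_hamField, symp_hamField]
  exact h5.symm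

end IsIsometryOn

end

/-! ### Cotangent coordinates -/

section

variable {d : ℕ} {N : Type*} [TopologicalSpace N]
  [ChartedSpace (EuclideanSpace ℝ (Fin (d + 1))) N] [IsManifold (𝓡 (d + 1)) ∞ N]
  {g : SmoothMetric d N} {e e' : OpenPartialHomeomorph N (EuclideanSpace ℝ (Fin (d + 1)))}

/-- The charts of the smooth structure of `N`. -/
abbrev smoothCharts (d : ℕ) (N : Type*) [TopologicalSpace N]
    [ChartedSpace (EuclideanSpace ℝ (Fin (d + 1))) N] :=
  IsManifold.maximalAtlas (𝓡 (d + 1)) ∞ N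

theorem exists_smoothChart (d : ℕ) {N : Type*} [TopologicalSpace N]
    [ChartedSpace (EuclideanSpace ℝ (Fin (d + 1))) N] [IsManifold (𝓡 (d + 1)) ∞ N] (x : N) :
    ∃ e ∈ smoothCharts d N, x ∈ e.source :=
  ⟨chartAt _ x, IsManifold.chart_mem_maximalAtlas x, mem_chart_source _ x⟩

theorem isMetricOn_chartForm (g : SmoothMetric d N) (he : e ∈ smoothCharts d N) :
    IsMetricOn (chartForm g e) e.target where
  isOpen := e.open_target
  contDiffOn := contDiffOn_chartForm g he
  symm _ u w := chartMetric_symm g _ u w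
  pos _ hy _ hu := chartMetric_pos g he hy hu

theorem isIsometryOn_transition (g : SmoothMetric d N) (he : e ∈ smoothCharts d N)
    (he' : e' ∈ smoothCharts d N) :
    IsIsometryOn (chartForm g e) (chartForm g e') (fun y => e' (e.symm y))
      (e.target ∩ e.symm ⁻¹' e'.source) where
  isOpen := e.isOpen_inter_preimage_symm e'.open_source
  contDiffOn _ hy := (contDiffAt_transition he he' hy.1 hy.2).contDiffWithinAt
  form_eq _ hy u w := chartMetric_transition g he he' hy.1 hy.2 u w

/-- The points of the tangent bundle over the domain of the chart `e`. -/
def overSource (e : OpenPartialHomeomorph N (EuclideanSpace ℝ (Fin (d + 1)))) :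
    Set (TangentBundle (𝓡 (d + 1)) N) := {p | p.1 ∈ e.source}

theorem continuous_base : Continuous fun p : TangentBundle (𝓡 (d + 1)) N => p.1 :=
  FiberBundle.continuous_proj _ _

theorem isOpen_overSource : IsOpen (overSource e) := e.open_source.preimage continuous_base

/-- The chart `(x, v) ↦ (e(x), G(e(x)) de_x(v))` of the tangent bundle: position and momentum. -/
def cotChart (g : SmoothMetric d N)
    (e : OpenPartialHomeomorph N (EuclideanSpace ℝ (Fin (d + 1))))
    (p : TangentBundle (𝓡 (d + 1)) N) : Coord d × Coord d :=
  (e p.1, metricOp (chartForm g e) (e p.1) (chartVector e p.1 p.2))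

/-- The inverse of `cotChart`. -/
def cotChartInv (g : SmoothMetric d N)
    (e : OpenPartialHomeomorph N (EuclideanSpace ℝ (Fin (d + 1)))) (z : Coord d × Coord d) :
    TangentBundle (𝓡 (d + 1)) N :=
  ⟨e.symm z.1, mfderiv (𝓡 (d + 1)) (𝓡 (d + 1)) e.symm z.1
    ((metricOp (chartForm g e) z.1).inverse z.2)⟩

theorem cotChart_mem {p : TangentBundle (𝓡 (d + 1)) N} (hp : p.1 ∈ e.source) :
    cotChart g e p ∈ e.target ×ˢ (univ : Set (Coord d)) := ⟨e.map_source hp, mem_univ _⟩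

theorem cotChartInv_mem {z : Coord d × Coord d} (hz : z.1 ∈ e.target) :
    cotChartInv g e z ∈ overSource e := e.map_target hz

theorem continuousOn_cotChart (g : SmoothMetric d N) (he : e ∈ smoothCharts d N) :
    ContinuousOn (cotChart g e) (overSource e) := by
  have h1 := continuousOn_chartVector he
  have h2 := (isMetricOn_chartForm g he).contDiffOn_momentum.continuousOn.comp h1
    fun p hp => ⟨e.map_source hp, mem_univ _⟩
  exact (continuous_fst.comp_continuousOn h1).prodMk h2

theorem continuousOn_cotChartInv (g : SmoothMetric d N) (he : e ∈ smoothCharts d N) :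
    ContinuousOn (cotChartInv g e) (e.target ×ˢ univ) := by
  have h1 := (isMetricOn_chartForm g he).contDiffOn_velocity.continuousOn
  exact (continuousOn_tangent_symm he).comp (continuousOn_fst.prodMk h1)
    fun z hz => ⟨hz.1, mem_univ _⟩

theorem cotChart_cotChartInv (g : SmoothMetric d N) (he : e ∈ smoothCharts d N)
    {z : Coord d × Coord d} (hz : z.1 ∈ e.target) : cotChart g e (cotChartInv g e z) = z := by
  have h1 : e (cotChartInv g e z).1 = z.1 := e.right_inv hz
  have h2 : chartVector e (cotChartInv g e z).1 (cotChartInv g e z).2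
      = (metricOp (chartForm g e) z.1).inverse z.2 := chartVector_mfderiv_symm he hz _
  refine Prod.ext h1 ?_
  change metricOp (chartForm g e) (e (cotChartInv g e z).1) _ = _
  rw [h1, h2, (isMetricOn_chartForm g he).metricOp_inverse hz]

theorem cotChartInv_cotChart (g : SmoothMetric d N) (he : e ∈ smoothCharts d N)
    {p : TangentBundle (𝓡 (d + 1)) N} (hp : p.1 ∈ e.source) :
    cotChartInv g e (cotChart g e p) = p := by
  obtain ⟨x, v⟩ := p
  have h1 := mfderiv_symm_chartVector he hp v
  have h2 : (metricOp (chartForm g e) (e x)).inverse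
      (metricOp (chartForm g e) (e x) (chartVector e x v)) = chartVector e x v :=
    (isMetricOn_chartForm g he).inverse_metricOp (e.map_source hp) _
  have key : ∀ (x' : N), x' = x → ∀ a : Coord d, a = v →
      (⟨x', (a : TangentSpace (𝓡 (d + 1)) x')⟩ : TangentBundle (𝓡 (d + 1)) N) = ⟨x, v⟩ := by
    rintro x' rfl a rfl
    rfl
  refine key _ (e.left_inv hp) _ ?_
  simp only [cotChart, h2]
  exact h1

theorem cotChart_injOn (g : SmoothMetric d N) (he : e ∈ smoothCharts d N) :
    InjOn (cotChart g e) (overSource e) := fun p hp q hq h => by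
  rw [← cotChartInv_cotChart g he hp, h, cotChartInv_cotChart g he hq]

theorem ham_cotChart (g : SmoothMetric d N) (he : e ∈ smoothCharts d N)
    {p : TangentBundle (𝓡 (d + 1)) N} (hp : p.1 ∈ e.source) :
    ham (chartForm g e) (cotChart g e p) = (1 / 2 : ℝ) * g.inner p.1 p.2 p.2 := by
  rw [cotChart, (isMetricOn_chartForm g he).ham_metricOp (e.map_source hp), chartForm_apply,
    chartMetric_chartVector g he hp]

theorem velocity_cotChart (g : SmoothMetric d N) (he : e ∈ smoothCharts d N)
    {p : TangentBundle (𝓡 (d + 1)) N} (hp : p.1 ∈ e.source) :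
    (metricOp (chartForm g e) (cotChart g e p).1).inverse (cotChart g e p).2
      = chartVector e p.1 p.2 :=
  (isMetricOn_chartForm g he).inverse_metricOp (e.map_source hp) _

theorem cotChart_transition (g : SmoothMetric d N) (he : e ∈ smoothCharts d N)
    (he' : e' ∈ smoothCharts d N) {p : TangentBundle (𝓡 (d + 1)) N} (hp : p.1 ∈ e.source)
    (hp' : p.1 ∈ e'.source) :
    cotChart g e' p = cotLift (chartForm g e) (chartForm g e') (fun y => e' (e.symm y))
      (cotChart g e p) := by
  rw [cotLift, velocity_cotChart g he hp]
  simp only [cotChart, e.left_inv hp, chartVector_transition he he' hp hp']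

/-- Vectors at one point are separated by their coordinates in a chart, vectors at different points
by their base points. Uniqueness of flow lines needs closedness of the set where two curves agree.
-/
instance t2Space_tangentBundle [T2Space N] : T2Space (TangentBundle (𝓡 (d + 1)) N) := by
  refine ⟨fun p q hpq => ?_⟩
  by_cases h : p.1 = q.1
  · obtain ⟨e, he, hp⟩ := exists_smoothChart d p.1
    have hq : q.1 ∈ e.source := h ▸ hp
    have hc := continuousOn_chartVector he
    have hne : (e p.1, chartVector e p.1 p.2) ≠ (e q.1, chartVector e q.1 q.2) := by
      intro H
      apply hpq
      obtain ⟨x, v⟩ := p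
      obtain ⟨x', v'⟩ := q
      obtain rfl : x = x' := h
      have h1 := mfderiv_symm_chartVector he hp v
      have h2 := mfderiv_symm_chartVector he hp v'
      have h3 : chartVector e x v = chartVector e x v' := congrArg Prod.snd H
      rw [h3] at h1
      have h4 : v = v' := h1.symm.trans h2
      rw [h4]
    obtain ⟨u, w, hu, hw, hpu, hqw, hd⟩ := t2_separation hne
    refine ⟨overSource e ∩ _ ⁻¹' u, overSource e ∩ _ ⁻¹' w,
      hc.isOpen_inter_preimage isOpen_overSource hu, hc.isOpen_inter_preimage isOpen_overSource hw,
      ⟨hp, hpu⟩, ⟨hq, hqw⟩, ?_⟩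
    exact (hd.preimage _).mono inter_subset_right inter_subset_right
  · obtain ⟨u, w, hu, hw, hpu, hqw, hd⟩ := t2_separation h
    exact ⟨_, _, hu.preimage continuous_base, hw.preimage continuous_base, hpu, hqw,
      hd.preimage _⟩

/-! ### Flow lines: independence of the chart, uniqueness, conservation of energy. -/

/-- The curve `c` in the tangent bundle satisfies the equation of the geodesic flow at time `t`. -/
def IsFlowLineAt (g : SmoothMetric d N) (c : ℝ → TangentBundle (𝓡 (d + 1)) N) (t : ℝ) : Prop :=
  ContinuousAt c t ∧ ∀ e ∈ smoothCharts d N, (c t).1 ∈ e.source →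
    HasDerivAt (fun s => cotChart g e (c s)) (hamField (chartForm g e) (cotChart g e (c t))) t

variable {c c₁ c₂ : ℝ → TangentBundle (𝓡 (d + 1)) N} {t : ℝ}

/-- The transition between two cotangent charts is a cotangent lift, which maps one Hamiltonian
field to the other; by the chain rule a single chart suffices. -/
theorem isFlowLineAt_of_chart (he : e ∈ smoothCharts d N) (hc : ContinuousAt c t)
    (ht : (c t).1 ∈ e.source)
    (h : HasDerivAt (fun s => cotChart g e (c s)) (hamField (chartForm g e) (cotChart g e (c t))) t) :
    IsFlowLineAt g c t := by
  refine ⟨hc, fun e' he' ht' => ?_⟩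
  have hf := isIsometryOn_transition g he he'
  have hU : e.target ∩ e.symm ⁻¹' e'.source ⊆ e.target := inter_subset_left
  have hU' : MapsTo (fun y => e' (e.symm y)) (e.target ∩ e.symm ⁻¹' e'.source) e'.target :=
    fun y hy => e'.map_source hy.2
  have hz : (cotChart g e (c t)).1 ∈ e.target ∩ e.symm ⁻¹' e'.source :=
    ⟨e.map_source ht, by change e.symm (e (c t).1) ∈ e'.source; rwa [e.left_inv ht]⟩
  have hm := isMetricOn_chartForm g he
  have hm' := isMetricOn_chartForm g he'
  have h1 := (hf.differentiableAt_cotLift hm hm' hU hU' hz).hasFDerivAt.comp_hasDerivAt t h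
  rw [hf.fderiv_cotLift_hamField hm hm' hU hU' hz, ← cotChart_transition g he he' ht ht'] at h1
  refine h1.congr_of_eventuallyEq ?_
  filter_upwards [hc (isOpen_overSource.mem_nhds ht), hc (isOpen_overSource.mem_nhds ht')] with s h2 h3
  exact cotChart_transition g he he' h2 h3

theorem IsFlowLineAt.congr (h : IsFlowLineAt g c₁ t) (hc : c₂ =ᶠ[𝓝 t] c₁) :
    IsFlowLineAt g c₂ t := by
  have ht : c₂ t = c₁ t := hc.eq_of_nhds
  refine ⟨h.1.congr hc.symm, fun e he hs => ?_⟩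
  rw [ht] at hs ⊢
  refine (h.2 e he hs).congr_of_eventuallyEq ?_
  filter_upwards [hc] with s hs
  rw [hs]

theorem IsFlowLineAt.comp_add {a : ℝ} (h : IsFlowLineAt g c (t + a)) :
    IsFlowLineAt g (fun s => c (s + a)) t := by
  refine ⟨ContinuousAt.comp (f := fun s => s + a) h.1 (by fun_prop), fun e he hs => ?_⟩
  exact (h.2 e he hs).comp_add_const t a

/-- Flow lines with a common point agree. -/
theorem eqOn_of_isFlowLineAt [T2Space N] {J : Set ℝ} (hJ : IsOpen J) (hJ' : IsPreconnected J)
    (h₁ : ∀ t ∈ J, IsFlowLineAt g c₁ t) (h₂ : ∀ t ∈ J, IsFlowLineAt g c₂ t) {t₀ : ℝ}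
    (ht₀ : t₀ ∈ J) (h₀ : c₁ t₀ = c₂ t₀) : EqOn c₁ c₂ J := by
  -- Uniqueness for an ordinary differential equation with locally Lipschitz right-hand side, in one
  -- chart.
  have hloc : ∀ t ∈ J, c₁ t = c₂ t → c₁ =ᶠ[𝓝 t] c₂ := by
    intro t ht heq
    obtain ⟨e, he, hs⟩ := exists_smoothChart d (c₁ t).1
    have hs₂ : (c₂ t).1 ∈ e.source := heq ▸ hs
    have hm := isMetricOn_chartForm g he
    have hS : ContDiffAt ℝ 1 (hamField (chartForm g e)) (cotChart g e (c₁ t)) :=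
      (hm.contDiffOn_hamField.contDiffAt (hm.isOpen_prod.mem_nhds (cotChart_mem hs))).of_le (by simp)
    obtain ⟨K, s, hsn, hK⟩ := hS.exists_lipschitzOnWith
    have hev : ∀ c, (∀ t ∈ J, IsFlowLineAt g c t) → c t = c₁ t → ∀ᶠ r in 𝓝 t,
        (HasDerivAt (fun s => cotChart g e (c s)) (hamField (chartForm g e) (cotChart g e (c r))) r ∧
          cotChart g e (c r) ∈ s) ∧ c r ∈ overSource e := by
      intro c hc hct
      have hcs : c t ∈ overSource e := by rw [hct]; exact hs
      have h1 : ∀ᶠ r in 𝓝 t, c r ∈ overSource e :=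
        (hc t ht).1 (isOpen_overSource.mem_nhds hcs)
      have h2 : ContinuousAt (fun r => cotChart g e (c r)) t :=
        ((continuousOn_cotChart g he).continuousAt (isOpen_overSource.mem_nhds hcs)).comp (hc t ht).1
      have h3 : ∀ᶠ r in 𝓝 t, cotChart g e (c r) ∈ s := h2
        (by change s ∈ 𝓝 (cotChart g e (c t)); rw [hct]; exact hsn)
      filter_upwards [hJ.mem_nhds ht, h1, h3] with r hr hr1 hr3
      exact ⟨⟨(hc r hr).2 e he hr1, hr3⟩, hr1⟩
    have e1 := hev c₁ h₁ rfl
    have e2 := hev c₂ h₂ heq.symm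
    have := ODE_solution_unique_of_eventually (v := fun _ => hamField (chartForm g e))
      (s := fun _ => s) (t₀ := t) (K := K)
      (f := fun s => cotChart g e (c₁ s)) (g := fun s => cotChart g e (c₂ s))
      (Eventually.of_forall fun _ => hK) (e1.mono fun _ h => h.1) (e2.mono fun _ h => h.1)
      (by simp only [heq])
    filter_upwards [this, e1, e2] with r hr hr1 hr2
    exact cotChart_injOn g he hr1.2 hr2.2 hr
  -- The set of times of local agreement is open, and relatively closed in J since distinct values
  -- stay distinct nearby in a Hausdorff space; connectedness finishes.
  have hsub : J ⊆ {t | c₁ =ᶠ[𝓝 t] c₂} := by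
    refine hJ'.subset_of_closure_inter_subset isOpen_setOfPred_eventually_nhds ⟨t₀, ht₀, hloc t₀ ht₀ h₀⟩ ?_
    rintro t ⟨hcl', ht⟩
    refine hloc t ht ?_
    by_contra hne
    have hd : ∀ᶠ r in 𝓝 t, c₁ r ≠ c₂ r :=
      ((h₁ t ht).1.prodMk (h₂ t ht).1).eventually (isOpen_ne_fun continuous_fst continuous_snd |>.mem_nhds hne)
    obtain ⟨r, hr, hr'⟩ := ((mem_closure_iff_frequently.1 hcl').and_eventually hd).exists
    exact hr' (show c₁ =ᶠ[𝓝 r] c₂ from hr).eq_of_nhds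
  exact fun t ht => (show c₁ =ᶠ[𝓝 t] c₂ from hsub ht).eq_of_nhds

/-- The speed is constant along flow lines. -/
theorem hasDerivAt_energy (h : IsFlowLineAt g c t) :
    HasDerivAt (fun s => g.inner (c s).1 (c s).2 (c s).2) 0 t := by
  obtain ⟨e, he, hs⟩ := exists_smoothChart d (c t).1
  have hm := isMetricOn_chartForm g he
  have hH : DifferentiableAt ℝ (ham (chartForm g e)) (cotChart g e (c t)) :=
    (hm.contDiffOn_ham.contDiffAt (hm.isOpen_prod.mem_nhds (cotChart_mem hs))).differentiableAt
      (by simp)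
  have h1 := (hH.hasFDerivAt.comp_hasDerivAt t (h.2 e he hs)).const_mul (2 : ℝ)
  -- The derivative of H along its own field is ω(X, X) = 0.
  rw [← symp_hamField, symp, sub_self, mul_zero] at h1
  refine h1.congr_of_eventuallyEq ?_
  filter_upwards [h.1 (isOpen_overSource.mem_nhds hs)] with s hs
  change _ = 2 * ham (chartForm g e) (cotChart g e (c s))
  rw [ham_cotChart g he hs]
  ring

theorem energy_eq {J : Set ℝ} (hJ : IsOpen J) (hJ' : IsPreconnected J)
    (h : ∀ t ∈ J, IsFlowLineAt g c t) {s t : ℝ} (hs : s ∈ J) (ht : t ∈ J) :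
    g.inner (c s).1 (c s).2 (c s).2 = g.inner (c t).1 (c t).2 (c t).2 :=
  hJ.is_const_of_deriv_eq_zero hJ'
    (fun t ht => (hasDerivAt_energy (h t ht)).differentiableAt.differentiableWithinAt)
    (fun t ht => (hasDerivAt_energy (h t ht)).deriv) hs ht

end

/-! ### Flow lines -/

section

variable {d : ℕ} {N : Type*} [TopologicalSpace N]
  [ChartedSpace (EuclideanSpace ℝ (Fin (d + 1))) N] [IsManifold (𝓡 (d + 1)) ∞ N]
  {g : SmoothMetric d N} {e e' : OpenPartialHomeomorph N (EuclideanSpace ℝ (Fin (d + 1)))}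
  {c : ℝ → TangentBundle (𝓡 (d + 1)) N} {t : ℝ}

/-- Homogeneity of the geodesic equation: velocity is linear and force quadratic in the momentum.
Scaling and reversal of geodesics come from here. -/
theorem IsMetricOn.hamField_smul {B : Coord d → Coord d →L[ℝ] Coord d →L[ℝ] ℝ} {O : Set (Coord d)}
    (h : IsMetricOn B O) {z : Coord d × Coord d} (hz : z.1 ∈ O) (r : ℝ) :
    hamField B (z.1, r • z.2) = (r • (hamField B z).1, r ^ 2 • (hamField B z).2) := by
  refine Prod.ext ?_ ?_
  · rw [h.hamField_fst (z := (z.1, r • z.2)) hz, h.hamField_fst hz, map_smul]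
  · refine ext_inner_right ℝ fun w => ?_
    have h1 : z = (z.1, metricOp B z.1 ((metricOp B z.1).inverse z.2)) :=
      Prod.ext rfl (h.metricOp_inverse hz _).symm
    have h2 : (z.1, r • z.2)
        = (z.1, metricOp B z.1 (r • (metricOp B z.1).inverse z.2)) :=
      Prod.ext rfl (by rw [map_smul, h.metricOp_inverse hz])
    have h3 : ⟪(hamField B z).2, w⟫_ℝ = (1 / 2 : ℝ) *
        fderiv ℝ (fun y => B y ((metricOp B z.1).inverse z.2) ((metricOp B z.1).inverse z.2))
          z.1 w := by
      conv_lhs => rw [h1]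
      exact h.inner_hamField_snd hz _ w
    rw [h2, h.inner_hamField_snd hz, inner_smul_left, h3, h.fderiv_apply_apply hz,
      h.fderiv_apply_apply hz]
    simp only [map_smul, smul_apply, smul_eq_mul, RCLike.conj_to_real]
    ring

/-- Multiplication by `r` in the fibres of the tangent bundle. -/
def bscale (r : ℝ) (p : TangentBundle (𝓡 (d + 1)) N) : TangentBundle (𝓡 (d + 1)) N :=
  ⟨p.1, r • p.2⟩

theorem bscale_bscale (r s : ℝ) (p : TangentBundle (𝓡 (d + 1)) N) :
    bscale r (bscale s p) = bscale (r * s) p :=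
  congrArg (fun w => (⟨p.1, w⟩ : TangentBundle (𝓡 (d + 1)) N)) (smul_smul r s p.2)

theorem bscale_one (p : TangentBundle (𝓡 (d + 1)) N) : bscale 1 p = p := by
  simp only [bscale, one_smul]

theorem reverse_eq_bscale (p : TangentBundle (𝓡 (d + 1)) N) : reverse p = bscale (-1) p := by
  simp only [bscale, reverse, neg_smul, one_smul]

theorem inner_bscale (g : SmoothMetric d N) (r : ℝ) (p : TangentBundle (𝓡 (d + 1)) N) :
    g.inner (bscale r p).1 (bscale r p).2 (bscale r p).2 = r ^ 2 * g.inner p.1 p.2 p.2 := by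
  change g.inner p.1 (r • p.2) (r • p.2) = _
  have h1 : g.inner p.1 (r • p.2) = r • g.inner p.1 p.2 := (g.inner p.1).map_smul r p.2
  have h2 : g.inner p.1 p.2 (r • p.2) = r • g.inner p.1 p.2 p.2 :=
    (g.inner p.1 p.2).map_smul r p.2
  rw [h1]
  change r • g.inner p.1 p.2 (r • p.2) = _
  rw [h2, smul_eq_mul, smul_eq_mul]
  ring

theorem cotChart_bscale (g : SmoothMetric d N)
    (e : OpenPartialHomeomorph N (EuclideanSpace ℝ (Fin (d + 1)))) (r : ℝ)
    (p : TangentBundle (𝓡 (d + 1)) N) :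
    cotChart g e (bscale r p) = ((cotChart g e p).1, r • (cotChart g e p).2) := by
  refine Prod.ext rfl ?_
  have h : chartVector e p.1 (r • p.2) = r • chartVector e p.1 p.2 :=
    map_smul (mfderiv (𝓡 (d + 1)) (𝓡 (d + 1)) e p.1) r p.2
  change metricOp _ _ (chartVector e p.1 (r • p.2)) = _
  rw [h, map_smul]
  rfl

theorem continuous_bscale (g : SmoothMetric d N) :
    Continuous fun q : ℝ × TangentBundle (𝓡 (d + 1)) N => bscale q.1 q.2 := by
  rw [continuous_iff_continuousAt]
  rintro ⟨r, p⟩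
  obtain ⟨e, he, hp⟩ := exists_smoothChart d p.1
  have h1 : ContinuousAt (fun q : ℝ × TangentBundle (𝓡 (d + 1)) N => cotChart g e q.2) (r, p) :=
    ContinuousAt.comp (f := fun q : ℝ × TangentBundle (𝓡 (d + 1)) N => q.2)
      ((continuousOn_cotChart g he).continuousAt (isOpen_overSource.mem_nhds (show p ∈ overSource e from hp))) continuousAt_snd
  have h2 : ContinuousAt (fun q : ℝ × TangentBundle (𝓡 (d + 1)) N =>
      ((cotChart g e q.2).1, q.1 • (cotChart g e q.2).2)) (r, p) :=
    h1.fst.prodMk (continuousAt_fst.smul h1.snd)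
  have h3 := ContinuousAt.comp (f := fun q : ℝ × TangentBundle (𝓡 (d + 1)) N =>
      ((cotChart g e q.2).1, q.1 • (cotChart g e q.2).2)) ((continuousOn_cotChartInv g he).continuousAt
      ((isMetricOn_chartForm g he).isOpen_prod.mem_nhds ⟨e.map_source hp, mem_univ _⟩)) h2
  refine h3.congr ?_
  have h4 : ∀ᶠ q : ℝ × TangentBundle (𝓡 (d + 1)) N in 𝓝 (r, p), q.2 ∈ overSource e :=
    (continuous_snd.tendsto (r, p)).eventually (isOpen_overSource.mem_nhds (show p ∈ overSource e from hp))
  filter_upwards [h4] with q hq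
  change cotChartInv g e ((cotChart g e q.2).1, q.1 • (cotChart g e q.2).2) = _
  rw [← cotChart_bscale, cotChartInv_cotChart g he]
  exact hq

/-- One factor r comes from the change of time and one from the scaling of the momentum, as
homogeneity requires. The value r = -1 is reversal, and r = 1/|v| normalizes the speed. -/
theorem IsFlowLineAt.bscale {r : ℝ} (h : IsFlowLineAt g c (r * t)) :
    IsFlowLineAt g (fun s => bscale r (c (r * s))) t := by
  have h1 : ContinuousAt (fun s => c (r * s)) t :=
    ContinuousAt.comp (f := fun s => r * s) h.1 (by fun_prop)
  refine ⟨(continuous_bscale g).continuousAt.comp (f := fun s => (r, c (r * s)))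
    (continuousAt_const.prodMk h1), fun e he hs => ?_⟩
  have h2 : HasDerivAt (fun s => cotChart g e (c (r * s)))
      (r • hamField (chartForm g e) (cotChart g e (c (r * t)))) t :=
    (h.2 e he hs).scomp t (by simpa using! (hasDerivAt_id t).const_mul r)
  have h3 : HasDerivAt (fun s => (cotChart g e (c (r * s))).1) _ t := h2.fst
  have h4 : HasDerivAt (fun s => (cotChart g e (c (r * s))).2) _ t := h2.snd
  simp only [cotChart_bscale]
  rw [(isMetricOn_chartForm g he).hamField_smul (e.map_source hs)]
  refine (h3.prodMk (h4.const_smul r)).congr_deriv (Prod.ext rfl ?_)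
  simp [smul_smul, sq]

theorem chartVector_velocity {γ : ℝ → N} (he : e ∈ smoothCharts d N)
    (hγ : MDifferentiableAt 𝓘(ℝ, ℝ) (𝓡 (d + 1)) γ t) (ht : γ t ∈ e.source) :
    chartVector e (velocity γ t).1 (velocity γ t).2 = deriv (fun s => e (γ s)) t := by
  have h := mfderiv_comp t ((mdifferentiable_of_mem_maximalAtlas he).mdifferentiableAt ht) hγ
  rw [← fderiv_apply_one_eq_deriv, ← mfderiv_eq_fderiv]
  exact (DFunLike.congr_fun h (1 : ℝ)).symm

theorem contDiffAt_chart_comp {γ : ℝ → N} {n : ℕ∞} (he : e ∈ smoothCharts d N)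
    (hγ : ContMDiffAt 𝓘(ℝ, ℝ) (𝓡 (d + 1)) n γ t) (ht : γ t ∈ e.source) :
    ContDiffAt ℝ n (fun s => e (γ s)) t := by
  rw [← contMDiffAt_iff_contDiffAt]
  exact ((contMDiffAt_of_mem_maximalAtlas he ht).of_le (by exact_mod_cast le_top)).comp t hγ

/-- The velocity of a geodesic is a flow line. -/
theorem IsGeodesic.isFlowLineAt {γ : ℝ → N} (h : IsGeodesic g γ) (t : ℝ) :
    IsFlowLineAt g (velocity γ) t := by
  obtain ⟨e, he, ht⟩ := exists_smoothChart d (γ t)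
  have hm := isMetricOn_chartForm g he
  set u : ℝ → Coord d := fun s => e (γ s)
  set J : Set ℝ := γ ⁻¹' e.source
  have hJ : IsOpen J := e.open_source.preimage h.1.continuous
  have hu2 : ∀ s ∈ J, ContDiffAt ℝ 2 u s := fun s hs =>
    contDiffAt_chart_comp (n := 2) he h.1.contMDiffAt hs
  have hu : ∀ s ∈ J, HasDerivAt u (deriv u s) s := fun s hs =>
    ((hu2 s hs).differentiableAt (by simp)).hasDerivAt
  have hv : DifferentiableAt ℝ (deriv u) t :=
    (((hu2 t ht).fderiv_right (m := 1) (by norm_num)).clm_apply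
      (contDiffAt_const (c := (1 : ℝ)))).differentiableAt (by simp)
  have hcot : ∀ s ∈ J, cotChart g e (velocity γ s) = (u s, metricOp (chartForm g e) (u s) (deriv u s)) := by
    intro s hs
    refine Prod.ext rfl ?_
    change metricOp _ (e (γ s)) (chartVector e (velocity γ s).1 (velocity γ s).2) = _
    rw [chartVector_velocity he (h.1.mdifferentiable (by simp) s) hs]
  have hmain : HasDerivAt (fun s => (u s, metricOp (chartForm g e) (u s) (deriv u s)))
      (hamField (chartForm g e) (u t, metricOp (chartForm g e) (u t) (deriv u t))) t :=
    (hm.hasDerivAt_iff_geodesic (e.map_source ht) (hu t ht) hv.hasDerivAt).2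
      fun w => h.2 e he t ht w
  have hev : (fun s => cotChart g e (velocity γ s)) =ᶠ[𝓝 t]
      fun s => (u s, metricOp (chartForm g e) (u s) (deriv u s)) := by
    filter_upwards [hJ.mem_nhds ht] with s hs using hcot s hs
  have hd : HasDerivAt (fun s => cotChart g e (velocity γ s))
      (hamField (chartForm g e) (cotChart g e (velocity γ t))) t := by
    rw [hcot t ht]
    exact hmain.congr_of_eventuallyEq hev
  refine isFlowLineAt_of_chart he ?_ ht hd
  have h1 : ContinuousAt (fun s => cotChartInv g e (cotChart g e (velocity γ s))) t :=
    ContinuousAt.comp (f := fun s => cotChart g e (velocity γ s))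
      ((continuousOn_cotChartInv g he).continuousAt
        (hm.isOpen_prod.mem_nhds (cotChart_mem ht))) hd.continuousAt
  refine h1.congr ?_
  filter_upwards [hJ.mem_nhds ht] with s hs using cotChartInv_cotChart g he hs

/-- The base curve of a flow line is a geodesic. -/
theorem isGeodesic_of_isFlowLineAt (h : ∀ t, IsFlowLineAt g c t) :
    IsGeodesic g (fun t => (c t).1) ∧ velocity (fun t => (c t).1) = c := by
  have hc : Continuous c := continuous_iff_continuousAt.2 fun t => (h t).1
  have key : ∀ e ∈ smoothCharts d N, _ := fun e he =>
    (isMetricOn_chartForm g he).geodesic_of_hasDerivAt (z := fun s => cotChart g e (c s))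
      (J := c ⁻¹' overSource e) (isOpen_overSource.preimage hc) (fun t ht => e.map_source ht)
      (fun t ht => (h t).2 e he ht)
  have hγ : ContMDiff 𝓘(ℝ, ℝ) (𝓡 (d + 1)) 2 (fun t => (c t).1) := by
    intro t
    obtain ⟨e, he, ht⟩ := exists_smoothChart d (c t).1
    have hJ : c ⁻¹' overSource e ∈ 𝓝 t := (isOpen_overSource.preimage hc).mem_nhds ht
    have h1 : ContDiffAt ℝ 2 (fun s => e (c s).1) t := ((key e he).1.contDiffAt hJ).fst
    have h2 : ContMDiffAt 𝓘(ℝ, ℝ) (𝓡 (d + 1)) 2 (fun s => e.symm (e (c s).1)) t :=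
      ((contMDiffAt_symm_of_mem_maximalAtlas he (e.map_source ht)).of_le
        (by simpa using! WithTop.coe_le_coe.2 (le_top : (2 : ℕ∞) ≤ ⊤))).comp t h1.contMDiffAt
    refine h2.congr_of_eventuallyEq ?_
    filter_upwards [hJ] with s hs
    exact (e.left_inv hs).symm
  refine ⟨⟨hγ, fun e he t ht w => ((key e he).2 t ht).2 w⟩, funext fun t => ?_⟩
  obtain ⟨e, he, ht⟩ := exists_smoothChart d (c t).1
  refine cotChart_injOn g he (show (velocity (fun t => (c t).1) t).1 ∈ e.source from ht) ht ?_
  refine Prod.ext rfl ?_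
  change metricOp _ (e (c t).1) (chartVector e (velocity (fun t => (c t).1) t).1 _) = _
  rw [chartVector_velocity he (hγ.mdifferentiable (by simp) t) ht]
  have h1 := ((key e he).2 t ht).1
  simp only [velocity_cotChart g he ht] at h1
  have h2 : deriv (fun s => e (c s).1) t = chartVector e (c t).1 (c t).2 := h1
  rw [h2]
  rfl

open Function in
/-- The local geodesic flow, in a chart. -/
theorem exists_local_geodesicFlow (g : SmoothMetric d N) (he : e ∈ smoothCharts d N)
    {p₀ : TangentBundle (𝓡 (d + 1)) N} (hp₀ : p₀.1 ∈ e.source) :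
    ∃ ε > 0, ∃ U ∈ 𝓝 p₀, ∃ φ : TangentBundle (𝓡 (d + 1)) N → ℝ → TangentBundle (𝓡 (d + 1)) N,
      U ⊆ overSource e ∧
      (∀ p ∈ U, φ p 0 = p ∧ ∀ t ∈ Ioo (-ε) ε, φ p t ∈ overSource e ∧ IsFlowLineAt g (φ p) t ∧
        ∃ D : Coord d × Coord d →L[ℝ] Coord d × Coord d, (∀ h k, symp (D h) (D k) = symp h k) ∧
          HasFDerivAt (fun q : (Coord d × Coord d) × ℝ => cotChart g e (φ (cotChartInv g e q.1) q.2))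
            (D.coprod (ContinuousLinearMap.toSpanSingleton ℝ
              (hamField (chartForm g e) (cotChart g e (φ p t))))) (cotChart g e p, t)) ∧
      ContinuousOn (uncurry φ) (U ×ˢ Ioo (-ε) ε) := by
  have hm := isMetricOn_chartForm g he
  obtain ⟨ε, hε, r, hr, φ, Y, hφ, hcont⟩ := exists_local_flow hm.isOpen_prod
    (hm.contDiffOn_hamField.of_le (by simpa using! WithTop.coe_le_coe.2 (le_top : (2 : ℕ∞) ≤ ⊤)))
    (cotChart_mem (g := g) hp₀)
  have hcc := continuousOn_cotChart g he
  set U := overSource e ∩ cotChart g e ⁻¹' Metric.ball (cotChart g e p₀) r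
  have hUo : IsOpen U := hcc.isOpen_inter_preimage isOpen_overSource Metric.isOpen_ball
  refine ⟨ε, hε, U, hUo.mem_nhds ⟨hp₀, Metric.mem_ball_self hr⟩,
    fun p t => cotChartInv g e (φ (cotChart g e p) t), inter_subset_left, ?_, ?_⟩
  · intro p hp
    obtain ⟨h0, hY0, hflow⟩ := hφ _ hp.2
    refine ⟨by simp only [h0, cotChartInv_cotChart g he hp.1], fun t ht => ?_⟩
    have hO : ∀ s ∈ Ioo (-ε) ε, (φ (cotChart g e p) s).1 ∈ e.target := fun s hs =>
      (hflow s hs).1.1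
    have hback : ∀ s ∈ Ioo (-ε) ε, cotChart g e (cotChartInv g e (φ (cotChart g e p) s))
        = φ (cotChart g e p) s := fun s hs => cotChart_cotChartInv g he (hO s hs)
    refine ⟨cotChartInv_mem (hO t ht), ?_, Y (cotChart g e p) t, ?_, ?_⟩
    · refine isFlowLineAt_of_chart he ?_ (cotChartInv_mem (hO t ht)) ?_
      · exact ContinuousAt.comp (f := φ (cotChart g e p))
          ((continuousOn_cotChartInv g he).continuousAt (hm.isOpen_prod.mem_nhds (hflow t ht).1))
          (hflow t ht).2.1.continuousAt
      · rw [hback t ht]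
        refine (hflow t ht).2.1.congr_of_eventuallyEq ?_
        filter_upwards [isOpen_Ioo.mem_nhds ht] with s hs using hback s hs
    · intro h k
      -- The symplectic form of two solutions of the linearized equation is constant in time, and Y
      -- is the identity at time 0.
      have hd : ∀ s ∈ Ioo (-ε) ε, HasDerivAt (fun s => symp (Y (cotChart g e p) s h)
          (Y (cotChart g e p) s k)) 0 s := by
        intro s hs
        have hY : ∀ h, HasDerivAt (fun s => Y (cotChart g e p) s h)
            (fderiv ℝ (hamField (chartForm g e)) (φ (cotChart g e p) s)
              (Y (cotChart g e p) s h)) s := fun h => by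
          simpa using (hflow s hs).2.2.1.clm_apply (hasDerivAt_const s h)
        have e1 : ∀ h, HasDerivAt (fun s => (Y (cotChart g e p) s h).1)
            (fderiv ℝ (hamField (chartForm g e)) (φ (cotChart g e p) s)
              (Y (cotChart g e p) s h)).1 s := fun h => (hY h).fst
        have e2 : ∀ h, HasDerivAt (fun s => (Y (cotChart g e p) s h).2)
            (fderiv ℝ (hamField (chartForm g e)) (φ (cotChart g e p) s)
              (Y (cotChart g e p) s h)).2 s := fun h => (hY h).snd
        refine (((e1 h).inner ℝ (e2 k)).sub ((e1 k).inner ℝ (e2 h))).congr_deriv ?_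
        have := hm.symp_fderiv_hamField (hO s hs) (Y (cotChart g e p) s h) (Y (cotChart g e p) s k)
        simp only [symp] at this
        linarith
      have hconst := isOpen_Ioo.is_const_of_deriv_eq_zero isPreconnected_Ioo
        (fun s hs => (hd s hs).differentiableAt.differentiableWithinAt)
        (fun s hs => (hd s hs).deriv) ht (show (0 : ℝ) ∈ Ioo (-ε) ε by constructor <;> linarith)
      simpa [hY0] using hconst
    · rw [hback t ht]
      refine (hflow t ht).2.2.2.congr_of_eventuallyEq ?_
      have hn : (Metric.ball (cotChart g e p₀) r ∩ e.target ×ˢ univ) ×ˢ Ioo (-ε) ε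
          ∈ 𝓝 (cotChart g e p, t) :=
        ((Metric.isOpen_ball.inter hm.isOpen_prod).prod isOpen_Ioo).mem_nhds
          ⟨⟨hp.2, cotChart_mem hp.1⟩, ht⟩
      filter_upwards [hn] with q hq
      rw [cotChart_cotChartInv g he hq.1.2.1]
      exact cotChart_cotChartInv g he ((hφ _ hq.1.1).2.2 _ hq.2).1.1
  · refine (continuousOn_cotChartInv g he).comp (t := e.target ×ˢ univ)
      (f := fun q : TangentBundle (𝓡 (d + 1)) N × ℝ => φ (cotChart g e q.1) q.2) ?_
      (fun q hq => ((hφ _ hq.1.2).2.2 _ hq.2).1)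
    refine hcont.comp (f := fun q : TangentBundle (𝓡 (d + 1)) N × ℝ => (cotChart g e q.1, q.2)) ?_
      (fun q hq => ⟨hq.1.2, hq.2⟩)
    exact (hcc.comp continuousOn_fst fun q hq => hq.1.1).prodMk continuousOn_snd

end

/-! ### The geodesic flow -/

section

variable {d : ℕ} {N : Type*} [TopologicalSpace N]
  [ChartedSpace (EuclideanSpace ℝ (Fin (d + 1))) N] [IsManifold (𝓡 (d + 1)) ∞ N]
  {g : SmoothMetric d N} {e e' : OpenPartialHomeomorph N (EuclideanSpace ℝ (Fin (d + 1)))}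
  {c : ℝ → TangentBundle (𝓡 (d + 1)) N} {s t : ℝ} {p : TangentBundle (𝓡 (d + 1)) N}

theorem chartForm_cotChart (g : SmoothMetric d N) (he : e ∈ smoothCharts d N)
    (hp : p.1 ∈ e.source) : chartForm g e (e p.1) (chartVector e p.1 p.2) (chartVector e p.1 p.2)
      = g.inner p.1 p.2 p.2 := chartMetric_chartVector g he hp p.2 p.2

/-- Expand 0 ≤ B(Cu - ξ, Cu - ξ), using B(u, ξ) = ‖ξ‖² and B(ξ, ξ) ≤ C‖ξ‖². Small Riemannian length
thus forces small momentum, locally uniformly in the base point. -/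
theorem norm_cotChart_snd_sq_le (g : SmoothMetric d N) (he : e ∈ smoothCharts d N)
    (hp : p.1 ∈ e.source) {C : ℝ} (hC : 0 < C) (hB : ‖chartForm g e (e p.1)‖ ≤ C) :
    ‖(cotChart g e p).2‖ ^ 2 ≤ C * g.inner p.1 p.2 p.2 := by
  set u := chartVector e p.1 p.2
  set ξ := (cotChart g e p).2 with hξ
  set B := chartForm g e (e p.1) with hBdef
  have hm := isMetricOn_chartForm g he
  have h1 : B u ξ = ‖ξ‖ ^ 2 := by
    rw [← real_inner_self_eq_norm_sq, ← inner_metricOp (chartForm g e) (e p.1) u ξ]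
    rfl
  have h2 : B ξ ξ ≤ C * ‖ξ‖ ^ 2 := by
    refine (le_abs_self _).trans (((B ξ).le_opNorm ξ).trans ?_)
    have h3 := B.le_opNorm ξ
    have h4 := mul_le_mul_of_nonneg_right hB (norm_nonneg ξ)
    have h5 := mul_le_mul_of_nonneg_right (h3.trans h4) (norm_nonneg ξ)
    nlinarith
  have h3 : 0 ≤ B (C • u - ξ) (C • u - ξ) := by
    by_cases h : C • u - ξ = 0
    · simp [h]
    · exact (hm.pos _ (e.map_source hp) _ h).le
  have h4 : B ξ u = B u ξ := hm.symm _ _ _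
  simp only [map_sub, map_smul, sub_apply, smul_apply, smul_eq_mul, h4, h1] at h3
  rw [← chartForm_cotChart g he hp]
  change _ ≤ C * B u u
  have h5 : 0 ≤ C * (C * B u u - ‖ξ‖ ^ 2) := by nlinarith
  nlinarith [nonneg_of_mul_nonneg_right h5 hC]

theorem continuousAt_norm_comp {X F : Type*} [TopologicalSpace X] [NormedAddCommGroup F] {f : X → F}
    {x : X} (hf : ContinuousAt f x) : ContinuousAt (fun y => ‖f y‖) x := hf.norm

/-- The sets `{g(v, v) < δ}` over small neighbourhoods of `x₀` form a basis of neighbourhoods of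
the zero vector at `x₀`. -/
theorem exists_small_vectors_subset (g : SmoothMetric d N) {x₀ : N}
    {U : Set (TangentBundle (𝓡 (d + 1)) N)} (hU : U ∈ 𝓝 (⟨x₀, 0⟩ : TangentBundle (𝓡 (d + 1)) N)) :
    ∃ W ∈ 𝓝 x₀, ∃ δ > 0, ∀ p : TangentBundle (𝓡 (d + 1)) N, p.1 ∈ W →
      g.inner p.1 p.2 p.2 < δ → p ∈ U := by
  obtain ⟨e, he, hx⟩ := exists_smoothChart d x₀
  have hm := isMetricOn_chartForm g he
  set p₀ : TangentBundle (𝓡 (d + 1)) N := ⟨x₀, 0⟩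
  have hp₀ : cotChart g e p₀ = (e x₀, 0) := by
    refine Prod.ext rfl ?_
    have : chartVector e x₀ (0 : TangentSpace (𝓡 (d + 1)) x₀) = 0 :=
      map_zero (mfderiv (𝓡 (d + 1)) (𝓡 (d + 1)) e x₀)
    change metricOp _ _ (chartVector e x₀ (0 : TangentSpace (𝓡 (d + 1)) x₀)) = _
    rw [this, map_zero]
  have h1 : ContinuousAt (cotChartInv g e) (e x₀, 0) :=
    (continuousOn_cotChartInv g he).continuousAt
      (hm.isOpen_prod.mem_nhds ⟨e.map_source hx, mem_univ _⟩)
  have h2 : cotChartInv g e ⁻¹' U ∈ 𝓝 (e x₀, (0 : Coord d)) := by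
    refine h1.preimage_mem_nhds ?_
    rw [← hp₀, cotChartInv_cotChart g he hx]
    exact hU
  obtain ⟨r, hr, hrU⟩ := Metric.mem_nhds_iff.1 h2
  have hform : ContinuousAt (chartForm g e) (e x₀) :=
    hm.contDiffOn.continuousOn.continuousAt (hm.isOpen.mem_nhds (e.map_source hx))
  have hnorm : ContinuousAt (fun x => ‖chartForm g e (e x)‖) x₀ :=
    continuousAt_norm_comp (f := fun x => chartForm g e (e x))
      (ContinuousAt.comp (g := chartForm g e) hform (e.continuousAt hx))
  set C := ‖chartForm g e (e x₀)‖ + 1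
  have hC : 0 < C := by positivity
  have hW : {x | x ∈ e.source ∧ e x ∈ Metric.ball (e x₀) r ∧ ‖chartForm g e (e x)‖ < C} ∈ 𝓝 x₀ := by
    filter_upwards [e.open_source.mem_nhds hx,
      (e.continuousAt hx).preimage_mem_nhds (Metric.ball_mem_nhds _ hr),
      hnorm.preimage_mem_nhds (Iio_mem_nhds (lt_add_one _))] with x a b c using ⟨a, b, c⟩
  refine ⟨_, hW, r ^ 2 / C, by positivity, fun p hp hlt => ?_⟩
  rw [← cotChartInv_cotChart g he hp.1]
  refine hrU ?_
  have h3 := norm_cotChart_snd_sq_le g he hp.1 hC hp.2.2.le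
  rw [lt_div_iff₀ hC] at hlt
  have h4 : ‖(cotChart g e p).2‖ < r := lt_of_pow_lt_pow_left₀ 2 hr.le (by linarith)
  rw [← ball_prod_same]
  exact ⟨hp.2.1, by simpa using h4⟩

/-! ### Completeness of the geodesic flow on a compact manifold. -/

/-- Flow lines through short vectors exist for a uniform time. -/
theorem exists_uniform_flowLine [CompactSpace N] (g : SmoothMetric d N) :
    ∃ ε > 0, ∃ δ > 0, ∀ p : TangentBundle (𝓡 (d + 1)) N, g.inner p.1 p.2 p.2 < δ →
      ∃ c, c 0 = p ∧ ∀ t ∈ Ioo (-ε) ε, IsFlowLineAt g c t := by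
  -- The statement passes to subsets and to finite unions, so for compact K only a neighbourhood of
  -- one zero vector has to be treated, and there the local flow applies.
  have h : ∀ K : Set N, IsCompact K → ∃ ε > 0, ∃ δ > 0, ∀ p : TangentBundle (𝓡 (d + 1)) N,
      p.1 ∈ K → g.inner p.1 p.2 p.2 < δ → ∃ c, c 0 = p ∧ ∀ t ∈ Ioo (-ε) ε, IsFlowLineAt g c t := by
    intro K hK
    refine hK.induction_on (p := fun K => ∃ ε > 0, ∃ δ > 0, ∀ p : TangentBundle (𝓡 (d + 1)) N,
      p.1 ∈ K → g.inner p.1 p.2 p.2 < δ → ∃ c, c 0 = p ∧ ∀ t ∈ Ioo (-ε) ε, IsFlowLineAt g c t)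
      ?_ ?_ ?_ ?_
    · exact ⟨1, one_pos, 1, one_pos, fun p hp => hp.elim⟩
    · intro s t hst ht
      obtain ⟨ε, hε, δ, hδ, h⟩ := ht
      exact ⟨ε, hε, δ, hδ, fun p hp => h p (hst hp)⟩
    · intro s t hs ht
      obtain ⟨ε, hε, δ, hδ, h⟩ := hs
      obtain ⟨ε', hε', δ', hδ', h'⟩ := ht
      refine ⟨min ε ε', lt_min hε hε', min δ δ', lt_min hδ hδ', fun p hp hlt => ?_⟩
      rcases hp with hp | hp
      · obtain ⟨c, hc, hf⟩ := h p hp (hlt.trans_le (min_le_left _ _))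
        exact ⟨c, hc, fun t ht => hf t ⟨by linarith [ht.1, min_le_left ε ε'],
          by linarith [ht.2, min_le_left ε ε']⟩⟩
      · obtain ⟨c, hc, hf⟩ := h' p hp (hlt.trans_le (min_le_right _ _))
        exact ⟨c, hc, fun t ht => hf t ⟨by linarith [ht.1, min_le_right ε ε'],
          by linarith [ht.2, min_le_right ε ε']⟩⟩
    · intro x hx
      obtain ⟨e, he, hxe⟩ := exists_smoothChart d x
      obtain ⟨ε, hε, U, hU, φ, -, hφ, -⟩ := exists_local_geodesicFlow g he
        (p₀ := (⟨x, 0⟩ : TangentBundle (𝓡 (d + 1)) N)) hxe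
      obtain ⟨W, hW, δ, hδ, h⟩ := exists_small_vectors_subset g hU
      exact ⟨W, mem_nhdsWithin_of_mem_nhds hW, ε, hε, δ, hδ, fun p hp hlt =>
        ⟨φ p, (hφ p (h p hp hlt)).1, fun t ht => ((hφ p (h p hp hlt)).2 t ht).2.1⟩⟩
  obtain ⟨ε, hε, δ, hδ, h⟩ := h univ isCompact_univ
  exact ⟨ε, hε, δ, hδ, fun p => h p (mem_univ _)⟩

/-- Energy is conserved, so the line can be restarted at times ±a/2 for a further time a; uniqueness
glues the pieces to an interval of half-length 3a/2. -/
theorem extend_flowLines [T2Space N] {a δ : ℝ} (ha : 0 < a)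
    (h : ∀ p : TangentBundle (𝓡 (d + 1)) N, g.inner p.1 p.2 p.2 < δ →
      ∃ c, c 0 = p ∧ ∀ t ∈ Ioo (-a) a, IsFlowLineAt g c t)
    (p : TangentBundle (𝓡 (d + 1)) N) (hp : g.inner p.1 p.2 p.2 < δ) :
    ∃ c, c 0 = p ∧ ∀ t ∈ Ioo (-(3 / 2 * a)) (3 / 2 * a), IsFlowLineAt g c t := by
  obtain ⟨c, hc0, hc⟩ := h p hp
  have key : ∀ b ∈ Ioo (-a) a, ∃ c', (∀ t ∈ Ioo (b - a) (b + a), IsFlowLineAt g c' t) ∧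
      EqOn c' c (Ioo (b - a) (b + a) ∩ Ioo (-a) a) := by
    intro b hb
    have h0 : (0 : ℝ) ∈ Ioo (-a) a := by constructor <;> linarith
    have hE : g.inner (c b).1 (c b).2 (c b).2 < δ := by
      rw [energy_eq isOpen_Ioo isPreconnected_Ioo hc hb h0, hc0]
      exact hp
    obtain ⟨c₁, hc₁, hf⟩ := h (c b) hE
    have hf' : ∀ t ∈ Ioo (b - a) (b + a), IsFlowLineAt g (fun s => c₁ (s + -b)) t := fun t ht =>
      IsFlowLineAt.comp_add (hf _ ⟨by linarith [ht.1], by linarith [ht.2]⟩)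
    refine ⟨fun s => c₁ (s + -b), hf', ?_⟩
    refine eqOn_of_isFlowLineAt (isOpen_Ioo.inter isOpen_Ioo)
      (((ordConnected_Ioo).inter ordConnected_Ioo).isPreconnected) (fun t ht => hf' t ht.1)
      (fun t ht => hc t ht.2) (t₀ := b) ⟨⟨by linarith, by linarith⟩, hb⟩ ?_
    simp [hc₁]
  obtain ⟨c₁, h₁, e₁⟩ := key (a / 2) ⟨by linarith, by linarith⟩
  obtain ⟨c₂, h₂, e₂⟩ := key (-(a / 2)) ⟨by linarith, by linarith⟩
  have hnear : ∀ t ∈ Ioo (-(a / 2)) (a / 2), (if 0 < t then c₁ t else c₂ t) = c t := by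
    intro t ht
    split_ifs with h0
    · exact e₁ ⟨⟨by linarith [ht.1], by linarith [ht.2]⟩, ⟨by linarith [ht.1], by linarith [ht.2]⟩⟩
    · exact e₂ ⟨⟨by linarith [ht.1], by linarith [ht.2]⟩, ⟨by linarith [ht.1], by linarith [ht.2]⟩⟩
  refine ⟨fun t => if 0 < t then c₁ t else c₂ t, ?_, fun t ht => ?_⟩
  · change (if (0 : ℝ) < 0 then c₁ 0 else c₂ 0) = p
    rw [hnear 0 ⟨by linarith, by linarith⟩, hc0]
  · rcases lt_trichotomy t 0 with h0 | h0 | h0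
    · refine (h₂ t ⟨by linarith [ht.1], by linarith⟩).congr ?_
      filter_upwards [Iio_mem_nhds h0] with s hs
      rw [if_neg (not_lt.2 (le_of_lt hs))]
    · subst h0
      refine (hc 0 ⟨by linarith, by linarith⟩).congr ?_
      filter_upwards [isOpen_Ioo.mem_nhds (show (0 : ℝ) ∈ Ioo (-(a / 2)) (a / 2) from
        ⟨by linarith, by linarith⟩)] with s hs using hnear s hs
    · refine (h₁ t ⟨by linarith, by linarith [ht.2]⟩).congr ?_
      filter_upwards [Ioi_mem_nhds h0] with s hs
      exact if_pos (mem_Ioi.1 hs)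

/-- Completeness of the geodesic flow. -/
theorem exists_flowLine [T2Space N] [CompactSpace N] (g : SmoothMetric d N)
    (p : TangentBundle (𝓡 (d + 1)) N) : ∃ c, c 0 = p ∧ ∀ t, IsFlowLineAt g c t := by
  obtain ⟨ε, hε, δ, hδ, h⟩ := exists_uniform_flowLine g
  -- Each extension multiplies the time of existence by 3/2 with the same energy bound δ, so every
  -- time is reached for short vectors.
  have hn : ∀ n : ℕ, ∀ p : TangentBundle (𝓡 (d + 1)) N, g.inner p.1 p.2 p.2 < δ →
      ∃ c, c 0 = p ∧ ∀ t ∈ Ioo (-((3 / 2) ^ n * ε)) ((3 / 2) ^ n * ε), IsFlowLineAt g c t := by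
    intro n
    induction n with
    | zero => simpa using h
    | succ n ih =>
      intro p hp
      have := extend_flowLines (a := (3 / 2) ^ n * ε) (by positivity) ih p hp
      rwa [← mul_assoc, ← pow_succ'] at this
  have hsmall : ∀ p : TangentBundle (𝓡 (d + 1)) N, g.inner p.1 p.2 p.2 < δ →
      ∃ c, c 0 = p ∧ ∀ t, IsFlowLineAt g c t := by
    intro p hp
    choose c hc0 hc using fun n => hn n p hp
    have hex : ∀ t : ℝ, ∃ n : ℕ, t ∈ Ioo (-((3 / 2) ^ n * ε)) ((3 / 2) ^ n * ε) := by
      intro t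
      obtain ⟨n, hn⟩ := pow_unbounded_of_one_lt (|t| / ε) (show (1 : ℝ) < 3 / 2 by norm_num)
      exact ⟨n, abs_lt.1 ((div_lt_iff₀ hε).1 hn)⟩
    choose n hn using hex
    have heq : ∀ m k : ℕ, ∀ t, t ∈ Ioo (-((3 / 2) ^ m * ε)) ((3 / 2) ^ m * ε) →
        t ∈ Ioo (-((3 / 2) ^ k * ε)) ((3 / 2) ^ k * ε) → c m t = c k t := by
      intro m k t hm hk
      have hpos : ∀ j : ℕ, 0 < (3 / 2 : ℝ) ^ j * ε := fun j => by positivity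
      exact eqOn_of_isFlowLineAt (isOpen_Ioo.inter isOpen_Ioo)
        ((ordConnected_Ioo.inter ordConnected_Ioo).isPreconnected) (fun t ht => hc m t ht.1)
        (fun t ht => hc k t ht.2) (t₀ := 0)
        ⟨⟨neg_lt_zero.2 (hpos m), hpos m⟩, ⟨neg_lt_zero.2 (hpos k), hpos k⟩⟩
        ((hc0 m).trans (hc0 k).symm) ⟨hm, hk⟩
    refine ⟨fun t => c (n t) t, hc0 _, fun t => (hc (n t) t (hn t)).congr ?_⟩
    filter_upwards [isOpen_Ioo.mem_nhds (hn t)] with s hs using heq _ _ s (hn s) hs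
  -- An arbitrary vector is shrunk until its energy is below δ; the scaling is undone afterwards by
  -- a change of time.
  obtain ⟨r, hr, hlt⟩ : ∃ r : ℝ, 0 < r ∧ r ^ 2 * g.inner p.1 p.2 p.2 < δ := by
    have : Tendsto (fun r : ℝ => r ^ 2 * g.inner p.1 p.2 p.2) (𝓝[>] 0) (𝓝 0) := by
      have h : Continuous (fun r : ℝ => r ^ 2 * g.inner p.1 p.2 p.2) := by fun_prop
      simpa using (h.tendsto 0).mono_left nhdsWithin_le_nhds
    obtain ⟨r, h1, h2⟩ := ((this.eventually (gt_mem_nhds hδ)).and self_mem_nhdsWithin).exists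
    exact ⟨r, h2, h1⟩
  obtain ⟨c, hc0, hc⟩ := hsmall (bscale r p) (by rwa [inner_bscale])
  refine ⟨fun s => bscale r⁻¹ (c (r⁻¹ * s)), ?_, fun t => (hc _).bscale⟩
  simp [hc0, bscale_bscale, hr.ne', bscale_one]

section Flow

variable [T2Space N] [CompactSpace N]

/-- By completeness the default branch in the definition of `geodesic` never occurs. -/
theorem geodesic_spec (g : SmoothMetric d N) (p : TangentBundle (𝓡 (d + 1)) N) :
    IsGeodesic g (geodesic g p) ∧ velocity (geodesic g p) 0 = p := by
  have h : ∃ γ : ℝ → N, IsGeodesic g γ ∧ velocity γ 0 = p := by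
    obtain ⟨c, hc0, hc⟩ := exists_flowLine g p
    obtain ⟨h1, h2⟩ := isGeodesic_of_isFlowLineAt hc
    exact ⟨_, h1, by rw [h2, hc0]⟩
  rw [geodesic, dif_pos h]
  exact h.choose_spec

theorem geodesicFlow_zero (g : SmoothMetric d N) (p : TangentBundle (𝓡 (d + 1)) N) :
    geodesicFlow g 0 p = p := (geodesic_spec g p).2

theorem geodesicFlow_fst (g : SmoothMetric d N) (t : ℝ) (p : TangentBundle (𝓡 (d + 1)) N) :
    (geodesicFlow g t p).1 = geodesic g p t := rfl

theorem isFlowLineAt_geodesicFlow (g : SmoothMetric d N) (p : TangentBundle (𝓡 (d + 1)) N)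
    (t : ℝ) : IsFlowLineAt g (fun s => geodesicFlow g s p) t :=
  (geodesic_spec g p).1.isFlowLineAt t

/-- Local uniqueness. -/
theorem eq_geodesicFlow_of_mem_Ioo {a b : ℝ} (h0 : (0 : ℝ) ∈ Ioo a b) (hc0 : c 0 = p)
    (hc : ∀ t ∈ Ioo a b, IsFlowLineAt g c t) (ht : t ∈ Ioo a b) : c t = geodesicFlow g t p :=
  eqOn_of_isFlowLineAt isOpen_Ioo isPreconnected_Ioo hc
    (fun t _ => isFlowLineAt_geodesicFlow g p t) h0 (by rw [hc0, geodesicFlow_zero]) ht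

theorem eq_geodesicFlow (hc0 : c 0 = p) (hc : ∀ t, IsFlowLineAt g c t) (t : ℝ) :
    c t = geodesicFlow g t p :=
  eqOn_of_isFlowLineAt isOpen_univ isPreconnected_univ (fun t _ => hc t)
    (fun t _ => isFlowLineAt_geodesicFlow g p t) (mem_univ 0) (by rw [hc0, geodesicFlow_zero])
    (mem_univ t)

theorem geodesicFlow_geodesicFlow (g : SmoothMetric d N) (s t : ℝ)
    (p : TangentBundle (𝓡 (d + 1)) N) :
    geodesicFlow g t (geodesicFlow g s p) = geodesicFlow g (t + s) p :=
  (eq_geodesicFlow (c := fun t => geodesicFlow g (t + s) p) (by simp)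
    (fun t => (isFlowLineAt_geodesicFlow g p (t + s)).comp_add) t).symm

theorem geodesicFlow_bscale (g : SmoothMetric d N) (r t : ℝ) (p : TangentBundle (𝓡 (d + 1)) N) :
    geodesicFlow g t (bscale r p) = bscale r (geodesicFlow g (r * t) p) :=
  (eq_geodesicFlow (c := fun t => bscale r (geodesicFlow g (r * t) p))
    (by simp [geodesicFlow_zero]) (fun t => (isFlowLineAt_geodesicFlow g p (r * t)).bscale) t).symm

theorem inner_geodesicFlow (g : SmoothMetric d N) (t : ℝ) (p : TangentBundle (𝓡 (d + 1)) N) :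
    g.inner (geodesicFlow g t p).1 (geodesicFlow g t p).2 (geodesicFlow g t p).2
      = g.inner p.1 p.2 p.2 := by
  rw [energy_eq isOpen_univ isPreconnected_univ (fun t _ => isFlowLineAt_geodesicFlow g p t)
    (mem_univ t) (mem_univ 0), geodesicFlow_zero]

end Flow

end

/-! ### Symplecticity of the geodesic flow -/

section

variable {d : ℕ} {N : Type*} [TopologicalSpace N]
  [ChartedSpace (EuclideanSpace ℝ (Fin (d + 1))) N] [IsManifold (𝓡 (d + 1)) ∞ N]
  {g : SmoothMetric d N} {e e' e₁ e₁' e'' : OpenPartialHomeomorph N (EuclideanSpace ℝ (Fin (d + 1)))}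
  {s t : ℝ} {p : TangentBundle (𝓡 (d + 1)) N}

theorem isOpen_transition_domain :
    IsOpen (e.target ∩ e.symm ⁻¹' e'.source) :=
  e.symm.isOpen_inter_preimage e'.open_source

theorem mem_transition_domain {x : N} (hx : x ∈ e.source) (hx' : x ∈ e'.source) :
    e x ∈ e.target ∩ e.symm ⁻¹' e'.source :=
  ⟨e.map_source hx, show e.symm (e x) ∈ e'.source by rwa [e.left_inv hx]⟩

variable [T2Space N] [CompactSpace N]

/-- The geodesic flow in charts. -/
def chartFlow (g : SmoothMetric d N)
    (e e' : OpenPartialHomeomorph N (EuclideanSpace ℝ (Fin (d + 1))))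
    (q : (Coord d × Coord d) × ℝ) : Coord d × Coord d :=
  cotChart g e' (geodesicFlow g q.2 (cotChartInv g e q.1))

/-- The geodesic flow is differentiable at `(p, t)` in the charts `e`, `e'`, with symplectic
derivative in the directions of the tangent bundle. -/
def HasSympDerivAt (g : SmoothMetric d N)
    (e e' : OpenPartialHomeomorph N (EuclideanSpace ℝ (Fin (d + 1)))) (t : ℝ)
    (p : TangentBundle (𝓡 (d + 1)) N) : Prop :=
  ∃ D : Coord d × Coord d →L[ℝ] Coord d × Coord d, (∀ h k, symp (D h) (D k) = symp h k) ∧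
    HasFDerivAt (chartFlow g e e') (D.coprod (ContinuousLinearMap.toSpanSingleton ℝ
      (hamField (chartForm g e') (cotChart g e' (geodesicFlow g t p))))) (cotChart g e p, t)

/-- The transitions on both sides are cotangent lifts: they are symplectic, and the one at the
endpoint maps the Hamiltonian field to the Hamiltonian field. Both features therefore survive
composition. -/
theorem HasSympDerivAt.change_charts (h : HasSympDerivAt g e e' t p) (he : e ∈ smoothCharts d N)
    (he' : e' ∈ smoothCharts d N) (he₁ : e₁ ∈ smoothCharts d N) (he₁' : e₁' ∈ smoothCharts d N)
    (hp : p.1 ∈ e.source) (hp₁ : p.1 ∈ e₁.source) (hq : (geodesicFlow g t p).1 ∈ e'.source)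
    (hq₁ : (geodesicFlow g t p).1 ∈ e₁'.source) 
    (hc : ContinuousAt (fun q : TangentBundle (𝓡 (d + 1)) N × ℝ => geodesicFlow g q.2 q.1) (p, t)) :
    HasSympDerivAt g e₁ e₁' t p := by
  obtain ⟨D, hD, hF⟩ := h
  have hm := isMetricOn_chartForm g he
  have hm' := isMetricOn_chartForm g he'
  have hm₁ := isMetricOn_chartForm g he₁
  have hm₁' := isMetricOn_chartForm g he₁'
  set q := geodesicFlow g t p
  have hin : (cotChart g e₁ p).1 ∈ e₁.target ∩ e₁.symm ⁻¹' e.source :=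
    mem_transition_domain hp₁ hp
  have hout : (cotChart g e' q).1 ∈ e'.target ∩ e'.symm ⁻¹' e₁'.source :=
    mem_transition_domain hq hq₁
  have hm1 : MapsTo (fun y => e (e₁.symm y)) (e₁.target ∩ e₁.symm ⁻¹' e.source) e.target :=
    fun y hy => e.map_source hy.2
  have hm2 : MapsTo (fun y => e₁' (e'.symm y)) (e'.target ∩ e'.symm ⁻¹' e₁'.source) e₁'.target :=
    fun y hy => e₁'.map_source hy.2
  have hi := isIsometryOn_transition g he₁ he
  have ho := isIsometryOn_transition g he' he₁'
  set L := fderiv ℝ (cotLift (chartForm g e₁) (chartForm g e) fun y => e (e₁.symm y))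
    (cotChart g e₁ p)
  set L' := fderiv ℝ (cotLift (chartForm g e') (chartForm g e₁') fun y => e₁' (e'.symm y))
    (cotChart g e' q)
  have hL := (hi.differentiableAt_cotLift hm₁ hm inter_subset_left hm1 hin).hasFDerivAt
  have hL' := (ho.differentiableAt_cotLift hm' hm₁' inter_subset_left hm2 hout).hasFDerivAt
  refine ⟨L'.comp (D.comp L), fun a b => ?_, ?_⟩
  · exact (ho.symp_fderiv_cotLift hm' hm₁' inter_subset_left hm2 hout _ _).trans
      ((hD _ _).trans (hi.symp_fderiv_cotLift hm₁ hm inter_subset_left hm1 hin _ _))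
  · have e0 : cotLift (chartForm g e₁) (chartForm g e) (fun y => e (e₁.symm y)) (cotChart g e₁ p)
        = cotChart g e p := (cotChart_transition g he₁ he hp₁ hp).symm
    have h1 : HasFDerivAt (fun z : (Coord d × Coord d) × ℝ =>
        (cotLift (chartForm g e₁) (chartForm g e) (fun y => e (e₁.symm y)) z.1, z.2))
        ((L.comp (ContinuousLinearMap.fst ℝ _ ℝ)).prod (ContinuousLinearMap.snd ℝ _ ℝ))
        (cotChart g e₁ p, t) :=
      (HasFDerivAt.comp (f := Prod.fst) (cotChart g e₁ p, t) hL
        (hasFDerivAt_fst (𝕜 := ℝ) (p := (cotChart g e₁ p, t)))).prodMk hasFDerivAt_snd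
    have h2 : HasFDerivAt (chartFlow g e e') (D.coprod (ContinuousLinearMap.toSpanSingleton ℝ
        (hamField (chartForm g e') (cotChart g e' q))))
        (cotLift (chartForm g e₁) (chartForm g e) (fun y => e (e₁.symm y)) (cotChart g e₁ p), t) := by
      rw [e0]; exact hF
    have h3 := HasFDerivAt.comp (cotChart g e₁ p, t) h2 h1
    have hval : chartFlow g e e' (cotChart g e p, t) = cotChart g e' q := by
      change cotChart g e' (geodesicFlow g t (cotChartInv g e (cotChart g e p))) = _
      rw [cotChartInv_cotChart g he hp]
    have h4 : HasFDerivAt (cotLift (chartForm g e') (chartForm g e₁') fun y => e₁' (e'.symm y)) L'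
        ((chartFlow g e e' ∘ fun z : (Coord d × Coord d) × ℝ =>
        (cotLift (chartForm g e₁) (chartForm g e) (fun y => e (e₁.symm y)) z.1, z.2))
          (cotChart g e₁ p, t)) := by
      simp only [Function.comp, e0, hval]
      exact hL'
    have h5 := HasFDerivAt.comp (cotChart g e₁ p, t) h4 h3
    have hn1 : ∀ᶠ z : (Coord d × Coord d) × ℝ in 𝓝 (cotChart g e₁ p, t),
        z.1.1 ∈ e₁.target ∩ e₁.symm ⁻¹' e.source :=
      (continuous_fst.fst.tendsto (cotChart g e₁ p, t)).eventually
        (isOpen_transition_domain.mem_nhds hin)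
    have hcc : ContinuousAt (fun z : (Coord d × Coord d) × ℝ =>
        geodesicFlow g z.2 (cotChartInv g e₁ z.1)) (cotChart g e₁ p, t) := by
      refine ContinuousAt.comp' (f := fun z : (Coord d × Coord d) × ℝ => (cotChartInv g e₁ z.1, z.2))
        (g := fun q : TangentBundle (𝓡 (d + 1)) N × ℝ => geodesicFlow g q.2 q.1) ?_ ?_
      · simp only [cotChartInv_cotChart g he₁ hp₁]
        exact hc
      · exact (((continuousOn_cotChartInv g he₁).continuousAt (hm₁.isOpen_prod.mem_nhds
          (cotChart_mem hp₁))).comp' (f := fun z : (Coord d × Coord d) × ℝ => z.1) continuousAt_fst).prodMk continuousAt_snd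
    -- Continuity of the flow keeps nearby endpoints in both target charts, so that the composite
    -- formula holds on a neighbourhood.
    have hn2 := hcc.preimage_mem_nhds ((isOpen_overSource (e := e')).inter
      (isOpen_overSource (e := e₁')) |>.mem_nhds (by
        simp only [cotChartInv_cotChart g he₁ hp₁]; exact ⟨hq, hq₁⟩))
    refine (h5.congr_fderiv ?_).congr_of_eventuallyEq ?_
    · have h6 : L' (hamField (chartForm g e') (cotChart g e' q))
          = hamField (chartForm g e₁') (cotChart g e₁' q) := by
        rw [cotChart_transition g he' he₁' hq hq₁]
        exact ho.fderiv_cotLift_hamField hm' hm₁' inter_subset_left hm2 hout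
      refine ContinuousLinearMap.ext fun a => ?_
      simp [h6, q]
    · filter_upwards [hn1, hn2] with z hz hz'
      have e1 : cotLift (chartForm g e₁) (chartForm g e) (fun y => e (e₁.symm y)) z.1
          = cotChart g e (cotChartInv g e₁ z.1) := by
        rw [cotChart_transition g he₁ he (cotChartInv_mem hz.1) hz.2, cotChart_cotChartInv g he₁ hz.1]
      change _ = cotLift _ _ _ (cotChart g e' (geodesicFlow g z.2 (cotChartInv g e
        (cotLift (chartForm g e₁) (chartForm g e) (fun y => e (e₁.symm y)) z.1))))
      rw [e1, cotChartInv_cotChart g he (show (cotChartInv g e₁ z.1).1 ∈ e.source from hz.2), ← cotChart_transition g he' he₁' hz'.1 hz'.2]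
      rfl

/-- The geodesic flow is continuous at `(p, t)`, and differentiable in all charts. -/
def FlowSmoothAt (g : SmoothMetric d N) (t : ℝ) (p : TangentBundle (𝓡 (d + 1)) N) : Prop :=
  ContinuousAt (fun q : TangentBundle (𝓡 (d + 1)) N × ℝ => geodesicFlow g q.2 q.1) (p, t) ∧
  ∀ e ∈ smoothCharts d N, p.1 ∈ e.source → ∀ e' ∈ smoothCharts d N,
    (geodesicFlow g t p).1 ∈ e'.source → HasSympDerivAt g e e' t p

/-- Local uniqueness identifies the flow constructed in a chart with the geodesic flow for short
times, uniformly near the given vector. -/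
theorem exists_flowSmoothAt (g : SmoothMetric d N) (p₀ : TangentBundle (𝓡 (d + 1)) N) :
    ∃ ε > 0, ∃ U ∈ 𝓝 p₀, ∀ p ∈ U, ∀ t ∈ Ioo (-ε) ε, FlowSmoothAt g t p := by
  obtain ⟨e, he, hp₀⟩ := exists_smoothChart d p₀.1
  obtain ⟨ε, hε, U, hU, φ, hUe, hφ, hcont⟩ := exists_local_geodesicFlow g he hp₀
  have h0 : (0 : ℝ) ∈ Ioo (-ε) ε := ⟨by linarith, hε⟩
  have heq : ∀ p ∈ U, ∀ t ∈ Ioo (-ε) ε, φ p t = geodesicFlow g t p := fun p hp t ht =>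
    eq_geodesicFlow_of_mem_Ioo h0 (hφ p hp).1 (fun s hs => ((hφ p hp).2 s hs).2.1) ht
  refine ⟨ε, hε, interior U, interior_mem_nhds.2 hU, fun p hp t ht => ?_⟩
  have hpU := interior_subset hp
  have hc : ContinuousAt (fun q : TangentBundle (𝓡 (d + 1)) N × ℝ => geodesicFlow g q.2 q.1)
      (p, t) := by
    have hn : U ×ˢ Ioo (-ε) ε ∈ 𝓝 (p, t) :=
      prod_mem_nhds (mem_interior_iff_mem_nhds.1 hp) (isOpen_Ioo.mem_nhds ht)
    refine (hcont.continuousAt hn).congr ?_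
    filter_upwards [hn] with q hq using heq q.1 hq.1 q.2 hq.2
  refine ⟨hc, fun e₁ he₁ hp₁ e₁' he₁' hq₁ => ?_⟩
  obtain ⟨hsrc, -, D, hD, hF⟩ := (hφ p hpU).2 t ht
  rw [heq p hpU t ht] at hsrc hF
  refine HasSympDerivAt.change_charts ⟨D, hD, hF.congr_of_eventuallyEq ?_⟩ he he he₁ he₁' (hUe hpU)
    hp₁ hsrc hq₁ hc
  have h1 : ContinuousAt (fun z : (Coord d × Coord d) × ℝ => cotChartInv g e z.1)
      (cotChart g e p, t) :=
    ((continuousOn_cotChartInv g he).continuousAt ((isMetricOn_chartForm g he).isOpen_prod.mem_nhds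
      (cotChart_mem (hUe hpU)))).comp' (f := fun z : (Coord d × Coord d) × ℝ => z.1) continuousAt_fst
  have h2 := h1.preimage_mem_nhds (t := U) (by
    simp only [cotChartInv_cotChart g he (hUe hpU)]; exact mem_interior_iff_mem_nhds.1 hp)
  have h3 : ∀ᶠ z : (Coord d × Coord d) × ℝ in 𝓝 (cotChart g e p, t), z.2 ∈ Ioo (-ε) ε :=
    (continuous_snd.tendsto (cotChart g e p, t)).eventually (isOpen_Ioo.mem_nhds ht)
  filter_upwards [h2, h3] with z hz hz'
  change cotChart g e (geodesicFlow g z.2 (cotChartInv g e z.1)) = _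
  rw [heq _ hz _ hz']

/-- The group law factors the flow to time t + s through a chart at the intermediate point; the time
variable is carried by the second factor. -/
theorem FlowSmoothAt.add (h : FlowSmoothAt g s p) (h' : FlowSmoothAt g t (geodesicFlow g s p)) :
    FlowSmoothAt g (t + s) p := by
  refine ⟨?_, fun e he hp e'' he'' hq => ?_⟩
  · have h1 : ContinuousAt (fun q : TangentBundle (𝓡 (d + 1)) N × ℝ =>
        (geodesicFlow g s q.1, q.2 - s)) (p, t + s) :=
      (ContinuousAt.comp' (x := (p, t + s))
        (f := fun q : TangentBundle (𝓡 (d + 1)) N × ℝ => (q.1, s)) h.1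
        (continuousAt_fst.prodMk continuousAt_const)).prodMk (continuousAt_snd.sub continuousAt_const)
    have h2 := ContinuousAt.comp' (f := fun q : TangentBundle (𝓡 (d + 1)) N × ℝ =>
        (geodesicFlow g s q.1, q.2 - s))
        (g := fun q : TangentBundle (𝓡 (d + 1)) N × ℝ => geodesicFlow g q.2 q.1) (x := (p, t + s))
        (by simpa using h'.1) h1
    simpa only [geodesicFlow_geodesicFlow, sub_add_cancel] using h2
  · obtain ⟨e', he', hq'⟩ := exists_smoothChart d (geodesicFlow g s p).1
    rw [← geodesicFlow_geodesicFlow] at hq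
    obtain ⟨D₁, hD₁, hF₁⟩ := h.2 e he hp e' he' hq'
    obtain ⟨D₂, hD₂, hF₂⟩ := h'.2 e' he' hq' e'' he'' hq
    refine ⟨D₂.comp D₁, fun a b => (hD₂ _ _).trans (hD₁ _ _), ?_⟩
    have hval : chartFlow g e e' (cotChart g e p, s) = cotChart g e' (geodesicFlow g s p) := by
      change cotChart g e' (geodesicFlow g s (cotChartInv g e (cotChart g e p))) = _
      rw [cotChartInv_cotChart g he hp]
    have h1 : HasFDerivAt (fun z : (Coord d × Coord d) × ℝ => (chartFlow g e e' (z.1, s), z.2 - s))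
        ((D₁.comp (ContinuousLinearMap.fst ℝ _ ℝ)).prod (ContinuousLinearMap.snd ℝ _ ℝ))
        (cotChart g e p, t + s) := by
      have h2 : HasFDerivAt (fun z : (Coord d × Coord d) × ℝ => (z.1, s))
          ((ContinuousLinearMap.fst ℝ _ ℝ).prod 0) (cotChart g e p, t + s) :=
        hasFDerivAt_fst.prodMk (hasFDerivAt_const s _)
      refine ((HasFDerivAt.comp (cotChart g e p, t + s) hF₁ h2).prodMk
        (hasFDerivAt_snd.sub_const s)).congr_fderiv ?_
      refine ContinuousLinearMap.ext fun a => ?_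
      simp
    have h3 : HasFDerivAt (chartFlow g e' e'') (D₂.coprod (ContinuousLinearMap.toSpanSingleton ℝ
        (hamField (chartForm g e'') (cotChart g e'' (geodesicFlow g t (geodesicFlow g s p)))))) ((fun z : (Coord d × Coord d) × ℝ =>
        (chartFlow g e e' (z.1, s), z.2 - s)) (cotChart g e p, t + s)) := by
      simp only [hval, add_sub_cancel_right]
      exact hF₂
    have h4 := HasFDerivAt.comp (cotChart g e p, t + s) h3 h1
    have hcc : ContinuousAt (fun z : (Coord d × Coord d) × ℝ =>
        geodesicFlow g s (cotChartInv g e z.1)) (cotChart g e p, t + s) := by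
      refine ContinuousAt.comp' (f := fun z : (Coord d × Coord d) × ℝ => (cotChartInv g e z.1, s))
        (g := fun q : TangentBundle (𝓡 (d + 1)) N × ℝ => geodesicFlow g q.2 q.1) ?_ ?_
      · simp only [cotChartInv_cotChart g he hp]
        exact h.1
      · exact (((continuousOn_cotChartInv g he).continuousAt
          ((isMetricOn_chartForm g he).isOpen_prod.mem_nhds (cotChart_mem hp))).comp'
          (f := fun z : (Coord d × Coord d) × ℝ => z.1) continuousAt_fst).prodMk continuousAt_const
    have hn := hcc.preimage_mem_nhds ((isOpen_overSource (e := e')).mem_nhds (by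
        simp only [cotChartInv_cotChart g he hp]; exact hq'))
    refine (h4.congr_fderiv ?_).congr_of_eventuallyEq ?_
    · rw [geodesicFlow_geodesicFlow]
      refine ContinuousLinearMap.ext fun a => ?_
      simp
    · filter_upwards [hn] with z hz
      change cotChart g e'' (geodesicFlow g z.2 (cotChartInv g e z.1))
        = cotChart g e'' (geodesicFlow g (z.2 - s) (cotChartInv g e'
          (cotChart g e' (geodesicFlow g s (cotChartInv g e z.1)))))
      rw [cotChartInv_cotChart g he' hz, geodesicFlow_geodesicFlow, sub_add_cancel]

theorem continuous_geodesicFlow_left (g : SmoothMetric d N) (p : TangentBundle (𝓡 (d + 1)) N) :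
    Continuous fun t => geodesicFlow g t p :=
  continuous_iff_continuousAt.2 fun t => (isFlowLineAt_geodesicFlow g p t).1

/-- The good times form an open and closed set containing 0. For closedness, the local result at the
limit point covers all nearby vectors, hence also the flow from a nearby good time to the limit
time. -/
theorem flowSmoothAt (g : SmoothMetric d N) (t : ℝ) (p : TangentBundle (𝓡 (d + 1)) N) :
    FlowSmoothAt g t p := by
  have hopen : IsOpen {t | FlowSmoothAt g t p} := by
    refine isOpen_iff_mem_nhds.2 fun s hs => ?_
    obtain ⟨ε, hε, U, hU, h⟩ := exists_flowSmoothAt g (geodesicFlow g s p)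
    filter_upwards [Ioo_mem_nhds (show s - ε < s by linarith) (show s < s + ε by linarith)]
      with r hr
    have := FlowSmoothAt.add hs (h _ (mem_of_mem_nhds hU) (r - s)
      ⟨by linarith [hr.1], by linarith [hr.2]⟩)
    simpa using this
  have hclosed : IsClosed {t | FlowSmoothAt g t p} := by
    refine isClosed_of_closure_subset fun s hs => ?_
    obtain ⟨ε, hε, U, hU, h⟩ := exists_flowSmoothAt g (geodesicFlow g s p)
    have hn : Ioo (s - ε) (s + ε) ∩ (fun r => geodesicFlow g r p) ⁻¹' U ∈ 𝓝 s :=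
      inter_mem (Ioo_mem_nhds (by linarith) (by linarith))
        ((continuous_geodesicFlow_left g p).continuousAt.preimage_mem_nhds hU)
    obtain ⟨r, ⟨hr, hrU⟩, hrS⟩ := mem_closure_iff_nhds.1 hs _ hn
    have := FlowSmoothAt.add hrS (h _ hrU (s - r) ⟨by linarith [hr.2], by linarith [hr.1]⟩)
    simpa using this
  obtain ⟨ε, hε, U, hU, h⟩ := exists_flowSmoothAt g p
  have h0 : FlowSmoothAt g 0 p := h p (mem_of_mem_nhds hU) 0 ⟨by linarith, hε⟩
  have h1 : t ∈ {t | FlowSmoothAt g t p} := by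
    rw [IsClopen.eq_univ ⟨hclosed, hopen⟩ ⟨0, h0⟩]
    exact mem_univ t
  exact h1

theorem continuous_geodesicFlow (g : SmoothMetric d N) :
    Continuous fun q : TangentBundle (𝓡 (d + 1)) N × ℝ => geodesicFlow g q.2 q.1 :=
  continuous_iff_continuousAt.2 fun q => (flowSmoothAt g q.2 q.1).1

theorem hasSympDerivAt (g : SmoothMetric d N) (he : e ∈ smoothCharts d N)
    (he' : e' ∈ smoothCharts d N) (hp : p.1 ∈ e.source) (hq : (geodesicFlow g t p).1 ∈ e'.source) :
    HasSympDerivAt g e e' t p := (flowSmoothAt g t p).2 e he hp e' he' hq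

/-- In charts, the derivative of the flow maps the generating vector field to itself. -/
theorem apply_hamField_of_hasFDerivAt_chartFlow (g : SmoothMetric d N) (he : e ∈ smoothCharts d N)
    (he' : e' ∈ smoothCharts d N) (hp : p.1 ∈ e.source) (hq : (geodesicFlow g t p).1 ∈ e'.source)
    {D : Coord d × Coord d →L[ℝ] Coord d × Coord d} {F : ℝ →L[ℝ] Coord d × Coord d}
    (hF : HasFDerivAt (chartFlow g e e') (D.coprod F) (cotChart g e p, t)) :
    D (hamField (chartForm g e) (cotChart g e p))
      = hamField (chartForm g e') (cotChart g e' (geodesicFlow g t p)) := by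
  have h1 := (isFlowLineAt_geodesicFlow g p 0).2 e he (by simpa [geodesicFlow_zero] using hp)
  have h2 : HasDerivAt (fun s => (cotChart g e (geodesicFlow g s p), t))
      (hamField (chartForm g e) (cotChart g e p), 0) 0 := by
    simp only [geodesicFlow_zero] at h1
    exact h1.prodMk (hasDerivAt_const _ _)
  -- Differentiate φ_t(φ_s(p)) = φ_{s+t}(p) at s = 0 in two ways.
  have h3 := HasFDerivAt.comp_hasDerivAt (0 : ℝ) (l := chartFlow g e e')
    (f := fun s => (cotChart g e (geodesicFlow g s p), t)) (l' := D.coprod F)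
    (by simpa only [geodesicFlow_zero] using hF) h2
  have h4 : HasDerivAt (fun s => cotChart g e' (geodesicFlow g (s + t) p))
      (hamField (chartForm g e') (cotChart g e' (geodesicFlow g t p))) 0 := by
    have := ((isFlowLineAt_geodesicFlow g p (0 + t)).comp_add (t := 0) (a := t)).2 e' he'
      (by simpa using hq)
    simpa using this
  have hn : ∀ᶠ s in 𝓝 (0 : ℝ), geodesicFlow g s p ∈ overSource e :=
    (continuous_geodesicFlow_left g p).continuousAt.preimage_mem_nhds
      (isOpen_overSource.mem_nhds (show (geodesicFlow g 0 p).1 ∈ e.source by rwa [geodesicFlow_zero]))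
  have h5 := h4.congr_of_eventuallyEq (f₁ := chartFlow g e e' ∘
    fun s => (cotChart g e (geodesicFlow g s p), t)) (by
    filter_upwards [hn] with s hs
    change cotChart g e' (geodesicFlow g t (cotChartInv g e (cotChart g e (geodesicFlow g s p)))) = _
    rw [cotChartInv_cotChart g he hs, geodesicFlow_geodesicFlow, add_comm])
  simpa using h3.unique h5

end

/-! ### Boundary charts and the outer normal -/

section

variable {d : ℕ} {N : Type*} [TopologicalSpace N]
  [ChartedSpace (EuclideanSpace ℝ (Fin (d + 1))) N] [IsManifold (𝓡 (d + 1)) ∞ N]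
  {g : SmoothMetric d N} {e e' : OpenPartialHomeomorph N (EuclideanSpace ℝ (Fin (d + 1)))}
  {M : Set N} {x : N} {p : TangentBundle (𝓡 (d + 1)) N}

theorem hasDerivAt_coord {u : ℝ → Coord d} {u' : Coord d} {t : ℝ} (h : HasDerivAt u u' t)
    (i : Fin (d + 1)) : HasDerivAt (fun s => u s i) (u' i) t :=
  ((EuclideanSpace.proj i : Coord d →L[ℝ] ℝ).hasFDerivAt (x := u t)).comp_hasDerivAt t h

theorem continuous_coord (i : Fin (d + 1)) : Continuous fun y : Coord d => y i :=
  (EuclideanSpace.proj i : Coord d →L[ℝ] ℝ).continuous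

theorem exists_chartVector_eq (he : e ∈ smoothCharts d N) (hx : x ∈ e.source) (u : Coord d) :
    ∃ v : TangentSpace (𝓡 (d + 1)) x, chartVector e x v = u := by
  have h := chartVector_mfderiv_symm he (e.map_source hx) u
  rw [e.left_inv hx] at h
  exact ⟨_, h⟩

/-! ### Boundary charts -/

namespace IsBoundaryChart

theorem mem_interior_iff (h : IsBoundaryChart M e) (hx : x ∈ e.source) :
    x ∈ interior M ↔ 0 < e x 0 := by
  constructor
  · intro hi
    have h0 : 0 ≤ e x 0 := (h.2 x hx).1 (interior_subset hi)
    refine h0.lt_of_ne fun h1 => ?_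
    have h2 : e.symm ⁻¹' (interior M ∩ e.source) ∈ 𝓝 (e x) :=
      (e.continuousAt_symm (e.map_source hx)).preimage_mem_nhds (by
        rw [e.left_inv hx]
        exact (isOpen_interior.inter e.open_source).mem_nhds ⟨hi, hx⟩)
    -- If the coordinate vanished at an interior point, a small step in the direction -e₀ would stay
    -- in M but have negative coordinate.
    have h3 : ContinuousAt (fun s : ℝ => e x - s • (EuclideanSpace.single 0 1 : Coord d)) 0 := by
      fun_prop
    have h4 : ∀ᶠ s in 𝓝 (0 : ℝ), e x - s • (EuclideanSpace.single 0 1 : Coord d)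
        ∈ e.symm ⁻¹' (interior M ∩ e.source) ∩ e.target :=
      h3.preimage_mem_nhds (by
        simpa using inter_mem h2 (e.open_target.mem_nhds (e.map_source hx)))
    obtain ⟨s, ⟨⟨hs1, hs2⟩, hs3⟩, hs4⟩ :=
      ((h4.filter_mono nhdsWithin_le_nhds).and (self_mem_nhdsWithin (s := Ioi (0 : ℝ)))).exists
    have h5 := (h.2 _ hs2).1 (interior_subset hs1)
    rw [e.right_inv hs3] at h5
    simp [← h1] at h5
    exact absurd hs4 (not_lt.2 h5)
  · intro h0
    have h1 : e ⁻¹' {y | 0 < y 0} ∈ 𝓝 x :=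
      (e.continuousAt hx).preimage_mem_nhds
        ((isOpen_lt continuous_const (continuous_coord 0)).mem_nhds h0)
    rw [mem_interior_iff_mem_nhds]
    filter_upwards [h1, e.open_source.mem_nhds hx] with y hy hy' using (h.2 y hy').2 (le_of_lt hy)

theorem mem_frontier_iff (h : IsBoundaryChart M e) (hM : IsClosed M) (hx : x ∈ e.source) :
    x ∈ frontier M ↔ e x 0 = 0 := by
  rw [frontier, hM.closure_eq, Set.mem_sdiff, h.2 x hx, h.mem_interior_iff hx, not_lt]
  exact ⟨fun h => le_antisymm h.2 h.1, fun h => ⟨h.ge, h.le⟩⟩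

/-- The normal components of tangent vectors in two boundary charts are proportional. -/
theorem exists_ratio (h : IsBoundaryChart M e) (h' : IsBoundaryChart M e') (hM : IsClosed M)
    (hx : x ∈ e.source) (hx' : x ∈ e'.source) (hfr : x ∈ frontier M) :
    ∃ k : ℝ, 0 < k ∧ ∀ v : TangentSpace (𝓡 (d + 1)) x,
      chartVector e' x v 0 = k * chartVector e x v 0 := by
  set L := fderiv ℝ (fun z => e' (e.symm z)) (e x)
  have hy' : e.symm (e x) ∈ e'.source := by rwa [e.left_inv hx]
  have hL : HasFDerivAt (fun z => e' (e.symm z)) L (e x) :=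
    ((contDiffAt_transition h.1 h'.1 (e.map_source hx) hy').differentiableAt (by simp)).hasFDerivAt
  have h0 : e x 0 = 0 := (h.mem_frontier_iff hM hx).1 hfr
  have h0' : e' x 0 = 0 := (h'.mem_frontier_iff hM hx').1 hfr
  -- The transition map preserves the half-space y⁰ ≥ 0, so the one-sided derivative of the
  -- transversal coordinate in an inward direction cannot be negative.
  have hpos : ∀ u : Coord d, 0 < u 0 → 0 ≤ L u 0 := by
    intro u hu
    have hc : HasDerivAt (fun s : ℝ => e x + s • u) u 0 := by
      simpa using ((hasDerivAt_id (0 : ℝ)).smul_const u).const_add (e x)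
    have h1 : HasDerivAt (fun s : ℝ => e' (e.symm (e x + s • u)) 0) (L u 0) 0 :=
      hasDerivAt_coord (HasFDerivAt.comp_hasDerivAt (0 : ℝ) (l := fun z => e' (e.symm z))
        (by simpa using hL) hc) 0
    have hn : ∀ᶠ s in 𝓝 (0 : ℝ), e x + s • u ∈ e.target ∩ e.symm ⁻¹' e'.source :=
      hc.continuousAt.preimage_mem_nhds (isOpen_transition_domain.mem_nhds (by
        simpa using mem_transition_domain hx hx'))
    by_contra hneg
    have h2 := hasDerivAt_iff_tendsto_slope.1 h1
    have h3 : ∀ᶠ s in 𝓝[>] (0 : ℝ), slope (fun s : ℝ => e' (e.symm (e x + s • u)) 0) 0 s < 0 :=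
      (h2.mono_left (nhdsWithin_mono _ fun s (hs : 0 < s) => hs.ne')).eventually
        (gt_mem_nhds (not_le.1 hneg))
    obtain ⟨s, ⟨hs1, hs2⟩, hs3⟩ := ((h3.and (hn.filter_mono nhdsWithin_le_nhds)).and
      (self_mem_nhdsWithin (s := Ioi (0 : ℝ)))).exists
    have h4 : e.symm (e x + s • u) ∈ M := (h.2 _ (e.map_target hs2.1)).2 (by
      rw [e.right_inv hs2.1]
      simpa [h0] using (mul_pos hs3 hu).le)
    have h5 := (h'.2 _ hs2.2).1 h4
    rw [slope_def_field] at hs1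
    simp only [zero_smul, add_zero, e.left_inv hx, h0', sub_zero] at hs1
    exact absurd hs1 (not_lt.2 (div_nonneg h5 (le_of_lt hs3)))
  set ε₀ : Coord d := EuclideanSpace.single 0 1
  have hε₀ : ε₀ 0 = 1 := by simp [ε₀]
  -- The closed half-space is reached by adding a small multiple of e₀. The functional u ↦ (L u)⁰ is
  -- then nonnegative on a closed half-space, so it vanishes on the hyperplane and is a multiple of
  -- u⁰.
  have hnn : ∀ u : Coord d, 0 ≤ u 0 → 0 ≤ L u 0 := by
    intro u hu
    refine le_of_forall_pos_le_add fun r hr => ?_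
    rcases (hpos ε₀ (by simp [hε₀])).eq_or_lt with hk | hk
    · have := hpos (u + ε₀) (by simp [hε₀]; linarith)
      rw [map_add] at this
      simp only [PiLp.add_apply, ← hk] at this
      linarith
    · have := hpos (u + (r / L ε₀ 0) • ε₀) (by
        have : 0 < r / L ε₀ 0 := div_pos hr hk
        simp [hε₀]; linarith)
      rw [map_add, map_smul] at this
      simp only [PiLp.add_apply, PiLp.smul_apply, smul_eq_mul, div_mul_cancel₀ _ hk.ne'] at this
      exact this
  have hzero : ∀ u : Coord d, u 0 = 0 → L u 0 = 0 := fun u hu => by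
    have h1 := hnn u hu.ge
    have h2 := hnn (-u) (by simp [hu])
    rw [map_neg, PiLp.neg_apply] at h2
    linarith
  have hlin : ∀ u : Coord d, L u 0 = L ε₀ 0 * u 0 := fun u => by
    have := hzero (u - u 0 • ε₀) (by simp [hε₀])
    rw [map_sub, map_smul] at this
    simp only [PiLp.sub_apply, PiLp.smul_apply, smul_eq_mul] at this
    linarith
  have hv : ∀ v : TangentSpace (𝓡 (d + 1)) x,
      chartVector e' x v 0 = L ε₀ 0 * chartVector e x v 0 := fun v => by
    rw [← chartVector_transition h.1 h'.1 hx hx' v]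
    exact hlin _
  refine ⟨L ε₀ 0, (hpos ε₀ (by simp [hε₀])).lt_of_ne fun hk => ?_, hv⟩
  -- The factor is not zero, because the coordinates in the second chart attain e₀.
  obtain ⟨v, h2⟩ := exists_chartVector_eq h'.1 hx' ε₀
  have h1 := hv v
  rw [h2, ← hk, zero_mul, hε₀] at h1
  exact one_ne_zero h1

end IsBoundaryChart

/-- The normal is minus the normalized gradient of y⁰ in one boundary chart; proportionality of the
transversal coordinates makes it valid in all of them. -/
theorem exists_isOuterUnitNormal (g : SmoothMetric d N) (hM : IsSmoothDomain d M)
    (hx : x ∈ frontier M) : ∃ ν, IsOuterUnitNormal g M x ν := by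
  obtain ⟨e, he, hxe⟩ := hM.2 x hx
  have hm := isMetricOn_chartForm g he.1
  have hy := e.map_source hxe
  set ε₀ : Coord d := EuclideanSpace.single 0 1
  set w : Coord d := (metricOp (chartForm g e) (e x)).inverse ε₀
  have hw : ∀ u : Coord d, chartMetric g e (e x) w u = u 0 := fun u => by
    have := hm.form_inverse hy ε₀ u
    rw [EuclideanSpace.inner_single_left] at this
    simpa [chartForm_apply] using this
  have hw0 : w ≠ 0 := fun h0 => by
    have := hw ε₀
    rw [h0, ← chartForm_apply] at this
    simp [ε₀] at this
  have hpos : 0 < chartMetric g e (e x) w w := chartMetric_pos g he.1 hy hw0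
  set r := chartMetric g e (e x) w w
  set s := (Real.sqrt r)⁻¹
  have hs : 0 < s := inv_pos.2 (Real.sqrt_pos.2 hpos)
  have hwr : w 0 = r := (hw w).symm
  obtain ⟨ν, hν⟩ := exists_chartVector_eq he.1 hxe ((-s) • w)
  have hin : ∀ v : TangentSpace (𝓡 (d + 1)) x, g.inner x ν v = -s * chartVector e x v 0 := by
    intro v
    rw [← chartMetric_chartVector g he.1 hxe, hν, ← hw, ← chartForm_apply, ← chartForm_apply,
      map_smul]
    rfl
  refine ⟨ν, ?_, fun e' he' hx' => ?_⟩
  · rw [hin, hν]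
    simp only [PiLp.smul_apply, smul_eq_mul, hwr]
    have := Real.mul_self_sqrt hpos.le
    simp only [s]
    field_simp
    rw [sq, this]
  · obtain ⟨k, hk, hv⟩ := he.exists_ratio he' hM.1 hxe hx' hx
    refine ⟨?_, fun v h0 => ?_⟩
    · rw [hv, hν]
      simp only [PiLp.smul_apply, smul_eq_mul, hwr]
      have : 0 < k * (s * r) := by positivity
      linarith
    · rw [hv] at h0
      rw [hin, (mul_eq_zero.1 h0).resolve_left hk.ne', mul_zero]

theorem isOuterUnitNormal_outerNormal (g : SmoothMetric d N) (hM : IsSmoothDomain d M)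
    (hx : x ∈ frontier M) : IsOuterUnitNormal g M x (outerNormal g M x) := by
  have h := exists_isOuterUnitNormal g hM hx
  rw [outerNormal, dif_pos h]
  exact h.choose_spec

/-- The component of a tangent vector transversal to the boundary, in a boundary chart. -/
def normalCoord (e : OpenPartialHomeomorph N (EuclideanSpace ℝ (Fin (d + 1))))
    (p : TangentBundle (𝓡 (d + 1)) N) : ℝ := chartVector e p.1 p.2 0

theorem normalCoord_bscale (e : OpenPartialHomeomorph N (EuclideanSpace ℝ (Fin (d + 1)))) (r : ℝ)
    (p : TangentBundle (𝓡 (d + 1)) N) : normalCoord e (bscale r p) = r * normalCoord e p := by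
  have h : chartVector e p.1 (r • p.2) = r • chartVector e p.1 p.2 :=
    map_smul (mfderiv (𝓡 (d + 1)) (𝓡 (d + 1)) e p.1) r p.2
  change chartVector e p.1 (r • p.2) 0 = _
  rw [h]
  rfl

theorem continuousOn_normalCoord (he : e ∈ smoothCharts d N) :
    ContinuousOn (normalCoord e) (overSource e) :=
  (continuous_coord 0).comp_continuousOn (continuousOn_chartVector he).snd

theorem outerNormal_coord_neg (hM : IsSmoothDomain d M) (he : IsBoundaryChart M e)
    (hx : x ∈ e.source) (hfr : x ∈ frontier M) : chartVector e x (outerNormal g M x) 0 < 0 :=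
  ((isOuterUnitNormal_outerNormal g hM hfr).2 e he hx).1

/-- The vector v - (v⁰/ν⁰)ν is tangential, hence orthogonal to ν. Signs of ⟨ν, v⟩ can thus be read
off from v⁰, the opposite sign being due to ν⁰ < 0. -/
theorem inner_outerNormal (hM : IsSmoothDomain d M) (he : IsBoundaryChart M e)
    (hx : x ∈ e.source) (hfr : x ∈ frontier M) (v : TangentSpace (𝓡 (d + 1)) x) :
    g.inner x (outerNormal g M x) v
      = chartVector e x v 0 / chartVector e x (outerNormal g M x) 0 := by
  obtain ⟨h1, h2⟩ := isOuterUnitNormal_outerNormal g hM hfr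
  obtain ⟨h3, h4⟩ := h2 e he hx
  set ν := outerNormal g M x
  set a := chartVector e x v 0 / chartVector e x ν 0
  have hsub : chartVector e x (v - a • ν) = chartVector e x v - a • chartVector e x ν := by
    have h5 : chartVector e x (v - a • ν) = chartVector e x v - chartVector e x (a • ν) :=
      map_sub (mfderiv (𝓡 (d + 1)) (𝓡 (d + 1)) e x) v (a • ν)
    have h6 : chartVector e x (a • ν) = a • chartVector e x ν :=
      map_smul (mfderiv (𝓡 (d + 1)) (𝓡 (d + 1)) e x) a ν
    rw [h5, h6]
  have h0 := h4 (v - a • ν) (by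
    rw [hsub]
    simp only [PiLp.sub_apply, PiLp.smul_apply, smul_eq_mul]
    simp only [a]
    rw [div_mul_cancel₀ _ h3.ne, sub_self])
  have h7 : g.inner x ν (v - a • ν) = g.inner x ν v - a • g.inner x ν ν := by
    have h8 : g.inner x ν (v - a • ν) = g.inner x ν v - g.inner x ν (a • ν) :=
      map_sub (g.inner x ν) v (a • ν)
    have h9 : g.inner x ν (a • ν) = a • g.inner x ν ν := map_smul (g.inner x ν) a ν
    rw [h8, h9]
  rw [h7, h1, smul_eq_mul, mul_one] at h0
  linarith

theorem inner_outerNormal_eq (hM : IsSmoothDomain d M) (he : IsBoundaryChart M e)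
    (hp : p.1 ∈ e.source) (hfr : p.1 ∈ frontier M) :
    g.inner p.1 (outerNormal g M p.1) p.2
      = normalCoord e p / chartVector e p.1 (outerNormal g M p.1) 0 :=
  inner_outerNormal hM he hp hfr p.2

theorem inner_outerNormal_pos_iff (hM : IsSmoothDomain d M) (he : IsBoundaryChart M e)
    (hp : p.1 ∈ e.source) (hfr : p.1 ∈ frontier M) :
    0 < g.inner p.1 (outerNormal g M p.1) p.2 ↔ normalCoord e p < 0 := by
  rw [inner_outerNormal_eq hM he hp hfr]
  have h := outerNormal_coord_neg (g := g) hM he hp hfr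
  rw [div_pos_iff]
  constructor
  · rintro (h1 | h1)
    · exact absurd h1.2 h.not_gt
    · exact h1.1
  · exact fun h1 => Or.inr ⟨h1, h⟩

theorem inner_outerNormal_neg_iff (hM : IsSmoothDomain d M) (he : IsBoundaryChart M e)
    (hp : p.1 ∈ e.source) (hfr : p.1 ∈ frontier M) :
    g.inner p.1 (outerNormal g M p.1) p.2 < 0 ↔ 0 < normalCoord e p := by
  rw [inner_outerNormal_eq hM he hp hfr]
  have h := outerNormal_coord_neg (g := g) hM he hp hfr
  rw [div_neg_iff]
  constructor
  · rintro (h1 | h1)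
    · exact h1.1
    · exact absurd h1.2 h.not_gt
  · exact fun h1 => Or.inl ⟨h1, h⟩

theorem continuous_energy (g : SmoothMetric d N) :
    Continuous fun p : TangentBundle (𝓡 (d + 1)) N => g.inner p.1 p.2 p.2 := by
  rw [continuous_iff_continuousAt]
  intro p
  obtain ⟨e, he, hp⟩ := exists_smoothChart d p.1
  have h1 : ContinuousAt (fun q => 2 * ham (chartForm g e) (cotChart g e q)) p :=
    continuousAt_const.mul ((((isMetricOn_chartForm g he).contDiffOn_ham.continuousOn.continuousAt
      ((isMetricOn_chartForm g he).isOpen_prod.mem_nhds (cotChart_mem hp)))).comp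
      ((continuousOn_cotChart g he).continuousAt (isOpen_overSource.mem_nhds hp)))
  refine h1.congr ?_
  filter_upwards [(isOpen_overSource (e := e)).mem_nhds hp] with q hq
  rw [ham_cotChart g he hq]
  ring

/-! ### Geodesics at the boundary -/

/-- The second derivative test: the sign of f' is opposite to that of t - t₀, and the mean value
theorem transfers this to f on both sides. -/
theorem eventually_neg_of_deriv_neg {f f' : ℝ → ℝ} {a t₀ : ℝ} (ha : a < 0) (h0 : f t₀ = 0)
    (h0' : f' t₀ = 0) (hf : ∀ᶠ t in 𝓝 t₀, HasDerivAt f (f' t) t) (hf' : HasDerivAt f' a t₀) :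
    ∀ᶠ t in 𝓝[≠] t₀, f t < 0 := by
  have h1 := (hasDerivAt_iff_tendsto_slope.1 hf').eventually (gt_mem_nhds ha)
  rw [eventually_nhdsWithin_iff] at h1
  obtain ⟨ε, hε, hb⟩ := Metric.eventually_nhds_iff_ball.1 (hf.and h1)
  rw [eventually_nhdsWithin_iff]
  filter_upwards [Metric.ball_mem_nhds t₀ hε] with t ht hne
  have hsl : ∀ s ∈ Metric.ball t₀ ε, s ≠ t₀ → f' s / (s - t₀) < 0 := fun s hs hs' => by
    have := (hb s hs).2 hs'
    rwa [slope_def_field, h0', sub_zero] at this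
  rw [Real.ball_eq_Ioo] at ht hb hsl
  rcases lt_or_gt_of_ne hne with hlt | hgt
  · obtain ⟨c, hc, hc'⟩ := exists_hasDerivAt_eq_slope f f' hlt
      (fun s hs => (hb s ⟨by linarith [ht.1, hs.1], by linarith [hs.2]⟩).1.continuousAt.continuousWithinAt)
      (fun s hs => (hb s ⟨by linarith [ht.1, hs.1], by linarith [hs.2]⟩).1)
    have h2 := hsl c ⟨by linarith [ht.1, hc.1], by linarith [hc.2]⟩ hc.2.ne
    have h3 : 0 < f' c := by
      rcases div_neg_iff.1 h2 with h | h
      · exact h.1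
      · linarith [h.2, hc.2]
    rw [hc', h0, lt_div_iff₀ (by linarith)] at h3
    linarith
  · obtain ⟨c, hc, hc'⟩ := exists_hasDerivAt_eq_slope f f' hgt
      (fun s hs => (hb s ⟨by linarith [hs.1], by linarith [ht.2, hs.2]⟩).1.continuousAt.continuousWithinAt)
      (fun s hs => (hb s ⟨by linarith [hs.1], by linarith [ht.2, hs.2]⟩).1)
    have h2 := hsl c ⟨by linarith [hc.1], by linarith [ht.2, hc.2]⟩ hc.1.ne'
    have h3 : f' c < 0 := by
      rcases div_neg_iff.1 h2 with h | h
      · linarith [h.2, hc.1]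
      · exact h.1
    rw [hc', h0, div_lt_iff₀ (by linarith)] at h3
    linarith

theorem eventually_sign_of_hasDerivAt {f : ℝ → ℝ} {a t₀ : ℝ} (ha : 0 < a) (h0 : f t₀ = 0)
    (hf : HasDerivAt f a t₀) : (∀ᶠ t in 𝓝[>] t₀, 0 < f t) ∧ ∀ᶠ t in 𝓝[<] t₀, f t < 0 := by
  have h1 := (hasDerivAt_iff_tendsto_slope.1 hf).eventually (lt_mem_nhds ha)
  constructor
  · have h2 := h1.filter_mono (nhdsWithin_mono t₀ (s := Ioi t₀) fun s hs => ne_of_gt hs)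
    filter_upwards [h2, self_mem_nhdsWithin] with s hs hs'
    rw [slope_def_field, h0, sub_zero] at hs
    have h3 : 0 < s - t₀ := sub_pos.2 hs'
    simpa [h3.ne'] using mul_pos hs h3
  · have h2 := h1.filter_mono (nhdsWithin_mono t₀ (s := Iio t₀) fun s hs => ne_of_lt hs)
    filter_upwards [h2, self_mem_nhdsWithin] with s hs hs'
    rw [slope_def_field, h0, sub_zero] at hs
    have h3 : s - t₀ < 0 := sub_neg.2 hs'
    rcases div_pos_iff.1 hs with h | h
    · linarith [h.2]
    · exact h.1

section Flow

variable [T2Space N] [CompactSpace N]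

theorem hasDerivAt_chart_geodesic (he : e ∈ smoothCharts d N) {t : ℝ}
    (ht : (geodesicFlow g t p).1 ∈ e.source) :
    HasDerivAt (fun s => e (geodesic g p s))
      (chartVector e (geodesicFlow g t p).1 (geodesicFlow g t p).2) t := by
  have h := (isFlowLineAt_geodesicFlow g p t).2 e he ht
  have h1 : HasDerivAt (fun s => (cotChart g e (geodesicFlow g s p)).1) _ t := h.fst
  rw [(isMetricOn_chartForm g he).hamField_fst (e.map_source ht), velocity_cotChart g he ht] at h1
  exact h1

theorem hasDerivAt_normal_geodesic (he : e ∈ smoothCharts d N) {t : ℝ}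
    (ht : (geodesicFlow g t p).1 ∈ e.source) :
    HasDerivAt (fun s => e (geodesic g p s) 0) (normalCoord e (geodesicFlow g t p)) t :=
  hasDerivAt_coord (hasDerivAt_chart_geodesic he ht) 0

theorem continuous_geodesic (g : SmoothMetric d N) (p : TangentBundle (𝓡 (d + 1)) N) :
    Continuous (geodesic g p) := continuous_base.comp (continuous_geodesicFlow_left g p)

theorem geodesic_zero (g : SmoothMetric d N) (p : TangentBundle (𝓡 (d + 1)) N) :
    geodesic g p 0 = p.1 := by
  rw [← geodesicFlow_fst, geodesicFlow_zero]

theorem eventually_geodesic_mem_source {t₀ : ℝ} (h : geodesic g p t₀ ∈ e.source) :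
    ∀ᶠ t in 𝓝 t₀, geodesic g p t ∈ e.source :=
  (continuous_geodesic g p).continuousAt.preimage_mem_nhds (e.open_source.mem_nhds h)

theorem chartVector_ne_zero (he : e ∈ smoothCharts d N) (hp : p.1 ∈ e.source)
    (hne : 0 < g.inner p.1 p.2 p.2) : chartVector e p.1 p.2 ≠ 0 := by
  intro h
  rw [← chartForm_cotChart g he hp, h] at hne
  simp at hne

/-- Tangential geodesics leave a domain with strictly convex boundary. -/
theorem eventually_notMem_of_tangential (hM : IsSmoothDomain d M)
    (hconv : HasStrictlyConvexBoundary g M) (he : IsBoundaryChart M e) {t₀ : ℝ}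
    (hx : geodesic g p t₀ ∈ e.source) (hfr : geodesic g p t₀ ∈ frontier M)
    (h0 : normalCoord e (geodesicFlow g t₀ p) = 0) (hne : 0 < g.inner p.1 p.2 p.2) :
    ∀ᶠ t in 𝓝[≠] t₀, geodesic g p t ∉ M := by
  obtain ⟨hγ, hgeo⟩ := (geodesic_spec g p).1
  set u : ℝ → Coord d := fun s => e (geodesic g p s)
  set x := geodesic g p t₀
  have hev := eventually_geodesic_mem_source hx
  have hu2 : ContDiffAt ℝ 2 u t₀ := contDiffAt_chart_comp (n := 2) he.1 hγ.contMDiffAt hx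
  have hv : DifferentiableAt ℝ (deriv u) t₀ :=
    ((hu2.fderiv_right (m := 1) (by norm_num)).clm_apply
      (contDiffAt_const (c := (1 : ℝ)))).differentiableAt (by simp)
  have hd : ∀ᶠ t in 𝓝 t₀, deriv u t
      = chartVector e (geodesicFlow g t p).1 (geodesicFlow g t p).2 := by
    filter_upwards [hev] with t ht using (hasDerivAt_chart_geodesic he.1 ht).deriv
  -- Pairing the geodesic equation with ν gives ⟨u'', ν⟩ = -Γ(u', u'; ν) > 0 by convexity, so the
  -- transversal acceleration has the sign of ν⁰, which is negative.
  have hacc : deriv (deriv u) t₀ 0 < 0 := by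
    have h1 := hgeo e he.1 t₀ hx (chartVector e x (outerNormal g M x))
    have h2 : deriv u t₀ = chartVector e x (geodesicFlow g t₀ p).2 := hd.self_of_nhds
    have h3 : deriv u t₀ ≠ 0 := by
      rw [h2]
      exact chartVector_ne_zero (g := g) (p := geodesicFlow g t₀ p) he.1 hx
        (by rwa [inner_geodesicFlow])
    have h4 := hconv e he x hx hfr (deriv u t₀) (by rw [h2]; exact h0) h3
    set a := deriv (deriv u) t₀
    have h5 : chartMetric g e (e x) a (chartVector e x (outerNormal g M x))
        = a 0 / chartVector e x (outerNormal g M x) 0 := by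
      obtain ⟨v, hv⟩ := exists_chartVector_eq he.1 hx a
      have h6 := inner_outerNormal (g := g) hM he hx hfr v
      rw [← chartMetric_chartVector g he.1 hx, hv] at h6
      rw [chartMetric_symm, h6]
    have h6 := outerNormal_coord_neg (g := g) hM he hx hfr
    change chartMetric g e (e x) a _ + christoffel g e (e x) (deriv u t₀) (deriv u t₀) _ = 0 at h1
    have h7 : 0 < a 0 / chartVector e x (outerNormal g M x) 0 := by rw [← h5]; linarith
    rcases div_pos_iff.1 h7 with h | h
    · linarith [h.2]
    · exact h.1
  have h1 : ∀ᶠ t in 𝓝[≠] t₀, u t 0 < 0 := by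
    refine eventually_neg_of_deriv_neg (f := fun t => u t 0)
      (f' := fun t => normalCoord e (geodesicFlow g t p)) hacc
      ((he.mem_frontier_iff hM.1 hx).1 hfr) h0 ?_ ?_
    · filter_upwards [hev] with t ht using hasDerivAt_normal_geodesic he.1 ht
    · refine (hasDerivAt_coord hv.hasDerivAt 0).congr_of_eventuallyEq ?_
      filter_upwards [hd] with t ht
      rw [ht]
      rfl
  filter_upwards [h1, hev.filter_mono nhdsWithin_le_nhds] with t ht ht' hm
  exact absurd ((he.2 _ ht').1 hm) (not_le.2 ht)

theorem eventually_of_inward (hM : IsSmoothDomain d M) (he : IsBoundaryChart M e) {t₀ : ℝ}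
    (hx : geodesic g p t₀ ∈ e.source) (hfr : geodesic g p t₀ ∈ frontier M)
    (h0 : 0 < normalCoord e (geodesicFlow g t₀ p)) :
    (∀ᶠ t in 𝓝[>] t₀, geodesic g p t ∈ interior M) ∧ ∀ᶠ t in 𝓝[<] t₀, geodesic g p t ∉ M := by
  have hev := eventually_geodesic_mem_source hx
  obtain ⟨h1, h2⟩ := eventually_sign_of_hasDerivAt h0 ((he.mem_frontier_iff hM.1 hx).1 hfr)
    (hasDerivAt_normal_geodesic he.1 hx)
  constructor
  · filter_upwards [h1, hev.filter_mono nhdsWithin_le_nhds] with t ht ht'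
    exact (he.mem_interior_iff ht').2 ht
  · filter_upwards [h2, hev.filter_mono nhdsWithin_le_nhds] with t ht ht' hm
    exact absurd ((he.2 _ ht').1 hm) (not_le.2 ht)

theorem eventually_of_outward (hM : IsSmoothDomain d M) (he : IsBoundaryChart M e) {t₀ : ℝ}
    (hx : geodesic g p t₀ ∈ e.source) (hfr : geodesic g p t₀ ∈ frontier M)
    (h0 : normalCoord e (geodesicFlow g t₀ p) < 0) :
    ∀ᶠ t in 𝓝[>] t₀, geodesic g p t ∉ M := by
  have hev := eventually_geodesic_mem_source hx
  obtain ⟨h1, -⟩ := eventually_sign_of_hasDerivAt (f := fun s => -(e (geodesic g p s) 0))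
    (neg_pos.2 h0) (by rw [(he.mem_frontier_iff hM.1 hx).1 hfr, neg_zero])
    (hasDerivAt_normal_geodesic he.1 hx).neg
  filter_upwards [h1, hev.filter_mono nhdsWithin_le_nhds] with t ht ht' hm
  have := (he.2 _ ht').1 hm
  linarith

end Flow

end

/-! ### The travel time -/

section

variable {d : ℕ} {N : Type*} [TopologicalSpace N]
  [ChartedSpace (EuclideanSpace ℝ (Fin (d + 1))) N] [IsManifold (𝓡 (d + 1)) ∞ N]
  [T2Space N] [CompactSpace N]
  {g : SmoothMetric d N} {e e' : OpenPartialHomeomorph N (EuclideanSpace ℝ (Fin (d + 1)))}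
  {M : Set N} {x : N} {p : TangentBundle (𝓡 (d + 1)) N}

/-- The standing assumptions on the domain `M`. -/
structure IsConvexNonTrapping (g : SmoothMetric d N) (M : Set N) : Prop where
  smooth : IsSmoothDomain d M
  convex : HasStrictlyConvexBoundary g M
  nonTrapping : IsNonTrapping g M

/-- The travel time as a real number. -/
def exitTime (g : SmoothMetric d N) (M : Set N) (p : TangentBundle (𝓡 (d + 1)) N) : ℝ :=
  (travelTime g M p).toReal

/-- The point of the tangent bundle at which the geodesic leaves `M`. -/
def scatter (g : SmoothMetric d N) (M : Set N) (p : TangentBundle (𝓡 (d + 1)) N) :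
    TangentBundle (𝓡 (d + 1)) N := geodesicFlow g (exitTime g M p) p

/-- The tangent vectors at boundary points that point strictly into `M`. -/
def strictInward (g : SmoothMetric d N) (M : Set N) : Set (TangentBundle (𝓡 (d + 1)) N) :=
  {p | p.1 ∈ frontier M ∧ g.inner p.1 (outerNormal g M p.1) p.2 < 0}

/-- The tangent vectors at boundary points that point strictly out of `M`. -/
def strictOutward (g : SmoothMetric d N) (M : Set N) : Set (TangentBundle (𝓡 (d + 1)) N) :=
  {p | p.1 ∈ frontier M ∧ 0 < g.inner p.1 (outerNormal g M p.1) p.2}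

theorem travelTime_lt_iff {c : ℝ≥0∞} :
    travelTime g M p < c ↔ ∃ t : ℝ, (0 < t ∧ geodesic g p t ∉ M) ∧ ENNReal.ofReal t < c := by
  simp only [travelTime, iInf_lt_iff, exists_prop]

theorem exitTime_nonneg (g : SmoothMetric d N) (M : Set N) (p : TangentBundle (𝓡 (d + 1)) N) :
    0 ≤ exitTime g M p := ENNReal.toReal_nonneg

theorem geodesic_mem_of_lt_exitTime {t : ℝ} (h0 : 0 < t) (ht : t < exitTime g M p) :
    geodesic g p t ∈ M := by
  by_contra h
  have h1 : travelTime g M p ≤ ENNReal.ofReal t := iInf₂_le t ⟨h0, h⟩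
  exact absurd (ENNReal.toReal_le_of_le_ofReal h0.le h1) (not_le.2 ht)

theorem exists_notMem_of_exitTime_lt (h : travelTime g M p < ⊤) {s : ℝ}
    (hs : exitTime g M p < s) : ∃ t ∈ Ioo 0 s, geodesic g p t ∉ M := by
  have h1 : travelTime g M p < ENNReal.ofReal s := (ENNReal.lt_ofReal_iff_toReal_lt h.ne).2 hs
  obtain ⟨t, ⟨h0, ht⟩, hlt⟩ := travelTime_lt_iff.1 h1
  exact ⟨t, ⟨h0, (ENNReal.ofReal_lt_ofReal_iff_of_nonneg h0.le).1 hlt⟩, ht⟩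

/-- The second condition also forces the travel time to be finite, so that its real value is not the
default one. -/
theorem exitTime_eq {τ : ℝ} (h : ∀ t ∈ Ioo 0 τ, geodesic g p t ∈ M)
    (h' : ∀ s, τ < s → ∃ t ∈ Ioo 0 s, geodesic g p t ∉ M) : exitTime g M p = τ := by
  have hlt : travelTime g M p < ⊤ := by
    obtain ⟨t, ht, hm⟩ := h' (τ + 1) (by linarith)
    exact travelTime_lt_iff.2 ⟨t, ⟨ht.1, hm⟩, ENNReal.ofReal_lt_top⟩
  refine le_antisymm (le_of_not_gt fun hgt => ?_) (le_of_not_gt fun hgt => ?_)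
  · obtain ⟨t, ht, hm⟩ := h' _ hgt
    exact hm (geodesic_mem_of_lt_exitTime ht.1 ht.2)
  · obtain ⟨t, ht, hm⟩ := exists_notMem_of_exitTime_lt hlt hgt
    exact hm (h t ht)

theorem geodesic_bscale (g : SmoothMetric d N) (r t : ℝ) (p : TangentBundle (𝓡 (d + 1)) N) :
    geodesic g (bscale r p) t = geodesic g p (r * t) := by
  rw [← geodesicFlow_fst, geodesicFlow_bscale]
  rfl

theorem inner_bscale_right (r : ℝ) (ν : TangentSpace (𝓡 (d + 1)) p.1) :
    g.inner p.1 ν (bscale r p).2 = r * g.inner p.1 ν p.2 :=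
  map_smul (g.inner p.1 ν) r p.2

theorem bscale_mem_strictInward {r : ℝ} (hr : 0 < r) (h : p ∈ strictInward g M) :
    bscale r p ∈ strictInward g M :=
  ⟨h.1, (inner_bscale_right r _).trans_lt (mul_neg_of_pos_of_neg hr h.2)⟩

theorem inner_reverse (ν : TangentSpace (𝓡 (d + 1)) p.1) :
    g.inner p.1 ν (reverse p).2 = -g.inner p.1 ν p.2 := map_neg (g.inner p.1 ν) p.2

theorem reverse_reverse (p : TangentBundle (𝓡 (d + 1)) N) : reverse (reverse p) = p := by
  rw [reverse_eq_bscale, reverse_eq_bscale, bscale_bscale]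
  norm_num [bscale_one]

theorem inner_reverse_self (g : SmoothMetric d N) (p : TangentBundle (𝓡 (d + 1)) N) :
    g.inner (reverse p).1 (reverse p).2 (reverse p).2 = g.inner p.1 p.2 p.2 := by
  rw [reverse_eq_bscale, inner_bscale]
  norm_num

theorem reverse_mem_strictInward (h : p ∈ strictOutward g M) : reverse p ∈ strictInward g M :=
  ⟨h.1, (inner_reverse _).trans_lt (neg_neg_iff_pos.2 h.2)⟩

theorem energy_pos_of_ne {ν : TangentSpace (𝓡 (d + 1)) p.1} (h : g.inner p.1 ν p.2 ≠ 0) :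
    0 < g.inner p.1 p.2 p.2 := by
  refine g.pos p.1 p.2 fun h0 => h ?_
  rw [h0]
  exact map_zero (g.inner p.1 ν)

theorem energy_pos_of_strictInward (h : p ∈ strictInward g M) : 0 < g.inner p.1 p.2 p.2 :=
  energy_pos_of_ne h.2.ne

theorem geodesicFlow_reverse (g : SmoothMetric d N) (t : ℝ) (p : TangentBundle (𝓡 (d + 1)) N) :
    geodesicFlow g t (reverse p) = reverse (geodesicFlow g (-t) p) := by
  rw [reverse_eq_bscale, reverse_eq_bscale, geodesicFlow_bscale, neg_one_mul]

theorem inner_scatter (p : TangentBundle (𝓡 (d + 1)) N) :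
    g.inner (scatter g M p).1 (scatter g M p).2 (scatter g M p).2 = g.inner p.1 p.2 p.2 :=
  inner_geodesicFlow g _ p

/-- Leaving the closed set M at a given time is an open condition on the initial vector. The
resulting upper semicontinuity gives Borel measurability, and no continuity at tangential vectors is
needed. -/
theorem isOpen_travelTime_lt (g : SmoothMetric d N) (hM : IsClosed M) (c : ℝ≥0∞) :
    IsOpen {p | travelTime g M p < c} := by
  have : {p | travelTime g M p < c} = ⋃ t ∈ {t : ℝ | 0 < t ∧ ENNReal.ofReal t < c},
      {p | geodesic g p t ∉ M} := by
    ext p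
    simp only [mem_ofPred_eq, mem_iUnion, exists_prop, travelTime_lt_iff]
    exact ⟨fun ⟨t, h, h'⟩ => ⟨t, ⟨h.1, h'⟩, h.2⟩, fun ⟨t, h, h'⟩ => ⟨t, ⟨h.1, h'⟩, h.2⟩⟩
  rw [this]
  refine isOpen_biUnion fun t _ => hM.isOpen_compl.preimage ?_
  exact continuous_base.comp ((continuous_geodesicFlow g).comp
    (Continuous.prodMk continuous_id (continuous_const (y := t))))

/-! ### Exit of geodesics from a strictly convex, non-trapping domain. -/

namespace IsConvexNonTrapping

theorem frontier_subset (H : IsConvexNonTrapping g M) : frontier M ⊆ M := H.smooth.1.frontier_subset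

theorem travelTime_lt_top (H : IsConvexNonTrapping g M) (hp : p.1 ∈ M) (hE : 0 < g.inner p.1 p.2 p.2) :
    travelTime g M p < ⊤ := by
  set r := (Real.sqrt (g.inner p.1 p.2 p.2))⁻¹
  have hr : 0 < r := inv_pos.2 (Real.sqrt_pos.2 hE)
  have h1 : g.inner (bscale r p).1 (bscale r p).2 (bscale r p).2 = 1 := by
    rw [inner_bscale, inv_pow, Real.sq_sqrt hE.le, inv_mul_cancel₀ hE.ne']
  obtain ⟨t, ⟨h0, ht⟩, -⟩ := travelTime_lt_iff.1 (H.nonTrapping (bscale r p) hp h1)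
  rw [geodesic_bscale] at ht
  exact travelTime_lt_iff.2 ⟨r * t, ⟨mul_pos hr h0, ht⟩, ENNReal.ofReal_lt_top⟩

theorem exitTime_bscale (H : IsConvexNonTrapping g M) (hp : p.1 ∈ M) (hE : 0 < g.inner p.1 p.2 p.2) {r : ℝ} (hr : 0 < r) :
    exitTime g M (bscale r p) = exitTime g M p / r := by
  refine exitTime_eq (fun t ht => ?_) fun s hs => ?_
  · rw [geodesic_bscale]
    exact geodesic_mem_of_lt_exitTime (mul_pos hr ht.1) (by rw [mul_comm]; exact (lt_div_iff₀ hr).1 ht.2)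
  · rw [div_lt_iff₀ hr] at hs
    obtain ⟨t, ht, hm⟩ := exists_notMem_of_exitTime_lt (H.travelTime_lt_top hp hE) hs
    refine ⟨t / r, ⟨div_pos ht.1 hr, (div_lt_iff₀ hr).2 ht.2⟩, ?_⟩
    rwa [geodesic_bscale, mul_div_cancel₀ _ hr.ne']

theorem scatter_bscale (H : IsConvexNonTrapping g M) (hp : p.1 ∈ M) (hE : 0 < g.inner p.1 p.2 p.2) {r : ℝ} (hr : 0 < r) :
    scatter g M (bscale r p) = bscale r (scatter g M p) := by
  rw [scatter, H.exitTime_bscale hp hE hr, geodesicFlow_bscale, mul_div_cancel₀ _ hr.ne', scatter]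

theorem geodesic_mem_of_le_exitTime (H : IsConvexNonTrapping g M) (hp : p.1 ∈ M) {t : ℝ} (h0 : 0 ≤ t)
    (ht : t ≤ exitTime g M p) : geodesic g p t ∈ M := by
  rcases h0.eq_or_lt with rfl | h0
  · rwa [geodesic_zero]
  rcases ht.eq_or_lt with rfl | ht
  · have h1 : closure (Ioo 0 (exitTime g M p)) ⊆ geodesic g p ⁻¹' M :=
      closure_minimal (fun s hs => geodesic_mem_of_lt_exitTime hs.1 hs.2)
        (H.smooth.1.preimage (continuous_geodesic g p))
    rw [closure_Ioo h0.ne] at h1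
    exact h1 ⟨h0.le, le_rfl⟩
  · exact geodesic_mem_of_lt_exitTime h0 ht

theorem frequently_notMem (H : IsConvexNonTrapping g M) (hp : p.1 ∈ M) (hE : 0 < g.inner p.1 p.2 p.2) :
    ∃ᶠ t in 𝓝[>] exitTime g M p, geodesic g p t ∉ M := by
  rw [frequently_nhdsWithin_iff, frequently_iff]
  intro U hU
  obtain ⟨s, hs, hsU⟩ := exists_Ico_subset_of_mem_nhds hU (exists_gt _)
  obtain ⟨t, ht, hm⟩ := exists_notMem_of_exitTime_lt (H.travelTime_lt_top hp hE) hs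
  have hlt : exitTime g M p < t := by
    by_contra h
    exact hm (H.geodesic_mem_of_le_exitTime hp ht.1.le (not_lt.1 h))
  exact ⟨t, hsU ⟨hlt.le, ht.2⟩, hm, hlt⟩

/-- At an interior point the geodesic would remain in M for a while, whereas it is outside M at
times arbitrarily close after the exit time. -/
theorem scatter_mem_frontier (H : IsConvexNonTrapping g M) (hp : p.1 ∈ M) (hE : 0 < g.inner p.1 p.2 p.2) :
    (scatter g M p).1 ∈ frontier M := by
  have h1 : geodesic g p (exitTime g M p) ∈ M :=
    H.geodesic_mem_of_le_exitTime hp (exitTime_nonneg _ _ _) le_rfl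
  refine ⟨subset_closure h1, fun hi => ?_⟩
  have h2 : ∀ᶠ t in 𝓝 (exitTime g M p), geodesic g p t ∈ M := by
    filter_upwards [(continuous_geodesic g p).continuousAt.preimage_mem_nhds
      (isOpen_interior.mem_nhds hi)] with t ht using
      interior_subset (show geodesic g p t ∈ interior M from ht)
  obtain ⟨t, h3, h4⟩ := ((H.frequently_notMem hp hE).and_eventually
    (h2.filter_mono nhdsWithin_le_nhds)).exists
  exact h3 h4

/-- First-order behaviour settles outward vectors and convexity settles tangential ones; no case
distinction is needed afterwards. -/
theorem eventually_notMem_of_nonneg (H : IsConvexNonTrapping g M) {t₀ : ℝ} (hfr : geodesic g p t₀ ∈ frontier M)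
    (hE : 0 < g.inner p.1 p.2 p.2)
    (h : 0 ≤ g.inner (geodesicFlow g t₀ p).1 (outerNormal g M (geodesicFlow g t₀ p).1)
      (geodesicFlow g t₀ p).2) : ∀ᶠ t in 𝓝[>] t₀, geodesic g p t ∉ M := by
  obtain ⟨e, he, hx⟩ := H.smooth.2 _ hfr
  have h1 : normalCoord e (geodesicFlow g t₀ p) ≤ 0 :=
    not_lt.1 fun h2 => absurd ((inner_outerNormal_neg_iff (p := geodesicFlow g t₀ p)
      H.smooth he hx hfr).2 h2) (not_lt.2 h)
  rcases h1.eq_or_lt with h1 | h1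
  · exact (eventually_notMem_of_tangential H.smooth H.convex he hx hfr h1 hE).filter_mono
      (nhdsWithin_mono _ fun s (hs : t₀ < s) => hs.ne')
  · exact eventually_of_outward H.smooth he hx hfr h1

theorem eventually_notMem_of_nonpos (H : IsConvexNonTrapping g M) {t₀ : ℝ} (hfr : geodesic g p t₀ ∈ frontier M)
    (hE : 0 < g.inner p.1 p.2 p.2)
    (h : g.inner (geodesicFlow g t₀ p).1 (outerNormal g M (geodesicFlow g t₀ p).1)
      (geodesicFlow g t₀ p).2 ≤ 0) : ∀ᶠ t in 𝓝[<] t₀, geodesic g p t ∉ M := by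
  obtain ⟨e, he, hx⟩ := H.smooth.2 _ hfr
  have h1 : 0 ≤ normalCoord e (geodesicFlow g t₀ p) :=
    not_lt.1 fun h2 => absurd ((inner_outerNormal_pos_iff (p := geodesicFlow g t₀ p)
      H.smooth he hx hfr).2 h2) (not_lt.2 h)
  rcases h1.eq_or_lt with h1 | h1
  · exact (eventually_notMem_of_tangential H.smooth H.convex he hx hfr h1.symm hE).filter_mono
      (nhdsWithin_mono _ fun s (hs : s < t₀) => hs.ne)
  · exact (eventually_of_inward H.smooth he hx hfr h1).2

theorem eventually_mem_interior (H : IsConvexNonTrapping g M) {t₀ : ℝ} (h : geodesicFlow g t₀ p ∈ strictInward g M) :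
    ∀ᶠ t in 𝓝[>] t₀, geodesic g p t ∈ interior M := by
  obtain ⟨e, he, hx⟩ := H.smooth.2 _ h.1
  exact (eventually_of_inward H.smooth he hx h.1
    ((inner_outerNormal_neg_iff (p := geodesicFlow g t₀ p) H.smooth he hx h.1).1 h.2)).1

theorem exitTime_eq_zero (H : IsConvexNonTrapping g M) (hp : p.1 ∈ frontier M) (hE : 0 < g.inner p.1 p.2 p.2)
    (h : 0 ≤ g.inner p.1 (outerNormal g M p.1) p.2) : exitTime g M p = 0 := by
  refine exitTime_eq (fun t ht => absurd ht.1 (not_lt.2 ht.2.le)) fun s hs => ?_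
  have h1 := H.eventually_notMem_of_nonneg (p := p) (t₀ := 0) (by rwa [geodesic_zero]) hE
    (by rwa [geodesicFlow_zero])
  obtain ⟨t, ht, ht'⟩ := (h1.and (Ioo_mem_nhdsGT hs)).exists
  exact ⟨t, ht', ht⟩

theorem exitTime_pos (H : IsConvexNonTrapping g M) (h : p ∈ strictInward g M) : 0 < exitTime g M p := by
  have h1 := H.eventually_mem_interior (t₀ := 0) (p := p) (by rwa [geodesicFlow_zero])
  refine (exitTime_nonneg _ _ _).lt_of_ne fun h0 => ?_
  have h2 := H.frequently_notMem (H.frontier_subset h.1) (energy_pos_of_strictInward h)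
  rw [← h0] at h2
  obtain ⟨t, h3, h4⟩ := (h2.and_eventually h1).exists
  exact h3 (interior_subset h4)

/-- If the exit velocity were inward or tangential, the geodesic would already have been outside M
just before the exit. This transversality is what makes the exit time differentiable. -/
theorem scatter_mem_strictOutward (H : IsConvexNonTrapping g M) (hp : p.1 ∈ M) (hE : 0 < g.inner p.1 p.2 p.2)
    (h : 0 < exitTime g M p) : scatter g M p ∈ strictOutward g M := by
  refine ⟨H.scatter_mem_frontier hp hE, not_le.1 fun hle => ?_⟩
  have h1 := H.eventually_notMem_of_nonpos (H.scatter_mem_frontier hp hE) hE hle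
  obtain ⟨t, h2, h3⟩ := (h1.and (Ioo_mem_nhdsLT h)).exists
  exact h2 (geodesic_mem_of_lt_exitTime h3.1 h3.2)

/-- A contact with the boundary before the exit time would put the geodesic outside M just before or
just after the contact. -/
theorem geodesic_mem_interior (H : IsConvexNonTrapping g M) (hE : 0 < g.inner p.1 p.2 p.2) {t : ℝ}
    (ht : t ∈ Ioo 0 (exitTime g M p)) : geodesic g p t ∈ interior M := by
  by_contra hi
  have hm := geodesic_mem_of_lt_exitTime ht.1 ht.2
  have hfr : geodesic g p t ∈ frontier M := ⟨subset_closure hm, hi⟩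
  rcases le_total 0 (g.inner (geodesicFlow g t p).1 (outerNormal g M (geodesicFlow g t p).1)
      (geodesicFlow g t p).2) with h | h
  · obtain ⟨s, h2, h3⟩ := ((H.eventually_notMem_of_nonneg hfr hE h).and
      (Ioo_mem_nhdsGT ht.2)).exists
    exact h2 (geodesic_mem_of_lt_exitTime (ht.1.trans h3.1) h3.2)
  · obtain ⟨s, h2, h3⟩ := ((H.eventually_notMem_of_nonpos hfr hE h).and
      (Ioo_mem_nhdsLT ht.1)).exists
    exact h2 (geodesic_mem_of_lt_exitTime h3.1 (h3.2.trans ht.2))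

theorem scatter_strictInward (H : IsConvexNonTrapping g M) (h : p ∈ strictInward g M) : scatter g M p ∈ strictOutward g M :=
  H.scatter_mem_strictOutward (H.frontier_subset h.1) (energy_pos_of_strictInward h)
    (H.exitTime_pos h)

/-- Travelling back along a geodesic. -/
theorem scatter_reverse_scatter (H : IsConvexNonTrapping g M) (h : p ∈ strictInward g M) :
    scatter g M (reverse (scatter g M p)) = reverse p := by
  have hE := energy_pos_of_strictInward h
  set τ := exitTime g M p
  have hτ : 0 < τ := H.exitTime_pos h
  have hflow : ∀ t, geodesicFlow g t (reverse (scatter g M p)) = reverse (geodesicFlow g (τ - t) p) := by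
    intro t
    rw [geodesicFlow_reverse, scatter, geodesicFlow_geodesicFlow, neg_add_eq_sub]
  have hgeo : ∀ t, geodesic g (reverse (scatter g M p)) t = geodesic g p (τ - t) := fun t => by
    rw [← geodesicFlow_fst, hflow]
    rfl
  have h1 : exitTime g M (reverse (scatter g M p)) = τ := by
    refine exitTime_eq (fun t ht => ?_) fun s hs => ?_
    · rw [hgeo]
      exact geodesic_mem_of_lt_exitTime (by linarith [ht.2]) (by linarith [ht.1])
    -- Just before time 0 the original geodesic is outside M, so the reversed one leaves immediately
    -- after time τ.
    · have h2 := H.eventually_notMem_of_nonpos (p := p) (t₀ := 0)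
        (by rw [geodesic_zero]; exact h.1) hE (by rw [geodesicFlow_zero]; exact h.2.le)
      obtain ⟨r, h3, h4⟩ := (h2.and (Ioo_mem_nhdsLT (show τ - s < 0 by linarith))).exists
      refine ⟨τ - r, ⟨by linarith [h4.2], by linarith [h4.1]⟩, ?_⟩
      rwa [hgeo, sub_sub_cancel]
  rw [scatter, h1, hflow, sub_self, geodesicFlow_zero]

/-- The travel time is continuous at strictly inward pointing vectors. -/
theorem continuousWithinAt_exitTime (H : IsConvexNonTrapping g M) (h : p ∈ strictInward g M) :
    ContinuousWithinAt (exitTime g M) {q | q.1 ∈ frontier M} p := by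
  have hE := energy_pos_of_strictInward h
  have hpM := H.frontier_subset h.1
  have hE' : ∀ᶠ q : TangentBundle (𝓡 (d + 1)) N in 𝓝 p, 0 < g.inner q.1 q.2 q.2 :=
    (continuous_energy g).continuousAt.eventually (lt_mem_nhds hE)
  rw [ContinuousWithinAt, tendsto_order]
  refine ⟨fun s hs => ?_, fun s hs => ?_⟩
  · have hpos := H.exitTime_pos h
    obtain ⟨s', hs', hs'τ⟩ := exists_between (max_lt hs hpos)
    have hs's : s < s' := (le_max_left _ _).trans_lt hs'
    have hs'0 : 0 < s' := (le_max_right _ _).trans_lt hs'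
    have hcont := continuous_geodesicFlow g
    -- Lower semicontinuity, by compactness of [0, s']. At positive times the geodesic is in the
    -- interior, an open condition. Near time 0 the transversal velocity stays positive, so the
    -- transversal coordinate grows from its value 0 on the boundary.
    have key : ∀ t ∈ Icc 0 s', ∀ᶠ z : TangentBundle (𝓡 (d + 1)) N × ℝ in 𝓝 (p, t),
        z.1.1 ∈ frontier M → 0 < z.2 → geodesic g z.1 z.2 ∈ M := by
      intro t ht
      rcases ht.1.eq_or_lt with rfl | h0
      · obtain ⟨e, he, hx⟩ := H.smooth.2 _ h.1
        have hn : ∀ᶠ z : TangentBundle (𝓡 (d + 1)) N × ℝ in 𝓝 (p, 0),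
            geodesicFlow g z.2 z.1 ∈ overSource e ∩ normalCoord e ⁻¹' Ioi 0 :=
          hcont.continuousAt.preimage_mem_nhds (((continuousOn_normalCoord he.1).isOpen_inter_preimage
            isOpen_overSource isOpen_Ioi).mem_nhds (by
              rw [geodesicFlow_zero]
              exact ⟨hx, (inner_outerNormal_neg_iff H.smooth he hx h.1).1 h.2⟩))
        rw [nhds_prod_eq] at hn ⊢
        obtain ⟨P, hP, Q, hQ, hPQ⟩ := eventually_prod_iff.1 hn
        obtain ⟨ε, hε, hball⟩ := Metric.eventually_nhds_iff_ball.1 hQ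
        rw [Real.ball_eq_Ioo, zero_sub, zero_add] at hball
        refine eventually_prod_iff.2 ⟨P, hP, fun t => t ∈ Ioo (-ε) ε, Ioo_mem_nhds (by linarith) hε,
          fun {q} hq {t} ht hfr h0 => ?_⟩
        have hin : ∀ r ∈ Ioo (-ε) ε, geodesicFlow g r q ∈ overSource e ∩ normalCoord e ⁻¹' Ioi 0 :=
          fun r hr => hPQ hq (hball r hr)
        have hd : ∀ r ∈ Ioo (-ε) ε, HasDerivAt (fun r => e (geodesic g q r) 0)
            (normalCoord e (geodesicFlow g r q)) r := fun r hr =>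
          hasDerivAt_normal_geodesic he.1 (hin r hr).1
        obtain ⟨c, hc, hc'⟩ := exists_hasDerivAt_eq_slope (fun r => e (geodesic g q r) 0)
          (fun r => normalCoord e (geodesicFlow g r q)) h0
          (fun r hr => (hd r ⟨by linarith [hr.1], by linarith [hr.2, ht.2]⟩).continuousAt.continuousWithinAt)
          (fun r hr => hd r ⟨by linarith [hr.1], by linarith [hr.2, ht.2]⟩)
        have h1 := (hin c ⟨by linarith [hc.1], by linarith [hc.2, ht.2]⟩).2
        have h2 : q.1 ∈ e.source := by
          have := (hin 0 ⟨by linarith, hε⟩).1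
          rwa [geodesicFlow_zero] at this
        have h3 : e (geodesic g q 0) 0 = 0 := by
          rw [geodesic_zero]
          exact (he.mem_frontier_iff H.smooth.1 h2).1 hfr
        rw [mem_preimage, hc', h3, sub_zero, sub_zero, mem_Ioi, lt_div_iff₀ h0, zero_mul] at h1
        exact (he.2 _ (hin t ht).1).2 h1.le
      · have hi := H.geodesic_mem_interior hE ⟨h0, ht.2.trans_lt hs'τ⟩
        filter_upwards [(continuous_base.comp hcont).continuousAt.preimage_mem_nhds
          (isOpen_interior.mem_nhds hi)] with z hz _ _ using interior_subset hz
    have hev := isCompact_Icc.eventually_forall_of_forall_eventually (x₀ := p)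
      (P := fun q t => q.1 ∈ frontier M → 0 < t → geodesic g q t ∈ M) key
    filter_upwards [hev.filter_mono nhdsWithin_le_nhds, self_mem_nhdsWithin,
      hE'.filter_mono nhdsWithin_le_nhds] with q hq hfr hEq
    refine hs's.trans_le (not_lt.1 fun hlt => ?_)
    obtain ⟨t, ht, hm⟩ := exists_notMem_of_exitTime_lt
      (H.travelTime_lt_top (H.frontier_subset hfr) hEq) hlt
    exact hm (hq t ⟨ht.1.le, ht.2.le⟩ hfr ht.1)
  -- Upper semicontinuity, from openness of the sublevel sets of the travel time.
  · have hs0 : 0 < s := (exitTime_nonneg _ _ _).trans_lt hs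
    have h1 : travelTime g M p < ENNReal.ofReal s :=
      (ENNReal.lt_ofReal_iff_toReal_lt (H.travelTime_lt_top hpM hE).ne).2 hs
    filter_upwards [nhdsWithin_le_nhds ((isOpen_travelTime_lt g H.smooth.1 _).mem_nhds h1)] with q hq
    exact (ENNReal.lt_ofReal_iff_toReal_lt (hq.trans ENNReal.ofReal_lt_top).ne).1 hq

end IsConvexNonTrapping

end

/-! ### Measures on spheres -/

section

variable {d : ℕ} {N : Type*} [TopologicalSpace N]
  [ChartedSpace (EuclideanSpace ℝ (Fin (d + 1))) N] [IsManifold (𝓡 (d + 1)) ∞ N]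
  {g : SmoothMetric d N} {e e' : OpenPartialHomeomorph N (EuclideanSpace ℝ (Fin (d + 1)))}
  {M : Set N} {x : N} {p : TangentBundle (𝓡 (d + 1)) N}

/-- Chart expressions are continuous on their domain and arbitrary elsewhere; cutting off by the
indicator yields functions measurable everywhere. -/
theorem measurable_indicator_comp {X Y : Type*} [TopologicalSpace X] [MeasurableSpace X]
    [BorelSpace X] [TopologicalSpace Y] [MeasurableSpace Y] [BorelSpace Y] {s : Set X}
    (hs : MeasurableSet s) {f : X → Y} (hf : ContinuousOn f s) {h : Y → ℝ≥0∞} (hh : Measurable h) :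
    Measurable (s.indicator fun x => h (f x)) := by
  refine measurable_of_restrict_of_restrict_compl hs ?_ ?_
  · have : s.domRestrict (s.indicator fun x => h (f x)) = h ∘ s.domRestrict f :=
      funext fun x => by simp [domRestrict]
    rw [this]
    exact hh.comp hf.domRestrict.measurable
  · have : sᶜ.domRestrict (s.indicator fun x => h (f x)) = 0 :=
      funext fun x => by simpa [domRestrict] using fun h => absurd h x.2
    rw [this]
    exact measurable_zero

/-- Measurability is local: compactness reduces to finitely many open sets. -/
theorem measurable_of_forall_indicator {X : Type*} [TopologicalSpace X] [CompactSpace X]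
    [MeasurableSpace X] [BorelSpace X] {f : X → ℝ≥0∞}
    (h : ∀ x, ∃ U, IsOpen U ∧ x ∈ U ∧ Measurable (U.indicator f)) : Measurable f := by
  choose U hU hx hf using h
  obtain ⟨t, ht⟩ := isCompact_univ.elim_finite_subcover U hU fun x _ => mem_iUnion.2 ⟨x, hx x⟩
  intro s hs
  have : f ⁻¹' s = ⋃ i ∈ t, U i ∩ (U i).indicator f ⁻¹' s := by
    ext x
    simp only [mem_preimage, mem_iUnion, mem_inter_iff, exists_prop]
    constructor
    · intro hxs
      obtain ⟨i, hi, hxi⟩ := mem_iUnion₂.1 (ht (mem_univ x))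
      exact ⟨i, hi, hxi, by rwa [indicator_of_mem hxi]⟩
    · rintro ⟨i, -, hxi, h⟩
      rwa [indicator_of_mem hxi] at h
  rw [this]
  exact Finset.measurableSet_biUnion _ fun i _ => (hU i).measurableSet.inter (hf i hs)

/-! ### Gram determinants -/

/-- The Gram determinant of the metric in a chart. -/
def gramDet (g : SmoothMetric d N) (e : OpenPartialHomeomorph N (EuclideanSpace ℝ (Fin (d + 1))))
    (y : Coord d) : ℝ :=
  Matrix.det (Matrix.of fun i j : Fin (d + 1) =>
    chartMetric g e y (EuclideanSpace.single i 1) (EuclideanSpace.single j 1))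

/-- The Gram determinant of the metric in a chart on the hyperplane `y 0 = 0`. -/
def boundaryGramDet (g : SmoothMetric d N)
    (e : OpenPartialHomeomorph N (EuclideanSpace ℝ (Fin (d + 1)))) (y : Coord d) : ℝ :=
  Matrix.det (Matrix.of fun i j : Fin d =>
    chartMetric g e y (EuclideanSpace.single i.succ 1) (EuclideanSpace.single j.succ 1))

theorem continuousOn_gramDet (g : SmoothMetric d N) (he : e ∈ smoothCharts d N) :
    ContinuousOn (gramDet g e) e.target :=
  Continuous.comp_continuousOn (g := fun A : Matrix (Fin (d + 1)) (Fin (d + 1)) ℝ => A.det)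
    (Continuous.matrix_det continuous_id) (continuousOn_pi.2 fun _ => continuousOn_pi.2 fun _ =>
      (contDiffOn_chartMetric g he _ _).continuousOn)

theorem continuousOn_boundaryGramDet (g : SmoothMetric d N) (he : e ∈ smoothCharts d N) :
    ContinuousOn (boundaryGramDet g e) e.target :=
  Continuous.comp_continuousOn (g := fun A : Matrix (Fin d) (Fin d) ℝ => A.det)
    (Continuous.matrix_det continuous_id) (continuousOn_pi.2 fun _ => continuousOn_pi.2 fun _ =>
      (contDiffOn_chartMetric g he _ _).continuousOn)

/-- A form given by a family of continuous bilinear forms, as a bilinear form. -/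
def toBilin (B : Coord d →L[ℝ] Coord d →L[ℝ] ℝ) : LinearMap.BilinForm ℝ (Coord d) :=
  (ContinuousLinearMap.coeLM ℝ).comp B.toLinearMap

theorem toBilin_apply (B : Coord d →L[ℝ] Coord d →L[ℝ] ℝ) (u w : Coord d) :
    toBilin B u w = B u w := rfl

theorem basisFun_toBasis_apply {n : ℕ} (i : Fin n) :
    (EuclideanSpace.basisFun (Fin n) ℝ).toBasis i = EuclideanSpace.single i 1 := by simp

/-- The Gram determinant is the Jacobian of v ↦ ξ = Gv, which turns integrals over velocities into
integrals over momenta. -/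
theorem gramDet_eq_det (g : SmoothMetric d N)
    (e : OpenPartialHomeomorph N (EuclideanSpace ℝ (Fin (d + 1)))) (y : Coord d) :
    gramDet g e y = LinearMap.det (metricOp (chartForm g e) y).toLinearMap := by
  rw [← LinearMap.det_toMatrix (EuclideanSpace.basisFun (Fin (d + 1)) ℝ).toBasis, gramDet]
  congr 1
  ext i j
  rw [LinearMap.toMatrix_apply, Matrix.of_apply, chartMetric_symm, ← chartForm_apply,
    ← inner_metricOp, real_inner_comm]
  simp [EuclideanSpace.inner_single_left]

theorem gramDet_pos (g : SmoothMetric d N) (he : e ∈ smoothCharts d N) {y : Coord d}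
    (hy : y ∈ e.target) : 0 < gramDet g e y := by
  have hpd : (Matrix.of fun i j : Fin (d + 1) =>
    chartMetric g e y (EuclideanSpace.single i 1) (EuclideanSpace.single j 1)).PosDef := by
    refine Matrix.PosDef.of_dotProduct_mulVec_pos ?_ fun v hv => ?_
    · ext i j
      simp [chartMetric_symm g y (EuclideanSpace.single j 1)]
    · set u : Coord d := WithLp.toLp 2 v
      have hu : u = ∑ i, v i • (EuclideanSpace.single i 1 : Coord d) := by
        ext j
        simp [u, Finset.sum_apply, Pi.single_apply]
      have h1 := chartMetric_pos g he hy (u := u) (by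
        intro h
        exact hv (by simpa [u] using h))
      rw [← chartForm_apply, hu] at h1
      simp only [map_sum, map_smul, sum_apply, smul_apply, smul_eq_mul, chartForm_apply] at h1
      simp only [dotProduct, Matrix.mulVec, Matrix.of_apply, star_trivial, Finset.mul_sum]
      refine h1.trans_eq ?_
      refine Finset.sum_congr rfl fun i _ => ?_
      rw [Finset.mul_sum]
      exact Finset.sum_congr rfl fun j _ => by rw [chartMetric_symm]; ring
  exact hpd.det_pos

/-- The fibre volume is written in the reference coordinates of the tangent space; T compares them
with the coordinates of the chart e. -/
theorem gram_fiber (g : SmoothMetric d N) (he : e ∈ smoothCharts d N) (hx : x ∈ e.source)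
    {T : Coord d →L[ℝ] Coord d} (hT : ∀ v : TangentSpace (𝓡 (d + 1)) x, T v = chartVector e x v) :
    Matrix.det (Matrix.of fun i j : Fin (d + 1) =>
      g.inner x (EuclideanSpace.single i 1 : Coord d) (EuclideanSpace.single j 1 : Coord d))
      = LinearMap.det T.toLinearMap ^ 2 * gramDet g e (e x) := by
  have h := det_gram_comp (EuclideanSpace.basisFun (Fin (d + 1)) ℝ).toBasis
    (toBilin (chartForm g e (e x))) T.toLinearMap
  simp only [basisFun_toBasis_apply, toBilin_apply, chartForm_apply] at h
  rw [gramDet, ← h]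
  congr 1
  ext i j
  exact ((congrArg₂ (chartMetric g e (e x)) (hT _) (hT _)).trans
    (chartMetric_chartVector g he hx _ _)).symm

/-! ### The measures of the unit spheres -/

/-- The unit vector in the direction of a tangent vector. -/
def unitize (g : SmoothMetric d N) (p : TangentBundle (𝓡 (d + 1)) N) :
    TangentBundle (𝓡 (d + 1)) N := bscale (Real.sqrt (g.inner p.1 p.2 p.2))⁻¹ p

theorem measurable_unitize (g : SmoothMetric d N) : Measurable (unitize g) :=
  (continuous_bscale g).measurable.comp
    ((continuous_energy g).measurable.sqrt.inv.prodMk measurable_id)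

theorem det_chartVector_ne_zero (he : e ∈ smoothCharts d N)
    (hx : x ∈ e.source) {T : Coord d →L[ℝ] Coord d}
    (hT : ∀ v : TangentSpace (𝓡 (d + 1)) x, T v = chartVector e x v) :
    LinearMap.det T.toLinearMap ≠ 0 := by
  have hinj : Function.Injective T := by
    intro v w hvw
    have h1 := mfderiv_symm_chartVector he hx v
    have h2 := mfderiv_symm_chartVector he hx w
    exact h1.symm.trans ((congrArg (mfderiv (𝓡 (d + 1)) (𝓡 (d + 1)) e.symm (e x))
      ((hT v).symm.trans (hvw.trans (hT w)))).trans h2)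
  exact (LinearMap.isUnit_iff_ker_eq_bot T.toLinearMap |>.2 (LinearMap.ker_eq_bot.2 hinj)).map
    LinearMap.det |>.ne_zero

/-- The volume density is |det T|√det g, and the substitution ξ = GTv divides by |det T| det g. What
remains is 1/√det g, independently of the reference coordinates. -/
theorem lintegral_sphereMeasure (g : SmoothMetric d N) (he : e ∈ smoothCharts d N)
    (hx : x ∈ e.source) {F : TangentBundle (𝓡 (d + 1)) N → ℝ≥0∞} (hF : Measurable F) :
    ∫⁻ q, F q ∂(sphereMeasure g x) = ((d + 1 : ℕ) : ℝ≥0∞) *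
      (ENNReal.ofReal (Real.sqrt (gramDet g e (e x)))⁻¹ *
      ∫⁻ ξ : Coord d, {p | 0 < g.inner p.1 p.2 p.2 ∧ g.inner p.1 p.2 p.2 < 1}.indicator
        (fun p => F (unitize g p)) (cotChartInv g e (e x, ξ))) := by
  have hm := isMetricOn_chartForm g he
  set S : Set (TangentBundle (𝓡 (d + 1)) N) :=
    {p | 0 < g.inner p.1 p.2 p.2 ∧ g.inner p.1 p.2 p.2 < 1}
  have hS : MeasurableSet S :=
    ((isOpen_lt continuous_const (continuous_energy g)).inter
      (isOpen_lt (continuous_energy g) continuous_const)).measurableSet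
  set h : TangentBundle (𝓡 (d + 1)) N → ℝ≥0∞ := S.indicator fun p => F (unitize g p)
  have hh : Measurable h := (hF.comp (measurable_unitize g)).indicator hS
  set T : Coord d →L[ℝ] Coord d := mfderiv (𝓡 (d + 1)) (𝓡 (d + 1)) e x
  have hT : ∀ v : TangentSpace (𝓡 (d + 1)) x, T v = chartVector e x v := fun v => rfl
  set G := metricOp (chartForm g e) (e x)
  have hι : Continuous fun v : Coord d => (⟨x, v⟩ : TangentBundle (𝓡 (d + 1)) N) :=
    FiberBundle.continuous_totalSpaceMk (Coord d) (TangentSpace (𝓡 (d + 1)) : N → Type _) x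
  have hk : ∀ v : Coord d, (⟨x, v⟩ : TangentBundle (𝓡 (d + 1)) N)
      = cotChartInv g e (e x, (G.comp T) v) := fun v =>
    (cotChartInv_cotChart g he (p := ⟨x, v⟩) hx).symm
  have hdT := det_chartVector_ne_zero he hx hT
  have hpos := gramDet_pos g he (e.map_source hx)
  have hdet : LinearMap.det (G.comp T).toLinearMap
      = gramDet g e (e x) * LinearMap.det T.toLinearMap := by
    rw [gramDet_eq_det, ← map_mul]
    rfl
  have hdL : LinearMap.det (G.comp T).toLinearMap ≠ 0 := by
    rw [hdet]; exact mul_ne_zero hpos.ne' hdT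
  have hcont : Continuous fun ξ : Coord d => cotChartInv g e (e x, ξ) := by
    refine ContinuousOn.comp_continuous (continuousOn_cotChartInv g he) (by fun_prop) fun ξ =>
      ⟨e.map_source hx, mem_univ _⟩
  have h1 : ∫⁻ v : Coord d, h ⟨x, v⟩ = ENNReal.ofReal |(LinearMap.det (G.comp T).toLinearMap)⁻¹| *
      ∫⁻ ξ : Coord d, h (cotChartInv g e (e x, ξ)) := by
    have h2 := Measure.map_linearMap_addHaar_eq_smul_addHaar (volume : Measure (Coord d)) hdL
    have h3 : ∫⁻ ξ, h (cotChartInv g e (e x, ξ))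
        ∂(Measure.map (G.comp T).toLinearMap (volume : Measure (Coord d)))
        = ∫⁻ v : Coord d, h (cotChartInv g e (e x, (G.comp T) v)) :=
      lintegral_map (hh.comp hcont.measurable) (G.comp T).continuous.measurable
    rw [← smul_eq_mul, ← lintegral_smul_measure, ← h2, h3]
    exact lintegral_congr fun v => congrArg h (hk v)
  rw [sphereMeasure, lintegral_smul_measure, smul_eq_mul]
  congr 1
  have hmeas : Measurable fun v : Coord d =>
      (⟨x, (Real.sqrt (g.inner x v v))⁻¹ • v⟩ : TangentBundle (𝓡 (d + 1)) N) :=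
    (measurable_unitize g).comp hι.measurable
  rw [lintegral_map hF hmeas]
  refine (lintegral_indicator (hS.preimage hι.measurable) _).symm.trans ?_
  rw [fiberVolume, lintegral_smul_measure, smul_eq_mul]
  have h3 : ∀ v : Coord d, ((fun v : Coord d => (⟨x, v⟩ : TangentBundle (𝓡 (d + 1)) N)) ⁻¹' S).indicator
      (fun v : Coord d => F ⟨x, (Real.sqrt (g.inner x v v))⁻¹ • v⟩) v = h ⟨x, v⟩ := fun v => rfl
  rw [lintegral_congr h3, h1, ← mul_assoc, ← ENNReal.ofReal_mul (Real.sqrt_nonneg _)]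
  congr 2
  rw [gram_fiber g he hx hT, hdet, Real.sqrt_mul (sq_nonneg _), Real.sqrt_sq_eq_abs, abs_inv, abs_mul,
    abs_of_pos hpos]
  have h4 := Real.mul_self_sqrt hpos.le
  have h5 : 0 < |LinearMap.det T.toLinearMap| := abs_pos.2 hdT
  have h6 := Real.sqrt_pos.2 hpos
  nth_rewrite 2 [← h4]
  field_simp

/-- Measurable dependence on the base point is what allows integration against `Measure.bind` as an
iterated integral. Locally it follows from the formula in momentum coordinates. -/
theorem measurable_sphereMeasure [CompactSpace N] [MeasurableSpace N] [BorelSpace N]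
    (g : SmoothMetric d N) : Measurable (sphereMeasure g) := by
  refine Measure.measurable_of_measurable_coe _ fun A hA => ?_
  refine measurable_of_forall_indicator fun x => ?_
  obtain ⟨e, he, hx⟩ := exists_smoothChart d x
  have hm := isMetricOn_chartForm g he
  refine ⟨e.source, e.open_source, hx, ?_⟩
  set S : Set (TangentBundle (𝓡 (d + 1)) N) :=
    {p | 0 < g.inner p.1 p.2 p.2 ∧ g.inner p.1 p.2 p.2 < 1}
  have hS : MeasurableSet S :=
    ((isOpen_lt continuous_const (continuous_energy g)).inter
      (isOpen_lt (continuous_energy g) continuous_const)).measurableSet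
  have hF : Measurable (A.indicator (1 : TangentBundle (𝓡 (d + 1)) N → ℝ≥0∞)) :=
    measurable_one.indicator hA
  set h : TangentBundle (𝓡 (d + 1)) N → ℝ≥0∞ :=
    S.indicator fun p => A.indicator (1 : TangentBundle (𝓡 (d + 1)) N → ℝ≥0∞) (unitize g p)
  have hh : Measurable h := (hF.comp (measurable_unitize g)).indicator hS
  have hK : Measurable ((e.target ×ˢ (univ : Set (Coord d))).indicator
      fun z => h (cotChartInv g e z)) :=
    measurable_indicator_comp hm.isOpen_prod.measurableSet (continuousOn_cotChartInv g he) hh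
  have hI := hK.lintegral_prod_right' (ν := (volume : Measure (Coord d)))
  have hG : Measurable (e.target.indicator fun y =>
      ENNReal.ofReal (Real.sqrt (gramDet g e y))⁻¹) :=
    measurable_indicator_comp e.open_target.measurableSet (continuousOn_gramDet g he)
      (h := fun r => ENNReal.ofReal (Real.sqrt r)⁻¹)
      (ENNReal.measurable_ofReal.comp (Real.continuous_sqrt.measurable.inv))
  have hΦ := measurable_indicator_comp e.open_source.measurableSet e.continuousOn
    ((hG.mul hI).const_mul ((d + 1 : ℕ) : ℝ≥0∞))
  convert hΦ using 1
  refine indicator_congr fun z hz => ?_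
  rw [← lintegral_indicator_one hA, lintegral_sphereMeasure g he hz hF]
  simp only [Pi.mul_apply, indicator_of_mem (e.map_source hz)]
  congr 2
  refine lintegral_congr fun ξ => ?_
  rw [indicator_of_mem (show (e z, ξ) ∈ e.target ×ˢ univ from ⟨e.map_source hz, mem_univ _⟩)]

end

/-! ### The boundary measure in charts -/

section

variable {d : ℕ} {N : Type*} [TopologicalSpace N]
  [ChartedSpace (EuclideanSpace ℝ (Fin (d + 1))) N] [IsManifold (𝓡 (d + 1)) ∞ N]
  {g : SmoothMetric d N} {e e' : OpenPartialHomeomorph N (EuclideanSpace ℝ (Fin (d + 1)))}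
  {M : Set N} {x : N} {p : TangentBundle (𝓡 (d + 1)) N}

/-- `zeroCons` as a continuous linear map. -/
def zeroConsL (d : ℕ) : EuclideanSpace ℝ (Fin d) →L[ℝ] Coord d :=
  LinearMap.toContinuousLinearMap
    { toFun := zeroCons
      map_add' := fun y z => by
        ext i
        refine Fin.cases ?_ (fun j => ?_) i <;> simp [zeroCons]
      map_smul' := fun c y => by
        ext i
        refine Fin.cases ?_ (fun j => ?_) i <;> simp [zeroCons] }

theorem zeroConsL_apply (y : EuclideanSpace ℝ (Fin d)) : zeroConsL d y = zeroCons y := rfl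

/-- Forgetting the first coordinate. -/
def tailL (d : ℕ) : Coord d →L[ℝ] EuclideanSpace ℝ (Fin d) :=
  LinearMap.toContinuousLinearMap
    { toFun := fun y => WithLp.toLp 2 fun i => y i.succ
      map_add' := fun y z => by ext i; simp
      map_smul' := fun c y => by ext i; simp }

theorem tailL_apply (y : Coord d) (i : Fin d) : tailL d y i = y i.succ := rfl

@[simp] theorem zeroCons_zero_coord (y : EuclideanSpace ℝ (Fin d)) : zeroCons y 0 = 0 := rfl

@[simp] theorem tailL_zeroCons (y : EuclideanSpace ℝ (Fin d)) : tailL d (zeroCons y) = y := by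
  ext i
  simp [tailL_apply, zeroCons]

theorem zeroCons_tailL {y : Coord d} (hy : y 0 = 0) : zeroCons (tailL d y) = y := by
  ext i
  refine Fin.cases ?_ (fun j => ?_) i
  · simp [hy]
  · simp [zeroCons, tailL_apply]

theorem continuous_zeroCons : Continuous (zeroCons : EuclideanSpace ℝ (Fin d) → Coord d) :=
  (zeroConsL d).continuous

theorem zeroCons_single (i : Fin d) :
    zeroCons (EuclideanSpace.single i 1) = (EuclideanSpace.single i.succ 1 : Coord d) := by
  ext j
  refine Fin.cases ?_ (fun j => ?_) j
  · simp
  · simp [zeroCons, Pi.single_apply]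

/-- The part of the hyperplane `y 0 = 0` in the target of a chart. -/
def boundaryDomain (e : OpenPartialHomeomorph N (EuclideanSpace ℝ (Fin (d + 1)))) :
    Set (EuclideanSpace ℝ (Fin d)) := {y | zeroCons y ∈ e.target}

theorem isOpen_boundaryDomain : IsOpen (boundaryDomain e) :=
  e.open_target.preimage continuous_zeroCons

theorem continuousOn_symm_zeroCons :
    ContinuousOn (fun y => e.symm (zeroCons y)) (boundaryDomain e) :=
  e.continuousOn_symm.comp continuous_zeroCons.continuousOn fun _ hy => hy

theorem IsBoundaryChart.symm_zeroCons_mem_frontier (h : IsBoundaryChart M e) (hM : IsClosed M)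
    {y : EuclideanSpace ℝ (Fin d)} (hy : y ∈ boundaryDomain e) : e.symm (zeroCons y) ∈ frontier M := by
  rw [h.mem_frontier_iff hM (e.map_target hy), e.right_inv hy, zeroCons_zero_coord]

/-- The transition map between boundary charts, on the boundary. -/
def boundaryTransition (e e' : OpenPartialHomeomorph N (EuclideanSpace ℝ (Fin (d + 1))))
    (y : EuclideanSpace ℝ (Fin d)) : EuclideanSpace ℝ (Fin d) :=
  tailL d (e' (e.symm (zeroCons y)))

theorem zeroCons_boundaryTransition (h : IsBoundaryChart M e) (h' : IsBoundaryChart M e')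
    (hM : IsClosed M) {y : EuclideanSpace ℝ (Fin d)} (hy : y ∈ boundaryDomain e)
    (hy' : e.symm (zeroCons y) ∈ e'.source) :
    zeroCons (boundaryTransition e e' y) = e' (e.symm (zeroCons y)) :=
  zeroCons_tailL ((h'.mem_frontier_iff hM hy').1 (h.symm_zeroCons_mem_frontier hM hy))

/-- The derivative of the boundary transition multiplies the Gram determinants by the square of
its determinant. -/
theorem exists_hasFDerivAt_boundaryTransition (g : SmoothMetric d N) (h : IsBoundaryChart M e)
    (h' : IsBoundaryChart M e') (hM : IsClosed M) {y : EuclideanSpace ℝ (Fin d)}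
    (hy : y ∈ boundaryDomain e) (hy' : e.symm (zeroCons y) ∈ e'.source) :
    ∃ D : EuclideanSpace ℝ (Fin d) →L[ℝ] EuclideanSpace ℝ (Fin d),
      HasFDerivAt (boundaryTransition e e') D y ∧
      boundaryGramDet g e (zeroCons y)
        = D.det ^ 2 * boundaryGramDet g e' (e' (e.symm (zeroCons y))) := by
  set L := fderiv ℝ (fun z => e' (e.symm z)) (zeroCons y)
  have hL : HasFDerivAt (fun z => e' (e.symm z)) L (zeroCons y) :=
    ((contDiffAt_transition h.1 h'.1 hy hy').differentiableAt (by simp)).hasFDerivAt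
  have h1 : HasFDerivAt (fun y => e' (e.symm (zeroCons y))) (L.comp (zeroConsL d)) y :=
    HasFDerivAt.comp y (f := zeroConsL d) (g := fun z => e' (e.symm z)) hL (zeroConsL d).hasFDerivAt
  set D := (tailL d).comp (L.comp (zeroConsL d))
  have hD : HasFDerivAt (boundaryTransition e e') D y :=
    (tailL d).hasFDerivAt.comp y h1
  refine ⟨D, hD, ?_⟩
  have h2 : HasFDerivAt (fun y => e' (e.symm (zeroCons y))) ((zeroConsL d).comp D) y := by
    refine ((zeroConsL d).hasFDerivAt.comp y hD).congr_of_eventuallyEq ?_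
    have hn : ∀ᶠ z in 𝓝 y, z ∈ boundaryDomain e ∧ e.symm (zeroCons z) ∈ e'.source :=
      (isOpen_boundaryDomain.eventually_mem hy).and
        ((continuousOn_symm_zeroCons.continuousAt (isOpen_boundaryDomain.mem_nhds hy)).eventually
          (e'.open_source.mem_nhds hy'))
    filter_upwards [hn] with z hz
    exact (zeroCons_boundaryTransition h h' hM hz.1 hz.2).symm
  -- The transition maps the boundary hyperplane to itself, hence so does its derivative, and D is
  -- the restriction.
  have h3 : ∀ a, L (zeroCons a) = zeroCons (D a) := fun a => DFunLike.congr_fun (h1.unique h2) a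
  have h4 := det_gram_comp (EuclideanSpace.basisFun (Fin d) ℝ).toBasis
    ((toBilin (chartForm g e' (e' (e.symm (zeroCons y))))).compl₁₂ (zeroConsL d).toLinearMap
      (zeroConsL d).toLinearMap) D.toLinearMap
  simp only [basisFun_toBasis_apply, LinearMap.compl₁₂_apply, toBilin_apply, chartForm_apply,
    ContinuousLinearMap.coe_coe, zeroConsL_apply, zeroCons_single, ← h3] at h4
  rw [boundaryGramDet, boundaryGramDet]
  refine Eq.trans ?_ h4
  congr 1
  ext i j
  exact (chartMetric_transition g h.1 h'.1 hy hy' _ _).symm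

section Measure

variable [MeasurableSpace N] [BorelSpace N]

theorem lintegral_chartBoundaryVolume (g : SmoothMetric d N) (he : e ∈ smoothCharts d N)
    {F : N → ℝ≥0∞} (hF : Measurable F) :
    ∫⁻ x, F x ∂(chartBoundaryVolume g e) = ∫⁻ y in boundaryDomain e,
      ENNReal.ofReal (Real.sqrt (boundaryGramDet g e (zeroCons y))) * F (e.symm (zeroCons y)) := by
  have hm := (isOpen_boundaryDomain (e := e)).measurableSet
  have h1 : AEMeasurable (fun y => e.symm (zeroCons y))
      ((volume : Measure (EuclideanSpace ℝ (Fin d))).restrict (boundaryDomain e)) :=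
    continuousOn_symm_zeroCons.aemeasurable hm
  have h2 : AEMeasurable (fun y => ENNReal.ofReal (Real.sqrt (boundaryGramDet g e (zeroCons y))))
      ((volume : Measure (EuclideanSpace ℝ (Fin d))).restrict (boundaryDomain e)) := by
    refine ENNReal.measurable_ofReal.comp_aemeasurable
      (Real.continuous_sqrt.measurable.comp_aemeasurable ?_)
    exact ((continuousOn_boundaryGramDet g he).comp continuous_zeroCons.continuousOn
      fun _ hy => hy).aemeasurable hm
  have h3 := lintegral_withDensity_eq_lintegral_mul₀ h2 (hF.comp_aemeasurable h1)
  exact (lintegral_map' hF.aemeasurable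
    (h1.mono_ac (withDensity_absolutelyContinuous _ _))).trans h3

theorem measurableSet_domain_inter {A : Set N} (hA : MeasurableSet A) :
    MeasurableSet (boundaryDomain e ∩ {y | e.symm (zeroCons y) ∈ A}) := by
  have h := measurable_indicator_comp isOpen_boundaryDomain.measurableSet
    (continuousOn_symm_zeroCons (e := e)) (measurable_one.indicator hA (f := (1 : N → ℝ≥0∞)))
  convert h (measurableSet_singleton 1) using 1
  ext y
  by_cases hy : y ∈ boundaryDomain e <;> by_cases hy' : e.symm (zeroCons y) ∈ A <;>
    simp [hy, hy', indicator]

theorem chartBoundaryVolume_apply (g : SmoothMetric d N) (he : e ∈ smoothCharts d N) {A : Set N}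
    (hA : MeasurableSet A) :
    chartBoundaryVolume g e A = ∫⁻ y in boundaryDomain e ∩ {y | e.symm (zeroCons y) ∈ A},
      ENNReal.ofReal (Real.sqrt (boundaryGramDet g e (zeroCons y))) := by
  have h1 := lintegral_chartBoundaryVolume g he (measurable_one.indicator hA (f := 1))
  rw [lintegral_indicator_one hA] at h1
  have hm : MeasurableSet (boundaryDomain e ∩ {y | e.symm (zeroCons y) ∈ A}) :=
    measurableSet_domain_inter hA
  rw [h1, ← lintegral_indicator isOpen_boundaryDomain.measurableSet, ← lintegral_indicator hm]
  refine lintegral_congr fun y => ?_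
  by_cases hy : y ∈ boundaryDomain e <;> by_cases hy' : e.symm (zeroCons y) ∈ A <;>
    simp [hy, hy', indicator]

/-- Change of variables along the boundary transition, whose Jacobian |det D| is the quotient of the
two square roots of Gram determinants. -/
theorem chartBoundaryVolume_eq_of_subset (g : SmoothMetric d N) (h : IsBoundaryChart M e)
    (h' : IsBoundaryChart M e') (hM : IsClosed M) {A : Set N} (hA : MeasurableSet A)
    (hAe : A ⊆ e.source) (hAe' : A ⊆ e'.source) :
    chartBoundaryVolume g e A = chartBoundaryVolume g e' A := by
  rw [chartBoundaryVolume_apply g h.1 hA, chartBoundaryVolume_apply g h'.1 hA]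
  set s := boundaryDomain e ∩ {y | e.symm (zeroCons y) ∈ A}
  have hs : MeasurableSet s := measurableSet_domain_inter hA
  have hD : ∀ y ∈ s, ∃ D : EuclideanSpace ℝ (Fin d) →L[ℝ] EuclideanSpace ℝ (Fin d),
      HasFDerivAt (boundaryTransition e e') D y ∧ boundaryGramDet g e (zeroCons y)
        = D.det ^ 2 * boundaryGramDet g e' (e' (e.symm (zeroCons y))) := fun y hy =>
    exists_hasFDerivAt_boundaryTransition g h h' hM hy.1 (hAe' hy.2)
  choose! D hD hdet using hD
  have hz : ∀ y ∈ s, zeroCons (boundaryTransition e e' y) = e' (e.symm (zeroCons y)) := fun y hy =>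
    zeroCons_boundaryTransition h h' hM hy.1 (hAe' hy.2)
  have hinv : ∀ y ∈ s, e'.symm (zeroCons (boundaryTransition e e' y)) = e.symm (zeroCons y) :=
    fun y hy => by rw [hz y hy, e'.left_inv (hAe' hy.2)]
  have hinj : InjOn (boundaryTransition e e') s := by
    intro y hy z hz' hyz
    have h1 := hinv y hy
    rw [hyz, hinv z hz'] at h1
    have h2 := e.symm.injOn hz'.1 hy.1 h1
    rw [← tailL_zeroCons y, ← h2, tailL_zeroCons]
  have himg : boundaryTransition e e' '' s
      = boundaryDomain e' ∩ {y | e'.symm (zeroCons y) ∈ A} := by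
    refine Subset.antisymm ?_ fun y hy => ?_
    · rintro _ ⟨y, hy, rfl⟩
      refine ⟨?_, ?_⟩
      · rw [boundaryDomain, mem_ofPred_eq, hz y hy]
        exact e'.map_source (hAe' hy.2)
      · rw [mem_ofPred_eq, hinv y hy]
        exact hy.2
    · have h1 := zeroCons_boundaryTransition h' h hM hy.1 (hAe hy.2)
      have h2 : boundaryTransition e' e y ∈ s := by
        refine ⟨?_, ?_⟩
        · rw [boundaryDomain, mem_ofPred_eq, h1]
          exact e.map_source (hAe hy.2)
        · rw [mem_ofPred_eq, h1, e.left_inv (hAe hy.2)]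
          exact hy.2
      refine ⟨_, h2, ?_⟩
      rw [boundaryTransition, h1, e.left_inv (hAe hy.2), e'.right_inv hy.1, tailL_zeroCons]
  rw [← himg, lintegral_image_eq_lintegral_abs_det_fderiv_mul volume hs
    (fun y hy => (hD y hy).hasFDerivWithinAt) hinj]
  refine setLIntegral_congr_fun hs fun y hy => ?_
  rw [hz y hy, hdet y hy, Real.sqrt_mul (sq_nonneg _), Real.sqrt_sq_eq_abs,
    ENNReal.ofReal_mul (abs_nonneg _)]

theorem chartBoundaryVolume_source (g : SmoothMetric d N) (he : e ∈ smoothCharts d N) {A : Set N}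
    (hA : MeasurableSet A) :
    chartBoundaryVolume g e A = chartBoundaryVolume g e (A ∩ e.source) := by
  rw [chartBoundaryVolume_apply g he hA,
    chartBoundaryVolume_apply g he (hA.inter e.open_source.measurableSet)]
  congr 2
  ext y
  constructor
  · exact fun hy => ⟨hy.1, hy.2, e.map_target hy.1⟩
  · exact fun hy => ⟨hy.1, hy.2.1⟩

/-- The Riemannian measure of the boundary is given by boundary charts. -/
theorem restrict_boundaryVolume (g : SmoothMetric d N) (h : IsBoundaryChart M e) (hM : IsClosed M) :
    (boundaryVolume g M).restrict e.source = (chartBoundaryVolume g e).restrict e.source := by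
  have hs := e.open_source.measurableSet
  refine le_antisymm ?_ (Measure.restrict_mono le_rfl (le_iSup₂_of_le e h le_rfl))
  -- A measure that dominates all chart measures bounds their supremum. It may be infinite off the
  -- domain of e, since that part disappears on restriction.
  have hle : boundaryVolume g M ≤ chartBoundaryVolume g e + (⊤ : Measure N).restrict e.sourceᶜ := by
    refine iSup₂_le fun e' h' => Measure.le_iff.2 fun B hB => ?_
    rw [Measure.add_apply, ← measure_inter_add_sdiff B hs]
    refine add_le_add ?_ ?_
    · rw [chartBoundaryVolume_source g h'.1 (hB.inter hs),
        chartBoundaryVolume_eq_of_subset g h' h hM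
          ((hB.inter hs).inter e'.open_source.measurableSet) inter_subset_right
          (inter_subset_left.trans inter_subset_right)]
      exact measure_mono (inter_subset_left.trans inter_subset_left)
    · rw [Measure.restrict_apply hB, ← sdiff_eq]
      exact (le_top : chartBoundaryVolume g e' ≤ ⊤) _
  refine Measure.le_iff.2 fun B hB => ?_
  rw [Measure.restrict_apply hB, Measure.restrict_apply hB]
  refine (hle _).trans ?_
  rw [Measure.add_apply, Measure.restrict_apply (hB.inter hs)]
  have : B ∩ e.source ∩ e.sourceᶜ = ∅ := by
    rw [inter_assoc, inter_compl_self, inter_empty]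
  rw [this, measure_empty, add_zero]

end Measure

end

/-! ### The weighted measure in charts -/

section

variable {d : ℕ} {N : Type*} [TopologicalSpace N]
  [ChartedSpace (EuclideanSpace ℝ (Fin (d + 1))) N] [IsManifold (𝓡 (d + 1)) ∞ N]
  {g : SmoothMetric d N} {e e' : OpenPartialHomeomorph N (EuclideanSpace ℝ (Fin (d + 1)))}
  {M : Set N} {x : N} {p : TangentBundle (𝓡 (d + 1)) N}

theorem measurableSet_inter_preimage_of_continuousOn {X Y : Type*} [TopologicalSpace X]
    [MeasurableSpace X] [BorelSpace X] [TopologicalSpace Y] [MeasurableSpace Y] [BorelSpace Y]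
    {s : Set X} (hs : MeasurableSet s) {f : X → Y} (hf : ContinuousOn f s) {B : Set Y}
    (hB : MeasurableSet B) : MeasurableSet (s ∩ f ⁻¹' B) := by
  have h := measurable_indicator_comp hs hf (measurable_one.indicator hB (f := (1 : Y → ℝ≥0∞)))
  convert h (measurableSet_singleton 1) using 1
  ext y
  by_cases hy : y ∈ s <;> by_cases hy' : f y ∈ B <;> simp [hy, hy', indicator]

theorem isClosed_boundarySM (g : SmoothMetric d N) (M : Set N) : IsClosed (boundarySM g M) :=
  (isClosed_frontier.preimage continuous_base).inter
    (isClosed_eq (continuous_energy g) continuous_const)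

theorem measurableSet_boundarySM (g : SmoothMetric d N) (M : Set N) :
    MeasurableSet (boundarySM g M) := (isClosed_boundarySM g M).measurableSet

/-- The tangent vectors of length strictly between `0` and `1`. -/
def openUnitBundle (g : SmoothMetric d N) : Set (TangentBundle (𝓡 (d + 1)) N) :=
  {p | 0 < g.inner p.1 p.2 p.2 ∧ g.inner p.1 p.2 p.2 < 1}

theorem measurableSet_openUnitBundle (g : SmoothMetric d N) : MeasurableSet (openUnitBundle g) :=
  ((isOpen_lt continuous_const (continuous_energy g)).inter
    (isOpen_lt (continuous_energy g) continuous_const)).measurableSet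

/-- The parametrization of the tangent vectors at boundary points given by a boundary chart. -/
def boundaryParam (g : SmoothMetric d N)
    (e : OpenPartialHomeomorph N (EuclideanSpace ℝ (Fin (d + 1))))
    (w : EuclideanSpace ℝ (Fin d) × Coord d) : TangentBundle (𝓡 (d + 1)) N :=
  cotChartInv g e (zeroCons w.1, w.2)

theorem continuousOn_boundaryParam (g : SmoothMetric d N) (he : e ∈ smoothCharts d N) :
    ContinuousOn (boundaryParam g e) (boundaryDomain e ×ˢ univ) :=
  (continuousOn_cotChartInv g he).comp
    ((continuous_zeroCons.comp continuous_fst).prodMk continuous_snd).continuousOn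
    fun _ hw => ⟨hw.1, mem_univ _⟩

/-- The part of the cone over a set `A` of unit vectors that consists of short vectors, in a
boundary chart. -/
def boundaryCone (g : SmoothMetric d N)
    (e : OpenPartialHomeomorph N (EuclideanSpace ℝ (Fin (d + 1))))
    (A : Set (TangentBundle (𝓡 (d + 1)) N)) : Set (EuclideanSpace ℝ (Fin d) × Coord d) :=
  (boundaryDomain e ×ˢ univ) ∩ boundaryParam g e ⁻¹' (openUnitBundle g ∩ unitize g ⁻¹' A)

theorem measurableSet_boundaryCone (g : SmoothMetric d N) (he : e ∈ smoothCharts d N)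
    {A : Set (TangentBundle (𝓡 (d + 1)) N)} (hA : MeasurableSet A) :
    MeasurableSet (boundaryCone g e A) :=
  measurableSet_inter_preimage_of_continuousOn
    (isOpen_boundaryDomain.measurableSet.prod MeasurableSet.univ) (continuousOn_boundaryParam g he)
    ((measurableSet_openUnitBundle g).inter (measurable_unitize g hA))

/-- The weight converts the area density of the hyperplane into the full volume density times |v⁰|.
For this reason the weighted measure, rather than the unweighted one, is the invariant one. -/
theorem sqrt_boundaryGramDet_mul (hM : IsSmoothDomain d M) (he : IsBoundaryChart M e)
    (hp : p.1 ∈ e.source) (hfr : p.1 ∈ frontier M) :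
    Real.sqrt (boundaryGramDet g e (e p.1)) * |g.inner p.1 (outerNormal g M p.1) p.2|
      = Real.sqrt (gramDet g e (e p.1)) * |normalCoord e p| := by
  have h := sqrt_det_gram_mul_abs_normal (B := toBilin (chartForm g e (e p.1)))
    (ν := chartVector e p.1 (outerNormal g M p.1)) (fun u w => chartMetric_symm g _ u w) ?_ ?_
    (chartVector e p.1 p.2)
  · simp only [toBilin_apply, chartForm_apply, chartMetric_chartVector g he.1 hp] at h
    exact h
  · rw [toBilin_apply, chartForm_apply, chartMetric_chartVector g he.1 hp]
    exact (isOuterUnitNormal_outerNormal g hM hfr).1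
  · intro w hw
    obtain ⟨v, rfl⟩ := exists_chartVector_eq he.1 hp w
    rw [toBilin_apply, chartForm_apply, chartMetric_chartVector g he.1 hp]
    exact ((isOuterUnitNormal_outerNormal g hM hfr).2 e he hp).2 v hw

theorem sqrt_boundaryGramDet_pos (g : SmoothMetric d N) (hM : IsSmoothDomain d M)
    (he : IsBoundaryChart M e) (hx : x ∈ e.source) (hfr : x ∈ frontier M) :
    0 < Real.sqrt (boundaryGramDet g e (e x)) := by
  have h := sqrt_boundaryGramDet_mul (g := g) (p := ⟨x, outerNormal g M x⟩) hM he hx hfr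
  have h1 : g.inner x (outerNormal g M x) (outerNormal g M x) = 1 :=
    (isOuterUnitNormal_outerNormal g hM hfr).1
  have h2 : 0 < Real.sqrt (gramDet g e (e x)) * |normalCoord e ⟨x, outerNormal g M x⟩| :=
    mul_pos (Real.sqrt_pos.2 (gramDet_pos g he.1 (e.map_source hx)))
      (abs_pos.2 (outerNormal_coord_neg hM he hx hfr).ne)
  rw [← h] at h2
  refine (Real.sqrt_nonneg _).lt_of_ne fun h3 => ?_
  rw [← h3, zero_mul] at h2
  exact h2.false

variable [CompactSpace N] [MeasurableSpace N] [BorelSpace N]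

/-- The weighted measure of a set over the domain of a boundary chart. -/
theorem weightedMeasure_apply (hM : IsSmoothDomain d M) (he : IsBoundaryChart M e)
    {A : Set (boundarySM g M)} (hA : MeasurableSet A) (hAe : ∀ p ∈ A, p.1.1 ∈ e.source) :
    weightedMeasure g M A = ((d + 1 : ℕ) : ℝ≥0∞) *
      ∫⁻ w in boundaryCone g e (Subtype.val '' A),
        ENNReal.ofReal |normalCoord e (unitize g (boundaryParam g e w))| := by
  set A' : Set (TangentBundle (𝓡 (d + 1)) N) := Subtype.val '' A
  have hA' : MeasurableSet A' :=
    (MeasurableEmbedding.subtype_coe (measurableSet_boundarySM g M)).measurableSet_image.2 hA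
  have hA'e : A' ⊆ overSource e := by
    rintro _ ⟨p, hp, rfl⟩
    exact hAe p hp
  have hA'fr : ∀ p ∈ A', p.1 ∈ frontier M := by
    rintro _ ⟨p, hp, rfl⟩
    exact p.2.1
  -- The weight |⟨ν, v⟩| in the coordinates of e. This form is visibly measurable over the chart
  -- domain, although ν is chosen pointwise.
  set f : TangentBundle (𝓡 (d + 1)) N → ℝ≥0∞ := fun p =>
    ENNReal.ofReal (Real.sqrt (gramDet g e (e p.1)) * (Real.sqrt (boundaryGramDet g e (e p.1)))⁻¹
      * |normalCoord e p|) with hf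
  set F : TangentBundle (𝓡 (d + 1)) N → ℝ≥0∞ := A'.indicator f with hFdef
  have hbase : ContinuousOn (fun p : TangentBundle (𝓡 (d + 1)) N => e p.1) (overSource e) :=
    e.continuousOn.comp continuous_base.continuousOn fun _ h => h
  have hmaps : MapsTo (fun p : TangentBundle (𝓡 (d + 1)) N => e p.1) (overSource e) e.target :=
    fun p hp => e.map_source hp
  have hF : Measurable F := by
    have h1 : Measurable ((overSource e).indicator f) := by
      have h2 : ContinuousOn (fun p : TangentBundle (𝓡 (d + 1)) N =>
          ((gramDet g e (e p.1), boundaryGramDet g e (e p.1)), normalCoord e p)) (overSource e) :=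
        (((continuousOn_gramDet g he.1).comp hbase hmaps).prodMk
          ((continuousOn_boundaryGramDet g he.1).comp hbase hmaps)).prodMk
          (continuousOn_normalCoord he.1)
      refine measurable_indicator_comp isOpen_overSource.measurableSet h2
        (h := fun r : (ℝ × ℝ) × ℝ => ENNReal.ofReal
          (Real.sqrt r.1.1 * (Real.sqrt r.1.2)⁻¹ * |r.2|)) ?_
      fun_prop
    have h3 : F = A'.indicator ((overSource e).indicator f) := by
      rw [indicator_indicator, inter_eq_left.2 hA'e]
    rw [h3]
    exact h1.indicator hA'
  set J : N → ℝ≥0∞ := fun x => ∫⁻ q, F q ∂(sphereMeasure g x)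
  have hS := measurable_sphereMeasure g
  have hJ : Measurable J := (Measure.measurable_lintegral hF).comp hS
  -- The unit sphere over a point outside the chart does not meet A', so the integral over ∂M
  -- reduces to this chart.
  have hJ0 : ∀ x ∉ e.source, J x = 0 := by
    intro x hx
    obtain ⟨e₁, he₁, hx₁⟩ := exists_smoothChart d x
    simp only [J]
    rw [lintegral_sphereMeasure g he₁ hx₁ hF]
    have : ∀ ξ : Coord d, {p | 0 < g.inner p.1 p.2 p.2 ∧ g.inner p.1 p.2 p.2 < 1}.indicator
        (fun p => F (unitize g p)) (cotChartInv g e₁ (e₁ x, ξ)) = 0 := by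
      intro ξ
      refine indicator_apply_eq_zero.2 fun _ => indicator_of_notMem (fun h => hx ?_) _
      have h1 : e₁.symm (e₁ x) ∈ e.source := hA'e h
      rwa [e₁.left_inv hx₁] at h1
    simp [this]
  have step1 : weightedMeasure g M A = ∫⁻ x, J x ∂(boundaryVolume g M) := by
    rw [weightedMeasure, withDensity_apply _ hA, boundaryMeasure]
    have h1 : ∀ p ∈ A, ENNReal.ofReal |g.inner p.1.1 (outerNormal g M p.1.1) p.1.2| = f p.1 := by
      intro p hp
      have h2 := sqrt_boundaryGramDet_mul (g := g) (p := p.1) hM he (hAe p hp) p.2.1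
      have h3 := sqrt_boundaryGramDet_pos g hM he (hAe p hp) p.2.1
      rw [hf]
      congr 1
      field_simp
      linarith
    rw [setLIntegral_congr_fun hA h1, setLIntegral_subtype (measurableSet_boundarySM g M),
      ← lintegral_indicator hA', Measure.lintegral_bind hS.aemeasurable hF.aemeasurable]
  have step2 : ∫⁻ x, J x ∂(boundaryVolume g M) = ∫⁻ y in boundaryDomain e,
      ENNReal.ofReal (Real.sqrt (boundaryGramDet g e (zeroCons y))) * J (e.symm (zeroCons y)) := by
    have h1 : J = e.source.indicator J := by
      ext x
      by_cases hx : x ∈ e.source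
      · rw [indicator_of_mem hx]
      · rw [indicator_of_notMem hx, hJ0 x hx]
    rw [← lintegral_chartBoundaryVolume g he.1 hJ, h1,
      lintegral_indicator e.open_source.measurableSet,
      lintegral_indicator e.open_source.measurableSet, restrict_boundaryVolume g he hM.1]
  have hcone := measurableSet_boundaryCone g he.1 hA'
  set G : EuclideanSpace ℝ (Fin d) × Coord d → ℝ≥0∞ := (boundaryCone g e A').indicator fun w =>
    ENNReal.ofReal |normalCoord e (unitize g (boundaryParam g e w))|
  have hG : Measurable G := by
    have h1 : Measurable ((overSource e).indicator fun p => ENNReal.ofReal |normalCoord e p|) :=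
      measurable_indicator_comp isOpen_overSource.measurableSet (continuousOn_normalCoord he.1)
        (h := fun r => ENNReal.ofReal |r|) (by fun_prop)
    have h2 := measurable_indicator_comp
      (isOpen_boundaryDomain (e := e) |>.measurableSet.prod MeasurableSet.univ)
      (continuousOn_boundaryParam g he.1) (h1.comp (measurable_unitize g))
    have h3 : G = (boundaryCone g e A').indicator ((boundaryDomain e ×ˢ univ).indicator fun w =>
        ((overSource e).indicator (fun p => ENNReal.ofReal |normalCoord e p|) ∘ unitize g)
          (boundaryParam g e w)) := by
      refine indicator_congr fun w hw => ?_
      rw [indicator_of_mem hw.1, Function.comp_apply, indicator_of_mem (hA'e hw.2.2)]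
    rw [h3]
    exact h2.indicator hcone
  -- The boundary density, the factor 1/√det g of the sphere measure and the quotient of
  -- determinants in the weight cancel, leaving the transversal coordinate of the unit vector.
  have step3 : ∀ y ∈ boundaryDomain e, ENNReal.ofReal (Real.sqrt (boundaryGramDet g e (zeroCons y)))
      * J (e.symm (zeroCons y)) = ((d + 1 : ℕ) : ℝ≥0∞) * ∫⁻ ξ, G (y, ξ) := by
    intro y hy
    simp only [J]
    rw [lintegral_sphereMeasure g he.1 (e.map_target hy) hF, e.right_inv hy, mul_left_comm]
    congr 1
    rw [← mul_assoc, ← ENNReal.ofReal_mul (Real.sqrt_nonneg _),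
      ← lintegral_const_mul' _ _ ENNReal.ofReal_ne_top]
    refine lintegral_congr fun ξ => ?_
    by_cases hm : (y, ξ) ∈ boundaryCone g e A'
    · simp only [G]
      rw [indicator_of_mem hm, indicator_of_mem
        (show cotChartInv g e (zeroCons y, ξ) ∈ {p : TangentBundle (𝓡 (d + 1)) N |
          0 < g.inner p.1 p.2 p.2 ∧ g.inner p.1 p.2 p.2 < 1} from hm.2.1), hFdef,
        indicator_of_mem (show unitize g (cotChartInv g e (zeroCons y, ξ)) ∈ A' from hm.2.2), hf]
      have h1 : e (unitize g (cotChartInv g e (zeroCons y, ξ))).1 = zeroCons y := e.right_inv hy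
      have h2 := sqrt_boundaryGramDet_pos g hM he (e.map_target hy)
        (he.symm_zeroCons_mem_frontier hM.1 hy)
      rw [e.right_inv hy] at h2
      have h3 := Real.sqrt_pos.2 (gramDet_pos g he.1 hy)
      simp only [h1]
      rw [← ENNReal.ofReal_mul (by positivity)]
      congr 1
      change _ = |normalCoord e (unitize g (cotChartInv g e (zeroCons y, ξ)))|
      field_simp
    · simp only [G]
      rw [indicator_of_notMem hm]
      refine mul_eq_zero.2 (Or.inr (indicator_apply_eq_zero.2 fun h1 =>
        indicator_of_notMem (show unitize g (cotChartInv g e (zeroCons y, ξ)) ∉ A' from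
          fun h2 => hm ⟨⟨hy, mem_univ _⟩, h1, h2⟩) _))
  rw [step1, step2, setLIntegral_congr_fun isOpen_boundaryDomain.measurableSet step3,
    ← lintegral_indicator hcone, Measure.volume_eq_prod, lintegral_prod _ hG.aemeasurable,
    lintegral_const_mul' _ _ (ENNReal.natCast_ne_top _),
    ← lintegral_indicator isOpen_boundaryDomain.measurableSet]
  congr 1
  refine lintegral_congr fun y => ?_
  by_cases hy : y ∈ boundaryDomain e
  · rw [indicator_of_mem hy]
  · rw [indicator_of_notMem hy]
    have : ∀ ξ, G (y, ξ) = 0 := fun ξ => indicator_of_notMem (fun h => hy h.1.1) _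
    simp [this]

end

/-! ### The Poincaré map -/

section

/-- Differentiability of a continuous solution of `f(z, τ(z)) = 0`. -/
theorem hasFDerivWithinAt_of_implicit {W : Type*} [NormedAddCommGroup W] [NormedSpace ℝ W]
    {f : W × ℝ → ℝ} {f' : W →L[ℝ] ℝ} {a : ℝ} {τ : W → ℝ} {s : Set W} {w : W}
    (hf : HasFDerivAt f (f'.coprod (ContinuousLinearMap.toSpanSingleton ℝ a)) (w, τ w))
    (ha : a ≠ 0) (hτ : ContinuousWithinAt τ s w) (h0 : ∀ z ∈ s, f (z, τ z) = 0) (hw : w ∈ s) :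
    HasFDerivWithinAt τ (-(a⁻¹ • f')) s w := by
  have ht : Tendsto (fun z => (z, τ z)) (𝓝[s] w) (𝓝 (w, τ w)) :=
    continuousWithinAt_id.prodMk hτ
  have h1 : (fun z => f' (z - w) + a * (τ z - τ w)) =o[𝓝[s] w]
      fun z => (z - w, τ z - τ w) := by
    have h2 := (hasFDerivAt_iff_isLittleO.1 hf).comp_tendsto ht
    refine (h2.neg_left.congr' ?_ (EventuallyEq.refl _ _))
    filter_upwards [self_mem_nhdsWithin] with z hz
    simp [h0 z hz, h0 w hw]
    ring
  have ha' : 0 < |a| := abs_pos.2 ha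
  -- By continuity of τ, the linearization error is at most |a|/2 times the increments. The part
  -- with the increment of τ is absorbed on the left, so τ is Lipschitz at w and the error is of
  -- smaller order than z - w.
  have hO : (fun z => (z - w, τ z - τ w)) =O[𝓝[s] w] fun z => z - w := by
    refine Asymptotics.IsBigO.of_bound (2 * ‖f'‖ / |a| + 2) ?_
    filter_upwards [h1.def (half_pos ha')] with z hz
    have h3 : ‖(z - w, τ z - τ w)‖ ≤ ‖z - w‖ + |τ z - τ w| := by
      rw [Prod.norm_def, Real.norm_eq_abs]
      exact max_le (le_add_of_nonneg_right (abs_nonneg _)) (le_add_of_nonneg_left (norm_nonneg _))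
    have h4 : |a| * |τ z - τ w| ≤ ‖f'‖ * ‖z - w‖ + |a| / 2 * (‖z - w‖ + |τ z - τ w|) := by
      rw [← abs_mul]
      have h5 : a * (τ z - τ w) = (f' (z - w) + a * (τ z - τ w)) - f' (z - w) := by ring
      rw [h5]
      refine (abs_sub _ _).trans ?_
      have h6 := hz.trans (mul_le_mul_of_nonneg_left h3 (half_pos ha').le)
      have h7 := f'.le_opNorm (z - w)
      rw [Real.norm_eq_abs] at h6 h7
      linarith
    have h8 : |τ z - τ w| ≤ (2 * ‖f'‖ / |a| + 1) * ‖z - w‖ := by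
      rw [div_add_one ha'.ne', div_mul_eq_mul_div, le_div_iff₀ ha']
      linarith
    linarith
  have h9 := (h1.const_mul_left a⁻¹).trans_isBigO hO
  rw [hasFDerivWithinAt_iff_isLittleO]
  refine h9.congr_left fun z => ?_
  simp only [neg_apply, smul_apply, smul_eq_mul]
  field_simp
  ring

variable {d : ℕ} {N : Type*} [TopologicalSpace N]
  [ChartedSpace (EuclideanSpace ℝ (Fin (d + 1))) N] [IsManifold (𝓡 (d + 1)) ∞ N]
  {g : SmoothMetric d N} {e e' : OpenPartialHomeomorph N (EuclideanSpace ℝ (Fin (d + 1)))}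
  {M : Set N} {x : N} {p : TangentBundle (𝓡 (d + 1)) N}

/-- The inclusion of the boundary hyperplane in phase space. -/
def boundaryIncl (d : ℕ) : EuclideanSpace ℝ (Fin d) × Coord d →L[ℝ] Coord d × Coord d :=
  (zeroConsL d).prodMap (ContinuousLinearMap.id ℝ (Coord d))

/-- The projection of phase space to the boundary hyperplane. -/
def boundaryProj (d : ℕ) : Coord d × Coord d →L[ℝ] EuclideanSpace ℝ (Fin d) × Coord d :=
  (tailL d).prodMap (ContinuousLinearMap.id ℝ (Coord d))

/-- The coordinate transversal to the boundary hyperplane. -/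
def normalProj (d : ℕ) : Coord d × Coord d →L[ℝ] ℝ :=
  (EuclideanSpace.proj 0 : Coord d →L[ℝ] ℝ).comp (ContinuousLinearMap.fst ℝ _ _)

theorem normalProj_apply (v : Coord d × Coord d) : normalProj d v = v.1 0 := rfl

theorem boundaryIncl_apply (w : EuclideanSpace ℝ (Fin d) × Coord d) :
    boundaryIncl d w = (zeroCons w.1, w.2) := rfl

theorem boundaryProj_apply (v : Coord d × Coord d) : boundaryProj d v = (tailL d v.1, v.2) := rfl

theorem boundaryProj_boundaryIncl (w : EuclideanSpace ℝ (Fin d) × Coord d) :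
    boundaryProj d (boundaryIncl d w) = w :=
  Prod.ext (tailL_zeroCons w.1) rfl

theorem boundaryIncl_boundaryProj {v : Coord d × Coord d} (hv : normalProj d v = 0) :
    boundaryIncl d (boundaryProj d v) = v :=
  Prod.ext (zeroCons_tailL hv) rfl

theorem normalProj_boundaryIncl (w : EuclideanSpace ℝ (Fin d) × Coord d) :
    normalProj d (boundaryIncl d w) = 0 := rfl

theorem normalProj_hamField (g : SmoothMetric d N) (he : e ∈ smoothCharts d N)
    (hp : p.1 ∈ e.source) :
    normalProj d (hamField (chartForm g e) (cotChart g e p)) = normalCoord e p := by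
  rw [normalProj_apply, (isMetricOn_chartForm g he).hamField_fst (e.map_source hp),
    velocity_cotChart g he hp]
  rfl

/-- Preservation of flux: D preserves volume and maps the Hamiltonian field to itself, so the
Jacobian of the induced map of hyperplanes is the quotient of the transversal components of the
field. -/
theorem det_mul_normalProj {D : Coord d × Coord d →L[ℝ] Coord d × Coord d}
    (hD : ∀ h k, symp (D h) (D k) = symp h k)
    {P : EuclideanSpace ℝ (Fin d) × Coord d →L[ℝ] EuclideanSpace ℝ (Fin d) × Coord d}
    {θ : EuclideanSpace ℝ (Fin d) × Coord d →L[ℝ] ℝ} {S S' : Coord d × Coord d} (hS : D S = S')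
    (hP : ∀ w, boundaryIncl d (P w) = D (boundaryIncl d w) + θ w • S') :
    |normalProj d S| = |P.det| * |normalProj d S'| := by
  have h := det_mul_eq_of_transversal (ι := (boundaryIncl d).toLinearMap)
    (pr := (boundaryProj d).toLinearMap) (l := (normalProj d).toLinearMap)
    (e := ((EuclideanSpace.single 0 1 : Coord d), (0 : Coord d))) boundaryProj_boundaryIncl
    normalProj_boundaryIncl
    (by
      refine Prod.ext ?_ rfl
      ext i
      simp [boundaryProj_apply, tailL_apply])
    (by simp [normalProj_apply])
    (fun v => by
      refine Prod.ext ?_ (by simp [boundaryIncl_apply, boundaryProj_apply])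
      ext i
      refine Fin.cases ?_ (fun j => ?_) i
      · simp [boundaryIncl_apply, boundaryProj_apply, normalProj_apply]
      · simp [boundaryIncl_apply, boundaryProj_apply, zeroCons, tailL_apply])
    (D := D.toLinearMap) (P := P.toLinearMap) (θ := θ.toLinearMap) hS hP
  have h2 := congrArg abs h
  rw [abs_mul, abs_mul] at h2
  have h3 : |LinearMap.det D.toLinearMap| = 1 := abs_det_eq_one_of_symp hD
  rw [h3, one_mul] at h2
  rw [mul_comm]
  exact h2

theorem cotChart_boundaryParam (g : SmoothMetric d N) (he : e ∈ smoothCharts d N)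
    {w : EuclideanSpace ℝ (Fin d) × Coord d} (hw : w.1 ∈ boundaryDomain e) :
    cotChart g e (boundaryParam g e w) = boundaryIncl d w := cotChart_cotChartInv g he hw

theorem bscale_sqrt_unitize (hE : 0 < g.inner p.1 p.2 p.2) :
    bscale (Real.sqrt (g.inner p.1 p.2 p.2)) (unitize g p) = p := by
  rw [unitize, bscale_bscale, mul_inv_cancel₀ (Real.sqrt_pos.2 hE).ne', bscale_one]

theorem boundaryParam_boundaryProj (g : SmoothMetric d N) (he : IsBoundaryChart M e)
    (hM : IsClosed M) (hp : p.1 ∈ e.source) (hfr : p.1 ∈ frontier M) :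
    boundaryParam g e (boundaryProj d (cotChart g e p)) = p := by
  have h : boundaryIncl d (boundaryProj d (cotChart g e p)) = cotChart g e p :=
    boundaryIncl_boundaryProj ((he.mem_frontier_iff hM hp).1 hfr)
  change cotChartInv g e (boundaryIncl d (boundaryProj d (cotChart g e p))) = p
  rw [h, cotChartInv_cotChart g he.1 hp]

theorem boundaryProj_mem (he : IsBoundaryChart M e)
    (hM : IsClosed M) (hp : p.1 ∈ e.source) (hfr : p.1 ∈ frontier M) :
    (boundaryProj d (cotChart g e p)).1 ∈ boundaryDomain e := by
  change zeroCons (tailL d (e p.1)) ∈ e.target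
  rw [zeroCons_tailL ((he.mem_frontier_iff hM hp).1 hfr)]
  exact e.map_source hp

variable [T2Space N] [CompactSpace N]

/-- The scattering relation in boundary charts. -/
def poincareMap (g : SmoothMetric d N) (M : Set N)
    (e e' : OpenPartialHomeomorph N (EuclideanSpace ℝ (Fin (d + 1))))
    (w : EuclideanSpace ℝ (Fin d) × Coord d) : EuclideanSpace ℝ (Fin d) × Coord d :=
  boundaryProj d (cotChart g e' (scatter g M (boundaryParam g e w)))

namespace IsConvexNonTrapping

theorem scatter_unitize (H : IsConvexNonTrapping g M) (hp : p.1 ∈ M)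
    (hE : 0 < g.inner p.1 p.2 p.2) : scatter g M (unitize g p) = unitize g (scatter g M p) := by
  rw [unitize, unitize, inner_scatter, H.scatter_bscale hp hE (inv_pos.2 (Real.sqrt_pos.2 hE))]

theorem mem_strictInward_of_unitize {A : Set (TangentBundle (𝓡 (d + 1)) N)}
    (hA : A ⊆ strictInward g M) (hE : 0 < g.inner p.1 p.2 p.2) (hp : unitize g p ∈ A) :
    p ∈ strictInward g M := by
  rw [← bscale_sqrt_unitize hE]
  exact bscale_mem_strictInward (Real.sqrt_pos.2 hE) (hA hp)

/-- The derivative of the Poincaré map. -/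
theorem exists_hasFDerivWithinAt_poincareMap (H : IsConvexNonTrapping g M)
    (he : IsBoundaryChart M e) (he' : IsBoundaryChart M e')
    {A : Set (TangentBundle (𝓡 (d + 1)) N)} (hA : A ⊆ strictInward g M)
    (hA' : ∀ p ∈ A, (scatter g M p).1 ∈ e'.source) {w : EuclideanSpace ℝ (Fin d) × Coord d}
    (hw : w ∈ boundaryCone g e A) :
    ∃ P : EuclideanSpace ℝ (Fin d) × Coord d →L[ℝ] EuclideanSpace ℝ (Fin d) × Coord d,
      HasFDerivWithinAt (poincareMap g M e e') P (boundaryCone g e A) w ∧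
      |normalCoord e (boundaryParam g e w)|
        = |P.det| * |normalCoord e' (scatter g M (boundaryParam g e w))| := by
  have hin : ∀ z ∈ boundaryCone g e A, boundaryParam g e z ∈ strictInward g M := fun z hz =>
    mem_strictInward_of_unitize hA hz.2.1.1 hz.2.2
  have hsrc : ∀ z ∈ boundaryCone g e A, (scatter g M (boundaryParam g e z)).1 ∈ e'.source := by
    intro z hz
    have h1 := hA' _ hz.2.2
    rwa [H.scatter_unitize (H.frontier_subset (hin z hz).1) hz.2.1.1] at h1
  have hsrc0 : ∀ z ∈ boundaryCone g e A, (boundaryParam g e z).1 ∈ e.source := fun z hz =>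
    e.map_target hz.1.1
  set p := boundaryParam g e w
  set q := scatter g M p
  set τ : EuclideanSpace ℝ (Fin d) × Coord d → ℝ := fun z => exitTime g M (boundaryParam g e z)
  obtain ⟨D, hD, hF⟩ := hasSympDerivAt g he.1 he'.1 (t := τ w) (hsrc0 w hw) (hsrc w hw)
  have hDS := apply_hamField_of_hasFDerivAt_chartFlow g he.1 he'.1 (t := τ w) (hsrc0 w hw)
    (hsrc w hw) hF
  set S' := hamField (chartForm g e') (cotChart g e' (geodesicFlow g (τ w) p))
  have hS' : normalProj d S' = normalCoord e' q := normalProj_hamField g he'.1 (hsrc w hw)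
  -- The exit is strictly outward, so the flow crosses the target hyperplane transversally.
  have hne : normalProj d S' ≠ 0 := by
    rw [hS']
    have h1 := H.scatter_strictInward (hin w hw)
    exact ((inner_outerNormal_pos_iff H.smooth he' (hsrc w hw) h1.1).1 h1.2).ne
  rw [cotChart_boundaryParam g he.1 hw.1.1] at hF
  have hG : HasFDerivAt (fun z : (EuclideanSpace ℝ (Fin d) × Coord d) × ℝ =>
      chartFlow g e e' (boundaryIncl d z.1, z.2))
      ((D.comp (boundaryIncl d)).coprod (ContinuousLinearMap.toSpanSingleton ℝ S')) (w, τ w) := by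
    have h1 : HasFDerivAt (fun z : (EuclideanSpace ℝ (Fin d) × Coord d) × ℝ =>
        (boundaryIncl d z.1, z.2))
        ((boundaryIncl d).prodMap (ContinuousLinearMap.id ℝ ℝ)) (w, τ w) :=
      ((boundaryIncl d).prodMap (ContinuousLinearMap.id ℝ ℝ)).hasFDerivAt
    refine (HasFDerivAt.comp (w, τ w) (f := fun z : (EuclideanSpace ℝ (Fin d) × Coord d) × ℝ =>
        (boundaryIncl d z.1, z.2)) hF h1).congr_fderiv ?_
    refine ContinuousLinearMap.ext fun a => ?_
    simp
  have hval : ∀ z ∈ boundaryCone g e A, chartFlow g e e' (boundaryIncl d z, τ z)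
      = cotChart g e' (scatter g M (boundaryParam g e z)) := fun z _ => rfl
  have hτc : ContinuousWithinAt τ (boundaryCone g e A) w := by
    exact ContinuousWithinAt.comp (g := exitTime g M) (f := boundaryParam g e)
      (t := {q : TangentBundle (𝓡 (d + 1)) N | q.1 ∈ frontier M})
      (H.continuousWithinAt_exitTime (hin w hw))
      (((continuousOn_boundaryParam g he.1) w hw.1).mono inter_subset_left)
      (fun z hz => (hin z hz).1)
  have h0 : ∀ z ∈ boundaryCone g e A,
      normalProj d (chartFlow g e e' (boundaryIncl d z, τ z)) = 0 := by
    intro z hz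
    rw [hval z hz]
    exact (he'.mem_frontier_iff H.smooth.1 (hsrc z hz)).1 (H.scatter_strictInward (hin z hz)).1
  set f' := (normalProj d).comp (D.comp (boundaryIncl d))
  have hτ : HasFDerivWithinAt τ (-((normalProj d S')⁻¹ • f')) (boundaryCone g e A) w := by
    refine hasFDerivWithinAt_of_implicit (f := fun z => normalProj d
      (chartFlow g e e' (boundaryIncl d z.1, z.2))) ?_ hne hτc h0 hw
    refine ((normalProj d).hasFDerivAt.comp (w, τ w) hG).congr_fderiv ?_
    refine ContinuousLinearMap.ext fun a => ?_
    simp [f']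
  set θ := -((normalProj d S')⁻¹ • f')
  have hflow : HasFDerivWithinAt (fun z => chartFlow g e e' (boundaryIncl d z, τ z))
      (D.comp (boundaryIncl d) + θ.smulRight S') (boundaryCone g e A) w := by
    refine (HasFDerivAt.comp_hasFDerivWithinAt w (f := fun z => (z, τ z)) hG
      ((hasFDerivWithinAt_id w _).prodMk hτ)).congr_fderiv ?_
    refine ContinuousLinearMap.ext fun a => ?_
    simp
  refine ⟨(boundaryProj d).comp (D.comp (boundaryIncl d) + θ.smulRight S'), ?_, ?_⟩
  · exact (boundaryProj d).hasFDerivAt.comp_hasFDerivWithinAt w hflow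
  · rw [← hS', ← normalProj_hamField g he.1 (hsrc0 w hw)]
    refine det_mul_normalProj hD (θ := θ) hDS fun a => ?_
    -- The derivative θ of the exit time is exactly the correction along S' that brings the image
    -- back to the hyperplane.
    have h1 : normalProj d (D (boundaryIncl d a) + θ a • S') = 0 := by
      rw [map_add, map_smul]
      simp only [θ, f', neg_apply, smul_apply, smul_eq_mul, ContinuousLinearMap.comp_apply]
      field_simp
      ring
    exact boundaryIncl_boundaryProj h1

/-- The weight of a set of inward pointing vectors is preserved by the Poincaré map. -/
theorem lintegral_boundaryCone_scatter (H : IsConvexNonTrapping g M) (he : IsBoundaryChart M e)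
    (he' : IsBoundaryChart M e') {A : Set (TangentBundle (𝓡 (d + 1)) N)} (hAm : MeasurableSet A)
    (hA : A ⊆ strictInward g M) (hA1 : ∀ p ∈ A, g.inner p.1 p.2 p.2 = 1)
    (hAe : ∀ p ∈ A, p.1 ∈ e.source) (hA' : ∀ p ∈ A, (scatter g M p).1 ∈ e'.source) :
    ∫⁻ w in boundaryCone g e A, ENNReal.ofReal |normalCoord e (unitize g (boundaryParam g e w))|
      = ∫⁻ w in boundaryCone g e' (scatter g M '' A),
        ENNReal.ofReal |normalCoord e' (unitize g (boundaryParam g e' w))| := by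
  have hin : ∀ z ∈ boundaryCone g e A, boundaryParam g e z ∈ strictInward g M := fun z hz =>
    mem_strictInward_of_unitize hA hz.2.1.1 hz.2.2
  have hunit : ∀ z ∈ boundaryCone g e A, scatter g M (unitize g (boundaryParam g e z))
      = unitize g (scatter g M (boundaryParam g e z)) := fun z hz =>
    H.scatter_unitize (H.frontier_subset (hin z hz).1) hz.2.1.1
  have hsrc : ∀ z ∈ boundaryCone g e A, (scatter g M (boundaryParam g e z)).1 ∈ e'.source := by
    intro z hz
    have h1 := hA' _ hz.2.2
    rwa [hunit z hz] at h1
  have hfr : ∀ z ∈ boundaryCone g e A, (scatter g M (boundaryParam g e z)).1 ∈ frontier M :=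
    fun z hz => (H.scatter_strictInward (hin z hz)).1
  have hparam : ∀ z ∈ boundaryCone g e A, boundaryParam g e' (poincareMap g M e e' z)
      = scatter g M (boundaryParam g e z) := fun z hz =>
    boundaryParam_boundaryProj g he' H.smooth.1 (hsrc z hz) (hfr z hz)
  choose! P hP hdet using fun w (hw : w ∈ boundaryCone g e A) =>
    H.exists_hasFDerivWithinAt_poincareMap he he' hA hA' hw
  have hinj : InjOn (poincareMap g M e e') (boundaryCone g e A) := by
    intro w hw z hz hwz
    have h1 := hparam w hw
    rw [hwz, hparam z hz] at h1
    -- A strictly inward vector is recovered from its exit vector by reversing, travelling back and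
    -- reversing again.
    have h2 : boundaryParam g e z = boundaryParam g e w := by
      rw [← reverse_reverse (boundaryParam g e z), ← H.scatter_reverse_scatter (hin z hz), h1,
        H.scatter_reverse_scatter (hin w hw), reverse_reverse]
    rw [← boundaryProj_boundaryIncl w, ← cotChart_boundaryParam g he.1 hw.1.1, ← h2,
      cotChart_boundaryParam g he.1 hz.1.1, boundaryProj_boundaryIncl]
  have himg : poincareMap g M e e' '' boundaryCone g e A = boundaryCone g e' (scatter g M '' A) := by
    refine Subset.antisymm ?_ fun w hw => ?_
    · rintro _ ⟨w, hw, rfl⟩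
      refine ⟨⟨boundaryProj_mem he' H.smooth.1 (hsrc w hw) (hfr w hw), mem_univ _⟩, ?_⟩
      rw [mem_preimage, hparam w hw]
      refine ⟨?_, _, hw.2.2, hunit w hw⟩
      rw [openUnitBundle, mem_ofPred_eq, inner_scatter]
      exact hw.2.1
    · obtain ⟨⟨hwd, -⟩, hwE, a, haA, ha⟩ := hw
      set q := boundaryParam g e' w
      set r := Real.sqrt (g.inner q.1 q.2 q.2)
      have hr : 0 < r := Real.sqrt_pos.2 hwE.1
      have haM := H.frontier_subset (hA haA).1
      have ha1 : 0 < g.inner a.1 a.2 a.2 := by rw [hA1 a haA]; exact one_pos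
      -- A point of the image cone is a multiple r of the exit vector of some unit a; by homogeneity
      -- it is the exit vector of r·a.
      have hq : scatter g M (bscale r a) = q := by
        rw [H.scatter_bscale haM ha1 hr, ha]
        exact bscale_sqrt_unitize hwE.1
      have hb : (bscale r a).1 ∈ e.source := hAe a haA
      have hEb : g.inner (bscale r a).1 (bscale r a).2 (bscale r a).2 = g.inner q.1 q.2 q.2 := by
        rw [inner_bscale, hA1 a haA, mul_one, Real.sq_sqrt hwE.1.le]
      have hpar := boundaryParam_boundaryProj g he H.smooth.1 hb (hA haA).1
      refine ⟨boundaryProj d (cotChart g e (bscale r a)), ⟨⟨boundaryProj_mem he H.smooth.1 hb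
        (hA haA).1, mem_univ _⟩, ?_⟩, ?_⟩
      · rw [mem_preimage, hpar]
        refine ⟨?_, ?_⟩
        · rw [openUnitBundle, mem_ofPred_eq, hEb]
          exact hwE
        · have : unitize g (bscale r a) = a := by
            rw [unitize, hEb, bscale_bscale, inv_mul_cancel₀ hr.ne', bscale_one]
          rw [mem_preimage, this]
          exact haA
      · rw [poincareMap, hpar, hq, cotChart_boundaryParam g he'.1 hwd, boundaryProj_boundaryIncl]
  have : (volume : Measure (EuclideanSpace ℝ (Fin d) × Coord d)).IsAddHaarMeasure :=
    Measure.prod.instIsAddHaarMeasure _ _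
  have hcone := measurableSet_boundaryCone g he.1 hAm
  rw [← himg, lintegral_image_eq_lintegral_abs_det_fderiv_mul volume hcone hP hinj]
  refine setLIntegral_congr_fun hcone fun w hw => ?_
  rw [hparam w hw, ← ENNReal.ofReal_mul (abs_nonneg _)]
  congr 1
  -- Speed is preserved, so the normalizing factors agree and only the Jacobian identity remains.
  rw [unitize, unitize, normalCoord_bscale, normalCoord_bscale, inner_scatter, abs_mul, abs_mul,
    hdet w hw]
  ring

end IsConvexNonTrapping

end

/-! ### The scattering relation -/

section

variable {d : ℕ} {N : Type*} [TopologicalSpace N]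
  [ChartedSpace (EuclideanSpace ℝ (Fin (d + 1))) N] [IsManifold (𝓡 (d + 1)) ∞ N]
  [T2Space N] [CompactSpace N]
  {g : SmoothMetric d N} {e e' : OpenPartialHomeomorph N (EuclideanSpace ℝ (Fin (d + 1)))}
  {M : Set N} {x : N} {p : TangentBundle (𝓡 (d + 1)) N}

/-- The unit vectors at boundary points that point strictly into `M`. -/
def unitInward (g : SmoothMetric d N) (M : Set N) : Set (boundarySM g M) :=
  Subtype.val ⁻¹' strictInward g M

/-- The unit vectors at boundary points that point strictly out of `M`. -/
def unitOutward (g : SmoothMetric d N) (M : Set N) : Set (boundarySM g M) :=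
  Subtype.val ⁻¹' strictOutward g M

theorem mem_unitInward {p : boundarySM g M} :
    p ∈ unitInward g M ↔ g.inner p.1.1 (outerNormal g M p.1.1) p.1.2 < 0 :=
  ⟨fun h => h.2, fun h => ⟨p.2.1, h⟩⟩

theorem mem_unitOutward {p : boundarySM g M} :
    p ∈ unitOutward g M ↔ 0 < g.inner p.1.1 (outerNormal g M p.1.1) p.1.2 :=
  ⟨fun h => h.2, fun h => ⟨p.2.1, h⟩⟩

theorem mem_inward {p : boundarySM g M} :
    p ∈ inward g M ↔ g.inner p.1.1 (outerNormal g M p.1.1) p.1.2 ≤ 0 :=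
  neg_nonneg (a := g.inner p.1.1 (outerNormal g M p.1.1) p.1.2)

theorem mem_outward {p : boundarySM g M} :
    p ∈ outward g M ↔ 0 ≤ g.inner p.1.1 (outerNormal g M p.1.1) p.1.2 := Iff.rfl

theorem compl_inward (g : SmoothMetric d N) (M : Set N) : (inward g M)ᶜ = unitOutward g M := by
  ext p
  rw [mem_compl_iff, mem_inward, mem_unitOutward, not_le]

theorem compl_outward (g : SmoothMetric d N) (M : Set N) : (outward g M)ᶜ = unitInward g M := by
  ext p
  rw [mem_compl_iff, mem_outward, mem_unitInward, not_le]

theorem isOpen_unitInward (hM : IsSmoothDomain d M) : IsOpen (unitInward g M) := by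
  refine isOpen_iff_mem_nhds.2 fun p hp => ?_
  obtain ⟨e, he, hx⟩ := hM.2 _ p.2.1
  have h1 : ∀ᶠ q in 𝓝 p, q.1 ∈ overSource e := continuous_subtype_val.continuousAt.eventually
    ((isOpen_overSource (e := e)).mem_nhds hx)
  have h2 : ContinuousAt (fun q : boundarySM g M => normalCoord e q.1) p :=
    ContinuousAt.comp (g := normalCoord e) (f := Subtype.val)
      ((continuousOn_normalCoord he.1).continuousAt ((isOpen_overSource (e := e)).mem_nhds hx))
      continuous_subtype_val.continuousAt
  filter_upwards [h1, h2.eventually (lt_mem_nhds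
    ((inner_outerNormal_neg_iff hM he hx p.2.1).1 hp.2))] with q hq hq'
  exact ⟨q.2.1, (inner_outerNormal_neg_iff hM he hq q.2.1).2 hq'⟩

theorem isOpen_unitOutward (hM : IsSmoothDomain d M) : IsOpen (unitOutward g M) := by
  refine isOpen_iff_mem_nhds.2 fun p hp => ?_
  obtain ⟨e, he, hx⟩ := hM.2 _ p.2.1
  have h1 : ∀ᶠ q in 𝓝 p, q.1 ∈ overSource e := continuous_subtype_val.continuousAt.eventually
    ((isOpen_overSource (e := e)).mem_nhds hx)
  have h2 : ContinuousAt (fun q : boundarySM g M => normalCoord e q.1) p :=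
    ContinuousAt.comp (g := normalCoord e) (f := Subtype.val)
      ((continuousOn_normalCoord he.1).continuousAt ((isOpen_overSource (e := e)).mem_nhds hx))
      continuous_subtype_val.continuousAt
  filter_upwards [h1, h2.eventually (gt_mem_nhds
    ((inner_outerNormal_pos_iff hM he hx p.2.1).1 hp.2))] with q hq hq'
  exact ⟨q.2.1, (inner_outerNormal_pos_iff hM he hq q.2.1).2 hq'⟩

theorem measurableSet_inward (hM : IsSmoothDomain d M) : MeasurableSet (inward g M) := by
  rw [← compl_compl (inward g M), compl_inward]
  exact (isOpen_unitOutward hM).measurableSet.compl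

theorem measurableSet_outward (hM : IsSmoothDomain d M) : MeasurableSet (outward g M) := by
  rw [← compl_compl (outward g M), compl_outward]
  exact (isOpen_unitInward hM).measurableSet.compl

theorem measurable_exitTime (g : SmoothMetric d N) (hM : IsClosed M) :
    Measurable (exitTime g M) :=
  (measurable_of_Iio fun c => (isOpen_travelTime_lt g hM c).measurableSet).ennreal_toReal

theorem measurable_geodesicFlow_oddTravelTime (g : SmoothMetric d N) (hM : IsClosed M) :
    Measurable fun p => geodesicFlow g (2 * oddTravelTime g M p) p := by
  have hrev : Measurable (reverse : TangentBundle (𝓡 (d + 1)) N → _) := by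
    have : (reverse : TangentBundle (𝓡 (d + 1)) N → _) = fun p => bscale (-1) p :=
      funext fun p => reverse_eq_bscale p
    rw [this]
    exact ((continuous_bscale g).comp (continuous_const.prodMk continuous_id)).measurable
  have h1 : Measurable fun p => 2 * oddTravelTime g M p :=
    (((measurable_exitTime g hM).sub ((measurable_exitTime g hM).comp hrev)).div_const
      2).const_mul 2
  exact (continuous_geodesicFlow g).measurable.comp (measurable_id.prodMk h1)

/-! ### The scattering relation as a measure-preserving involution. -/

namespace IsConvexNonTrapping

/-- The reversed vector is outward or tangential, so its travel time vanishes and twice the odd part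
is the full travel time. -/
theorem geodesicFlow_oddTravelTime_of_nonpos (H : IsConvexNonTrapping g M)
    (hp : p ∈ boundarySM g M) (h : g.inner p.1 (outerNormal g M p.1) p.2 ≤ 0) :
    geodesicFlow g (2 * oddTravelTime g M p) p = scatter g M p := by
  have h1 : exitTime g M (reverse p) = 0 := by
    refine H.exitTime_eq_zero hp.1 ?_ ?_
    · rw [inner_reverse_self, hp.2]
      exact one_pos
    · exact (neg_nonneg.2 h).trans_eq (inner_reverse _).symm
  have h2 : 2 * oddTravelTime g M p = exitTime g M p := by
    change 2 * ((exitTime g M p - exitTime g M (reverse p)) / 2) = _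
    rw [h1]
    ring
  rw [h2, scatter]

/-- Now the forward travel time vanishes, and flowing for negative time is travelling with reversed
velocity. -/
theorem geodesicFlow_oddTravelTime_of_nonneg (H : IsConvexNonTrapping g M)
    (hp : p ∈ boundarySM g M) (h : 0 ≤ g.inner p.1 (outerNormal g M p.1) p.2) :
    geodesicFlow g (2 * oddTravelTime g M p) p = reverse (scatter g M (reverse p)) := by
  have h1 : exitTime g M p = 0 := H.exitTime_eq_zero hp.1 (hp.2 ▸ one_pos) h
  have h2 : 2 * oddTravelTime g M p = -exitTime g M (reverse p) := by
    change 2 * ((exitTime g M p - exitTime g M (reverse p)) / 2) = _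
    rw [h1]
    ring
  rw [h2, scatter, geodesicFlow_reverse, reverse_reverse]

theorem geodesicFlow_oddTravelTime_mem (H : IsConvexNonTrapping g M) (hp : p ∈ boundarySM g M) :
    geodesicFlow g (2 * oddTravelTime g M p) p ∈ boundarySM g M := by
  refine ⟨?_, (inner_geodesicFlow g _ p).trans hp.2⟩
  rcases le_total (g.inner p.1 (outerNormal g M p.1) p.2) 0 with h | h
  · rw [H.geodesicFlow_oddTravelTime_of_nonpos hp h]
    exact H.scatter_mem_frontier (H.frontier_subset hp.1) (hp.2 ▸ one_pos)
  · rw [H.geodesicFlow_oddTravelTime_of_nonneg hp h]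
    refine H.scatter_mem_frontier (p := reverse p) (H.frontier_subset hp.1) ?_
    rw [inner_reverse_self, hp.2]
    exact one_pos

theorem coe_scattering (H : IsConvexNonTrapping g M) (p : boundarySM g M) :
    (scattering g M p).1 = geodesicFlow g (2 * oddTravelTime g M p.1) p.1 := by
  rw [scattering, dif_pos (H.geodesicFlow_oddTravelTime_mem p.2)]

theorem coe_scattering_of_unitInward (H : IsConvexNonTrapping g M) {p : boundarySM g M}
    (hp : p ∈ unitInward g M) : (scattering g M p).1 = scatter g M p.1 := by
  rw [H.coe_scattering, H.geodesicFlow_oddTravelTime_of_nonpos p.2 hp.2.le]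

theorem coe_scattering_of_unitOutward (H : IsConvexNonTrapping g M) {p : boundarySM g M}
    (hp : p ∈ unitOutward g M) :
    (scattering g M p).1 = reverse (scatter g M (reverse p.1)) := by
  rw [H.coe_scattering, H.geodesicFlow_oddTravelTime_of_nonneg p.2 hp.2.le]

theorem scattering_mem_unitOutward (H : IsConvexNonTrapping g M) {p : boundarySM g M}
    (hp : p ∈ unitInward g M) : scattering g M p ∈ unitOutward g M := by
  rw [unitOutward, mem_preimage, H.coe_scattering_of_unitInward hp]
  exact H.scatter_strictInward hp

theorem scattering_mem_unitInward (H : IsConvexNonTrapping g M) {p : boundarySM g M}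
    (hp : p ∈ unitOutward g M) : scattering g M p ∈ unitInward g M := by
  rw [unitInward, mem_preimage, H.coe_scattering_of_unitOutward hp]
  exact reverse_mem_strictInward (H.scatter_strictInward (reverse_mem_strictInward hp))

theorem scattering_of_tangential (H : IsConvexNonTrapping g M) {p : boundarySM g M}
    (hp : g.inner p.1.1 (outerNormal g M p.1.1) p.1.2 = 0) : scattering g M p = p := by
  refine Subtype.ext ?_
  rw [H.coe_scattering, H.geodesicFlow_oddTravelTime_of_nonpos p.2 hp.le, scatter,
    H.exitTime_eq_zero p.2.1 (p.2.2 ▸ one_pos) hp.ge, geodesicFlow_zero]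

/-- Travelling back along the same geodesic. Being an involution, α is a bijection whose preimages
are images, and invariance on one half of ∂(SM) gives it on the other. -/
theorem scattering_scattering (H : IsConvexNonTrapping g M) (p : boundarySM g M) :
    scattering g M (scattering g M p) = p := by
  rcases lt_trichotomy (g.inner p.1.1 (outerNormal g M p.1.1) p.1.2) 0 with h | h | h
  · have hp := mem_unitInward.2 h
    refine Subtype.ext ?_
    rw [H.coe_scattering_of_unitOutward (H.scattering_mem_unitOutward hp),
      H.coe_scattering_of_unitInward hp, H.scatter_reverse_scatter hp, reverse_reverse]
  · rw [H.scattering_of_tangential h, H.scattering_of_tangential h]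
  · have hp := mem_unitOutward.2 h
    refine Subtype.ext ?_
    rw [H.coe_scattering_of_unitInward (H.scattering_mem_unitInward hp),
      H.coe_scattering_of_unitOutward hp,
      H.scatter_reverse_scatter (reverse_mem_strictInward hp), reverse_reverse]

theorem mapsTo_scattering_inward (H : IsConvexNonTrapping g M) :
    MapsTo (scattering g M) (inward g M) (outward g M) := fun p hp => by
  rcases (mem_inward.1 hp).lt_or_eq with h | h
  · exact (mem_unitOutward.1 (H.scattering_mem_unitOutward (mem_unitInward.2 h))).le
  · rw [H.scattering_of_tangential h]
    exact h.ge

theorem mapsTo_scattering_outward (H : IsConvexNonTrapping g M) :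
    MapsTo (scattering g M) (outward g M) (inward g M) := fun p hp => by
  rcases (mem_outward.1 hp).lt_or_eq with h | h
  · exact mem_inward.2
      (mem_unitInward.1 (H.scattering_mem_unitInward (mem_unitOutward.2 h))).le
  · rw [H.scattering_of_tangential h.symm]
    exact mem_inward.2 h.ge

theorem measurable_scattering (H : IsConvexNonTrapping g M) : Measurable (scattering g M) := by
  have h : Measurable fun p : boundarySM g M => (scattering g M p).1 := by
    simp only [H.coe_scattering]
    exact (measurable_geodesicFlow_oddTravelTime g H.smooth.1).comp measurable_subtype_coe
  exact h.subtype_mk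

variable [MeasurableSpace N] [BorelSpace N]

/-- One boundary chart at each end suffices to write both sides as integrals over cones, where the
Poincaré map applies. -/
theorem weightedMeasure_preimage_scattering (H : IsConvexNonTrapping g M)
    (he : IsBoundaryChart M e) (he' : IsBoundaryChart M e') {B : Set (boundarySM g M)}
    (hB : MeasurableSet B) (hBO : B ⊆ unitOutward g M) (hBe' : ∀ q ∈ B, q.1.1 ∈ e'.source)
    (hBe : ∀ q ∈ B, (scattering g M q).1.1 ∈ e.source) :
    weightedMeasure g M (scattering g M ⁻¹' B ∩ unitInward g M) = weightedMeasure g M B := by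
  set A := scattering g M ⁻¹' B ∩ unitInward g M with hA
  have hAm : MeasurableSet A :=
    (H.measurable_scattering hB).inter (isOpen_unitInward H.smooth).measurableSet
  have himg : scatter g M '' (Subtype.val '' A) = Subtype.val '' B := by
    rw [image_image]
    refine Subset.antisymm ?_ ?_
    · rintro _ ⟨p, hp, rfl⟩
      exact ⟨_, hp.1, H.coe_scattering_of_unitInward hp.2⟩
    · rintro _ ⟨q, hq, rfl⟩
      have h1 := H.scattering_mem_unitInward (hBO hq)
      refine ⟨scattering g M q, ⟨?_, h1⟩, ?_⟩
      · rw [mem_preimage, H.scattering_scattering]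
        exact hq
      · exact (H.coe_scattering_of_unitInward h1).symm.trans
          (congrArg Subtype.val (H.scattering_scattering q))
  rw [weightedMeasure_apply H.smooth he' hB hBe', weightedMeasure_apply H.smooth he hAm, ← himg,
    H.lintegral_boundaryCone_scatter he he'
      ((MeasurableEmbedding.subtype_coe (measurableSet_boundarySM g M)).measurableSet_image.2 hAm)]
  · rintro _ ⟨p, hp, rfl⟩
    exact hp.2
  · rintro _ ⟨p, hp, rfl⟩
    exact p.2.2
  · rintro _ ⟨p, hp, rfl⟩
    have := hBe _ hp.1
    rwa [H.scattering_scattering] at this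
  · rintro _ ⟨p, hp, rfl⟩
    rw [← H.coe_scattering_of_unitInward hp.2]
    exact hBe' _ hp.1
  · intro p hp
    have := hBe _ hp.1
    rwa [H.scattering_scattering] at this

/-- Compactness of ∂M yields finitely many boundary charts. The pairs of a chart at q and a chart at
α(q) give a finite measurable cover, and measures may be compared on its pieces. -/
theorem map_scattering_restrict_unitInward (H : IsConvexNonTrapping g M) :
    ((weightedMeasure g M).restrict (unitInward g M)).map (scattering g M)
      = (weightedMeasure g M).restrict (unitOutward g M) := by
  choose E hE hxE using fun x : frontier M => H.smooth.2 x x.2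
  obtain ⟨t, ht⟩ := (isClosed_frontier (s := M)).isCompact.elim_nhds_subcover'
    (fun x hx => (E ⟨x, hx⟩).source) fun x hx => (E ⟨x, hx⟩).open_source.mem_nhds (hxE ⟨x, hx⟩)
  have hα := H.measurable_scattering
  have hcov : ⋃ i : t × t, {q : boundarySM g M | q.1.1 ∈ (E i.1.1).source ∧
      (scattering g M q).1.1 ∈ (E i.2.1).source} = univ := by
    refine eq_univ_of_forall fun q => ?_
    obtain ⟨a, ha, ha'⟩ := mem_iUnion₂.1 (ht q.2.1)
    obtain ⟨b, hb, hb'⟩ := mem_iUnion₂.1 (ht (scattering g M q).2.1)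
    exact mem_iUnion.2 ⟨(⟨a, ha⟩, ⟨b, hb⟩), ha', hb'⟩
  refine (Measure.ext_iff_of_iUnion_eq_univ hcov).2 fun i => Measure.ext fun B hB => ?_
  set s := {q : boundarySM g M | q.1.1 ∈ (E i.1.1).source ∧
      (scattering g M q).1.1 ∈ (E i.2.1).source}
  have hopen : ∀ a, MeasurableSet {q : boundarySM g M | q.1.1 ∈ (E a).source} := fun a =>
    ((E a).open_source.preimage (continuous_base.comp continuous_subtype_val)).measurableSet
  have hs : MeasurableSet s := (hopen _).inter (hα (hopen _))
  have hO := (isOpen_unitOutward (g := g) H.smooth).measurableSet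
  have hI := (isOpen_unitInward (g := g) H.smooth).measurableSet
  rw [Measure.restrict_apply hB, Measure.restrict_apply hB, Measure.map_apply hα (hB.inter hs),
    Measure.restrict_apply (hα (hB.inter hs)), Measure.restrict_apply (hB.inter hs),
    ← H.weightedMeasure_preimage_scattering (e := E i.2.1) (e' := E i.1.1) (hE _) (hE _)
      ((hB.inter hs).inter hO) inter_subset_right (fun q hq => hq.1.2.1)
      fun q hq => hq.1.2.2]
  congr 1
  ext p
  exact ⟨fun h => ⟨⟨h.1, H.scattering_mem_unitOutward h.2⟩, h.2⟩, fun h => ⟨h.1.1, h.2⟩⟩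

end IsConvexNonTrapping

/-- The density |⟨ν, v⟩| vanishes there, so strict and non-strict inequalities define the same sets
up to null sets. -/
theorem weightedMeasure_tangential [MeasurableSpace N] (hM : IsSmoothDomain d M) :
    weightedMeasure g M (inward g M ∩ outward g M) = 0 := by
  have hT := (measurableSet_inward (g := g) hM).inter (measurableSet_outward (g := g) hM)
  rw [weightedMeasure, withDensity_apply _ hT]
  refine (setLIntegral_congr_fun hT fun p hp => ?_).trans (lintegral_zero)
  rw [le_antisymm (mem_inward.1 hp.1) hp.2, abs_zero, ENNReal.ofReal_zero]

theorem unitInward_ae_eq [MeasurableSpace N] (hM : IsSmoothDomain d M) :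
    (unitInward g M : Set (boundarySM g M)) =ᵐ[weightedMeasure g M] inward g M := by
  refine (LE.le.eventuallyLE fun p hp => ?_).antisymm (ae_le_set.2 ?_)
  · exact mem_inward.2 (mem_unitInward.1 hp).le
  · rw [← compl_outward, sdiff_compl]
    exact weightedMeasure_tangential hM

theorem unitOutward_ae_eq [MeasurableSpace N] (hM : IsSmoothDomain d M) :
    (unitOutward g M : Set (boundarySM g M)) =ᵐ[weightedMeasure g M] outward g M := by
  refine (LE.le.eventuallyLE fun p hp => ?_).antisymm (ae_le_set.2 ?_)
  · exact (mem_unitOutward.1 hp).le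
  · rw [← compl_inward, sdiff_compl, inter_comm]
    exact weightedMeasure_tangential hM

theorem IsConvexNonTrapping.measurePreserving_scattering [MeasurableSpace N] [BorelSpace N]
    (H : IsConvexNonTrapping g M) :
    MeasurePreserving (scattering g M) ((weightedMeasure g M).restrict (inward g M))
      ((weightedMeasure g M).restrict (outward g M)) := by
  refine ⟨H.measurable_scattering, ?_⟩
  rw [← Measure.restrict_congr_set (unitInward_ae_eq H.smooth),
    ← Measure.restrict_congr_set (unitOutward_ae_eq H.smooth),
    H.map_scattering_restrict_unitInward]

/-- Push the invariance on strictly inward vectors forward once more and use that α is an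
involution. -/
theorem IsConvexNonTrapping.measurePreserving_scattering_unitOutward [MeasurableSpace N]
    [BorelSpace N] (H : IsConvexNonTrapping g M) :
    MeasurePreserving (scattering g M) ((weightedMeasure g M).restrict (unitOutward g M))
      ((weightedMeasure g M).restrict (inward g M)) := by
  refine ⟨H.measurable_scattering, ?_⟩
  rw [← H.map_scattering_restrict_unitInward,
    Measure.map_map H.measurable_scattering H.measurable_scattering,
    (funext H.scattering_scattering : scattering g M ∘ scattering g M = id), Measure.map_id,
    Measure.restrict_congr_set (unitInward_ae_eq H.smooth)]

end

/-! ### The continuation operators -/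

section

variable {d : ℕ} {N : Type*} [TopologicalSpace N]
  [ChartedSpace (EuclideanSpace ℝ (Fin (d + 1))) N] [IsManifold (𝓡 (d + 1)) ∞ N]
  [T2Space N] [CompactSpace N] [MeasurableSpace N] [BorelSpace N]
  {g : SmoothMetric d N} {M : Set N} {ε : ℝ}

theorem continuation_ae_eq_inward (hM : IsSmoothDomain d M) (ε : ℝ) (w : boundarySM g M → ℝ) :
    continuation g M ε w =ᵐ[(weightedMeasure g M).restrict (inward g M)] w := by
  filter_upwards [ae_restrict_mem (measurableSet_inward hM)] with p hp
  exact if_pos hp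

theorem continuation_ae_eq_compl_inward (hM : IsSmoothDomain d M) (ε : ℝ)
    (w : boundarySM g M → ℝ) :
    continuation g M ε w =ᵐ[(weightedMeasure g M).restrict (inward g M)ᶜ]
      fun p => ε * w (scattering g M p) := by
  filter_upwards [ae_restrict_mem (measurableSet_inward hM).compl] with p hp
  exact if_neg hp

/-- A linear operation on functions that multiplies the squares of `L²` norms by a constant induces
a bounded operator on `L²`. -/
theorem exists_continuousLinearMap_Lp {X : Type*} [MeasurableSpace X] {μ ν : Measure X}
    (T : (X → ℝ) →ₗ[ℝ] X → ℝ) (hT : ∀ u v, u =ᵐ[ν] v → T u =ᵐ[μ] T v)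
    (hm : ∀ u, MemLp u 2 ν → MemLp (T u) 2 μ) (c : ℝ≥0∞)
    (hc : ∀ u, MemLp u 2 ν → eLpNorm (T u) 2 μ ^ 2 = c * eLpNorm u 2 ν ^ 2) :
    ∃ A : Lp ℝ 2 ν →L[ℝ] Lp ℝ 2 μ, (∀ u (hu : MemLp u 2 ν), A (hu.toLp u) =ᵐ[μ] T u) ∧
      ∀ u, ‖A u‖ = Real.sqrt c.toReal * ‖u‖ := by
  let L : Lp ℝ 2 ν →ₗ[ℝ] Lp ℝ 2 μ :=
    { toFun := fun u => (hm u (Lp.memLp u)).toLp (T u)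
      map_add' := fun u v => by
        rw [← MemLp.toLp_add]
        refine MemLp.toLp_congr _ _ ((hT _ _ (Lp.coeFn_add u v)).trans ?_)
        rw [map_add]
      map_smul' := fun a u => by
        rw [RingHom.id_apply, ← MemLp.toLp_const_smul]
        refine MemLp.toLp_congr _ _ ((hT _ _ (Lp.coeFn_smul a u)).trans ?_)
        rw [map_smul] }
  have hL : ∀ u, ‖L u‖ = Real.sqrt c.toReal * ‖u‖ := fun u => by
    have h := congrArg ENNReal.toReal (hc u (Lp.memLp u))
    rw [ENNReal.toReal_pow, ENNReal.toReal_mul, ENNReal.toReal_pow] at h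
    refine (pow_left_inj₀ (norm_nonneg _)
      (mul_nonneg (Real.sqrt_nonneg _) (norm_nonneg _)) two_ne_zero).1 ?_
    rw [mul_pow, Real.sq_sqrt ENNReal.toReal_nonneg, Lp.norm_def u, ← h]
    exact congrArg (· ^ 2) (Lp.norm_toLp _ (hm u (Lp.memLp u)))
  exact ⟨L.mkContinuous (Real.sqrt c.toReal) fun u => (hL u).le, fun u hu =>
    (MemLp.coeFn_toLp (hm _ (Lp.memLp (hu.toLp u)))).trans (hT _ _ hu.coeFn_toLp), hL⟩

/-- The continuation of functions as a linear map. -/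
def continuationₗ (g : SmoothMetric d N) (M : Set N) (ε : ℝ) :
    (boundarySM g M → ℝ) →ₗ[ℝ] boundarySM g M → ℝ where
  toFun := continuation g M ε
  map_add' u v := by
    ext p
    by_cases hp : p ∈ inward g M <;> simp [continuation, hp, mul_add]
  map_smul' c u := by
    ext p
    by_cases hp : p ∈ inward g M <;> simp [continuation, hp, mul_left_comm]

namespace IsConvexNonTrapping

theorem measurePreserving_scattering_compl_inward (H : IsConvexNonTrapping g M) :
    MeasurePreserving (scattering g M) ((weightedMeasure g M).restrict (inward g M)ᶜ)
      ((weightedMeasure g M).restrict (inward g M)) := by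
  rw [compl_inward]
  exact H.measurePreserving_scattering_unitOutward

/-- A measure-preserving map pulls null sets back to null sets, so the continuation depends only on
the class of w. -/
theorem continuation_congr (H : IsConvexNonTrapping g M) {w w' : boundarySM g M → ℝ}
    (h : w =ᵐ[(weightedMeasure g M).restrict (inward g M)] w') :
    continuation g M ε w =ᵐ[weightedMeasure g M] continuation g M ε w' := by
  refine ae_of_ae_restrict_of_ae_restrict_compl (inward g M) ?_ ?_
  · exact ((continuation_ae_eq_inward H.smooth ε w).trans h).trans
      (continuation_ae_eq_inward H.smooth ε w').symm
  · refine (continuation_ae_eq_compl_inward H.smooth ε w).trans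
      (EventuallyEq.trans ?_ (continuation_ae_eq_compl_inward H.smooth ε w').symm)
    filter_upwards [H.measurePreserving_scattering_compl_inward.quasiMeasurePreserving.ae h]
      with p hp
    rw [hp]

theorem memLp_continuation (H : IsConvexNonTrapping g M) {w : boundarySM g M → ℝ}
    (hw : MemLp w 2 ((weightedMeasure g M).restrict (inward g M))) :
    MemLp (continuation g M ε w) 2 (weightedMeasure g M) := by
  classical
  have h := MemLp.piecewise (measurableSet_inward H.smooth) hw
    ((hw.comp_measurePreserving H.measurePreserving_scattering_compl_inward).const_mul ε)
  convert h using 1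
  ext p
  by_cases hp : p ∈ inward g M <;> simp [continuation, piecewise, hp]

/-- The inward half contributes ‖w‖², and its complement contributes ‖w∘α‖² = ‖w‖² because α
preserves the measure and |ε| = 1. -/
theorem eLpNorm_continuation (H : IsConvexNonTrapping g M) (hε : ε = 1 ∨ ε = -1)
    {w : boundarySM g M → ℝ} (hw : MemLp w 2 ((weightedMeasure g M).restrict (inward g M))) :
    eLpNorm (continuation g M ε w) 2 (weightedMeasure g M) ^ 2
      = 2 * eLpNorm w 2 ((weightedMeasure g M).restrict (inward g M)) ^ 2 := by
  have hsq : ∀ (f : boundarySM g M → ℝ) (μ : Measure (boundarySM g M)),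
      eLpNorm f 2 μ ^ 2 = ∫⁻ p, ‖f p‖ₑ ^ 2 ∂μ := fun f μ => by
    have := eLpNorm_nnreal_pow_eq_lintegral (f := f) (μ := μ) (p := 2) two_ne_zero
    simpa only [NNReal.coe_ofNat, ENNReal.coe_ofNat, ENNReal.rpow_ofNat] using this
  have hε' : ‖ε‖ₑ = 1 := by rcases hε with rfl | rfl <;> simp
  have h1 : eLpNorm (continuation g M ε w) 2 ((weightedMeasure g M).restrict (inward g M))
      = eLpNorm w 2 ((weightedMeasure g M).restrict (inward g M)) :=
    eLpNorm_congr_ae (continuation_ae_eq_inward H.smooth ε w)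
  have h2 : eLpNorm (continuation g M ε w) 2 ((weightedMeasure g M).restrict (inward g M)ᶜ)
      = eLpNorm w 2 ((weightedMeasure g M).restrict (inward g M)) := by
    rw [eLpNorm_congr_ae (continuation_ae_eq_compl_inward H.smooth ε w),
      ← eLpNorm_comp_measurePreserving hw.1 H.measurePreserving_scattering_compl_inward]
    refine eLpNorm_congr_enorm_ae (ae_of_all _ fun p => ?_)
    rw [enorm_mul, hε', one_mul, Function.comp_apply]
  rw [hsq, ← lintegral_add_compl _ (measurableSet_inward H.smooth), ← hsq, ← hsq, h1, h2, two_mul]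

/-- The continuation operator on `L²`. -/
theorem exists_continuationOperator (H : IsConvexNonTrapping g M) (hε : ε = 1 ∨ ε = -1) :
    ∃ A : Lp ℝ 2 ((weightedMeasure g M).restrict (inward g M)) →L[ℝ]
        Lp ℝ 2 (weightedMeasure g M),
      (∀ (w : boundarySM g M → ℝ)
        (hw : MemLp w 2 ((weightedMeasure g M).restrict (inward g M))),
          A (hw.toLp w) =ᵐ[weightedMeasure g M] continuation g M ε w) ∧
      ∀ w, ‖A w‖ = Real.sqrt 2 * ‖w‖ := by
  have h := exists_continuousLinearMap_Lp (continuationₗ g M ε)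
    (fun u v h => H.continuation_congr h) (fun u h => H.memLp_continuation h) 2
    fun u h => H.eLpNorm_continuation hε h
  rwa [ENNReal.toReal_ofNat] at h

end IsConvexNonTrapping

end

end GeodesicScattering

end

/-! ### The theorem. -/

theorem mainTheorem8 (d : ℕ) (hd : 1 ≤ d) (N : Type*) [TopologicalSpace N] [T2Space N]
    [CompactSpace N] [ChartedSpace (EuclideanSpace ℝ (Fin (d + 1))) N]
    [IsManifold (𝓡 (d + 1)) ∞ N] [MeasurableSpace N] [BorelSpace N]
    (g : SmoothMetric d N) (M : Set N) (hM : IsSmoothDomain d M)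
    (hconv : HasStrictlyConvexBoundary g M) (hnt : IsNonTrapping g M) :
    -- the scattering relation is well defined and exchanges inward and outward vectors
    (∀ p : boundarySM g M,
      geodesicFlow g (2 * oddTravelTime g M p.1) p.1 ∈ boundarySM g M) ∧
    MapsTo (scattering g M) (inward g M) (outward g M) ∧
    MapsTo (scattering g M) (outward g M) (inward g M) ∧
    -- it carries the measure of the inward vectors to the measure of the outward vectors
    MeasurePreserving (scattering g M) ((weightedMeasure g M).restrict (inward g M))
      ((weightedMeasure g M).restrict (outward g M)) ∧
    -- the even and odd continuations are bounded operators, and isometric up to the factor √2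
    ∀ ε : ℝ, ε = 1 ∨ ε = -1 →
      ∃ A : Lp ℝ 2 ((weightedMeasure g M).restrict (inward g M)) →L[ℝ]
          Lp ℝ 2 (weightedMeasure g M),
        (∀ (w : boundarySM g M → ℝ)
          (hw : MemLp w 2 ((weightedMeasure g M).restrict (inward g M))),
            A (hw.toLp w) =ᵐ[weightedMeasure g M] continuation g M ε w) ∧
        ∀ w, ‖A w‖ = Real.sqrt 2 * ‖w‖ := by
  have H : IsConvexNonTrapping g M := ⟨hM, hconv, hnt⟩
  exact ⟨fun p => H.geodesicFlow_oddTravelTime_mem p.2, H.mapsTo_scattering_inward,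
    H.mapsTo_scattering_outward, H.measurePreserving_scattering,
    fun ε hε => H.exists_continuationOperator hε⟩
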